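/- **Setting.** Let $n\ge 2$ and $\Gamma_n=\{\lambda\in\mathbb{R}^n : \lambda_i>0 \text{ for all } i\}$. Let $\Gamma\subsetneq\mathbb{R}^n$ be a non-empty open cone with vertex at the origin ($t\lambda\in\Gamma$ for $t>0$, $\lambda\in\Gamma$) that is symmetric (invariant under permutations of the coordinates) and satisfies $\Gamma+\Gamma_n\subset\Gamma$. Put $\lambda^*=(1,-1,\ldots,-1)\in\mathbb{R}^n$. For a $C^2$ function $\varphi$ let $$A[\varphi]=e^{-2\varphi}\Big(-\nabla^2\varphi+\nabla\varphi\otimes\nabla\varphi-\tfrac12|\nabla\varphi|^2I\Big),$$ and let $\lambda(M)$ denote the vector of eigenvalues of a real symmetric matrix $M$ (the order does not matter, as $\Gamma$ is symmetric). A function $v:\mathbb{R}^n\to\mathbb{R}$ is a *viscosity solution* of $\lambda(A[v])\in\partial\Gamma$ in $\mathbb{R}^n$ if it is continuous and, for every $x_0\in\mathbb{R}^n$ and every $\varphi$ of class $C^2$ near $x_0$ with $\varphi(x_0)=v(x_0)$: if $\varphi\le v$ near $x_0$, then $\lambda(A[\varphi](x_0))\in\overline\Gamma$; and if $\varphi\ge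 v$ near $x_0$, then $\lambda(A[\varphi](x_0))\in\mathbb{R}^n\setminus\Gamma$. It is a *viscosity solution* of $\lambda(-A[v])\in\partial\Gamma$ in $\mathbb{R}^n$ if it is continuous and, for all such $x_0,\varphi$: if $\varphi\ge v$ near $x_0$, then $\lambda(-A[\varphi](x_0))\in\overline\Gamma$; and if $\varphi\le v$ near $x_0$, then $\lambda(-A[\varphi](x_0))\in\mathbb{R}^n\setminus\Gamma$. **Theorem.** 1. If $\lambda^*\notin\partial\Gamma$, then every continuous viscosity solution of $\lambda(A[v])\in\partial\Gamma$ in $\mathbb{R}^n$ is constant. 2. (Equivalent form.) If $-\lambda^*\notin\partial\Gamma$, then every continuous viscosity solution of $\lambda(-A[v])\in\partial\Gamma$ in $\mathbb{R}^n$ is constant. 3. (Optimality.) If $\lambda^*\in\partial\Gamma$, then every linear function $v:\mathbb{R}^n\to\mathbb{R}$ is a viscosity solution of $\lambda(A[v])\in\partial\Gamma$ in $\mathbb{R}^n$; in particular there is a non-constant continuous viscosity solution. Likewise, if $-\lambda^*\in\partial\Gamma$, then every linear function is a viscosity solution of $\lambda(-A[v])\in\partial\Gamma$ in $\mathbb{R}^n$,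 and there is a non-constant continuous viscosity solution. -/

import Mathlib

open Matrix Topology
open scoped Pointwise

namespace MobiusLiouville

/-- The Euclidean space `ℝⁿ`. -/
abbrev E (n : ℕ) : Type := EuclideanSpace ℝ (Fin n)

/-- The positive cone `Γ_n = {λ ∈ ℝⁿ : λ_i > 0 for all i}`. -/
def posCone (n : ℕ) : Set (Fin n → ℝ) := {l | ∀ i, 0 < l i}

/-- The conditions on the cone: `Γ ⊊ ℝⁿ` is a non-empty open symmetric cone with vertex at the
origin, and `Γ + Γ_n ⊆ Γ`. -/
structure IsAdmissibleCone {n : ℕ} (Γ : Set (Fin n → ℝ)) : Prop where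
  nonempty : Γ.Nonempty
  ne_univ : Γ ≠ Set.univ
  isOpen : IsOpen Γ
  symmetric : ∀ σ : Equiv.Perm (Fin n), ∀ l ∈ Γ, l ∘ σ ∈ Γ
  cone : ∀ t : ℝ, 0 < t → ∀ l ∈ Γ, t • l ∈ Γ
  add_posCone : Γ + posCone n ⊆ Γ

/-- The vector `λ* = (1, -1, …, -1)`. -/
def lambdaStar (n : ℕ) : Fin n → ℝ := fun i => if (i : ℕ) = 0 then 1 else -1

/-- The Hessian matrix `∇²v(x)`. -/
noncomputable def hessian {n : ℕ} (v : E n → ℝ) (x : E n) : Matrix (Fin n) (Fin n) ℝ :=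
  Matrix.of fun i j =>
    fderiv ℝ (fderiv ℝ v) x (EuclideanSpace.single i 1) (EuclideanSpace.single j 1)

/-- The Möbius Hessian `A[v] = e^{-2v} (-∇²v + ∇v ⊗ ∇v - ½ |∇v|² I)` at the point `x`. -/
noncomputable def mobiusHessian {n : ℕ} (v : E n → ℝ) (x : E n) : Matrix (Fin n) (Fin n) ℝ :=
  Real.exp (-2 * v x) •
    (-hessian v x + Matrix.vecMulVec (fun i => gradient v x i) (fun i => gradient v x i)
      - ((1 / 2 : ℝ) * ‖gradient v x‖ ^ 2) • (1 : Matrix (Fin n) (Fin n) ℝ))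

theorem hessian_isHermitian {n : ℕ} {v : E n → ℝ} {x : E n} (hv : ContDiffAt ℝ 2 v x) :
    (hessian v x).IsHermitian := by
  have h : IsSymmSndFDerivAt ℝ v x := hv.isSymmSndFDerivAt (by simp)
  ext i j
  simp only [hessian, Matrix.conjTranspose_apply, Matrix.of_apply, star_trivial]
  exact h.eq _ _

/-- `A[v](x)` is a symmetric matrix if `v` is `C²` near `x`. -/
theorem mobiusHessian_isHermitian {n : ℕ} {v : E n → ℝ} {x : E n} (hv : ContDiffAt ℝ 2 v x) :
    (mobiusHessian v x).IsHermitian := by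
  have h := hessian_isHermitian hv
  ext i j
  have hij := h.apply i j
  simp only [star_trivial] at hij
  simp only [mobiusHessian, Matrix.conjTranspose_apply, Matrix.smul_apply, Matrix.sub_apply,
    Matrix.add_apply, Matrix.neg_apply, Matrix.vecMulVec_apply, Matrix.one_apply, star_trivial,
    hij, eq_comm (a := j) (b := i)]
  ring_nf

/-- The vector `λ(A[v](x))` of eigenvalues, repeated according to multiplicity, of the symmetric
matrix `A[v](x)`, for `v` of class `C²` near `x`. -/
noncomputable def eigA {n : ℕ} {v : E n → ℝ} {x : E n} (hv : ContDiffAt ℝ 2 v x) : Fin n → ℝ :=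
  (mobiusHessian_isHermitian hv).eigenvalues

/-- The vector `λ(-A[v](x))` of eigenvalues, repeated according to multiplicity, of the symmetric
matrix `-A[v](x)`, for `v` of class `C²` near `x`. -/
noncomputable def eigNegA {n : ℕ} {v : E n → ℝ} {x : E n} (hv : ContDiffAt ℝ 2 v x) :
    Fin n → ℝ :=
  (mobiusHessian_isHermitian hv).neg.eigenvalues

/-- `φ` touches `v` from below at `x₀`. -/
def TouchesBelow {n : ℕ} (φ v : E n → ℝ) (x₀ : E n) : Prop :=
  φ x₀ = v x₀ ∧ ∀ᶠ x in 𝓝 x₀, φ x ≤ v x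

/-- `φ` touches `v` from above at `x₀`. -/
def TouchesAbove {n : ℕ} (φ v : E n → ℝ) (x₀ : E n) : Prop :=
  φ x₀ = v x₀ ∧ ∀ᶠ x in 𝓝 x₀, v x ≤ φ x

/-- `v` is a viscosity supersolution of `λ(A[v]) ∈ ∂Γ` on `ℝⁿ`, that is, `λ(A[v]) ∈ closure Γ` on
`ℝⁿ` in the viscosity sense. -/
def IsViscositySupersolution {n : ℕ} (Γ : Set (Fin n → ℝ)) (v : E n → ℝ) : Prop :=
  LowerSemicontinuous v ∧
    ∀ (x₀ : E n) (φ : E n → ℝ) (hφ : ContDiffAt ℝ 2 φ x₀),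
      TouchesBelow φ v x₀ → eigA hφ ∈ closure Γ

/-- `v` is a viscosity subsolution of `λ(A[v]) ∈ ∂Γ` on `ℝⁿ`, that is, `λ(A[v]) ∈ ℝⁿ \ Γ` on
`ℝⁿ` in the viscosity sense. -/
def IsViscositySubsolution {n : ℕ} (Γ : Set (Fin n → ℝ)) (v : E n → ℝ) : Prop :=
  UpperSemicontinuous v ∧
    ∀ (x₀ : E n) (φ : E n → ℝ) (hφ : ContDiffAt ℝ 2 φ x₀),
      TouchesAbove φ v x₀ → eigA hφ ∈ Γᶜ

/-- `v` is a viscosity solution of `λ(A[v]) ∈ ∂Γ` on `ℝⁿ`. A viscosity solution takes neither of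
the values `±∞`, since supersolutions take values in `(-∞, ∞]` and subsolutions in `[-∞, ∞)`. -/
def IsViscositySolution {n : ℕ} (Γ : Set (Fin n → ℝ)) (v : E n → ℝ) : Prop :=
  IsViscositySupersolution Γ v ∧ IsViscositySubsolution Γ v

/-- `v` is a viscosity solution of `λ(-A[v]) ∈ ∂Γ` on `ℝⁿ`. As `-A[v]` is increasing in `∇²v`,
`λ(-A[v]) ∈ closure Γ` is tested by functions touching `v` from above, and `λ(-A[v]) ∈ ℝⁿ \ Γ` by
functions touching `v` from below. -/
def IsViscositySolutionNeg {n : ℕ} (Γ : Set (Fin n → ℝ)) (v : E n → ℝ) : Prop :=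
  (UpperSemicontinuous v ∧
    ∀ (x₀ : E n) (φ : E n → ℝ) (hφ : ContDiffAt ℝ 2 φ x₀),
      TouchesAbove φ v x₀ → eigNegA hφ ∈ closure Γ) ∧
  (LowerSemicontinuous v ∧
    ∀ (x₀ : E n) (φ : E n → ℝ) (hφ : ContDiffAt ℝ 2 φ x₀),
      TouchesBelow φ v x₀ → eigNegA hφ ∈ Γᶜ)

/-- `v` is constant on `ℝⁿ`. -/
def IsConstant {n : ℕ} (v : E n → ℝ) : Prop := ∃ c : ℝ, ∀ x, v x = c

end MobiusLiouville

/-!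
In terms of `q = exp (-v) > 0` the matrix `A[v]` is `q ∇²q - ½ |∇q|² I`. Membership of
eigenvalues in `Γ` is expressed through quadratic forms (`InCone`), and the viscosity conditions
through second order superjets (`SuperOn`, `SubOn`). The supersolution condition is invariant under
inversions (`SuperOn.kelvin`).

If `λ* ∈ Γ`, powers of `L - log |z - y|²` with a large exponent are strict supersolutions. Comparing
a solution `q` with them and letting `L → ∞` gives `q y ≤ q x` for all `x` and `y`
(`SubOn.eq_of_lambdaStar_mem`).

If `λ* ∉ closure Γ`, the corresponding strict subsolutions give a maximum principle on punctured
balls (`SuperOn.le_of_sphere`). Applied to the inverted function it shows that `q` grows at most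
quadratically: `β = limsup q / |z|²` is finite. The comparison principle (`comparison`, based on the
theorem on sums `exists_upperJets`, which is proved with sup-convolutions, density points and
Rademacher's theorem) then allows the method of moving spheres: `q` dominates its transform in the
sphere of centre `y` and radius `√a`, as long as `β a ≤ q y` (`kelvin_le`). If `β = 0`, all spheres
can be used, and `q` is constant (`eq_of_growth_zero`).

The case `β > 0`, say `β = 1`, is excluded in `not_quadratic_growth`. The critical spheres at all
centres bound `q w` by `|w|² + ⟨G, w⟩ + o(|w|)` for every supergradient `G` of `q - |·|²`. If `U` is
the span of the differences of these supergradients, then `q - |·|²` is affine in the directions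
orthogonal to `U`, while the inverted function has a concave kink at the origin along `U`. The kink
either yields that `Γ` contains the eigenvalues of forms which are slightly positive on `Uᗮ` and
negative on `U` (`exists_kink`), and then `q` can be touched from below by functions with such
Hessians (`not_subOn_of_affine`); or it improves to a kink in all directions, which is ruled out by
the barrier `-log |x|`, whose Hessian is a multiple of `λ*` (`not_kink`).

The equation for `-A[v]` is the one for `A[v]` with the dual cone `-(ℝⁿ \ closure Γ)`. A linear
function with gradient `p` has `λ(A[v]) = ½ e^{-2v} |p|² λ*`, which proves the optimality.
-/

namespace MobiusLiouville

open scoped RealInnerProductSpace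
open Filter Set Metric

variable {n : ℕ} {Γ : Set (Fin n → ℝ)}

/-! ### The cone on the level of quadratic forms -/

lemma IsAdmissibleCone.add_mem (hΓ : IsAdmissibleCone Γ) {l m : Fin n → ℝ} (hl : l ∈ Γ)
    (hm : ∀ i, 0 < m i) : l + m ∈ Γ :=
  hΓ.add_posCone (Set.add_mem_add hl hm)

/-- By openness, the inclusion `Γ + Γ_n ⊆ Γ` can be strengthened at each point. -/
lemma IsAdmissibleCone.exists_sub_mem (hΓ : IsAdmissibleCone Γ) {l : Fin n → ℝ} (hl : l ∈ Γ) :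
    ∃ ε > 0, (fun i => l i - ε) ∈ Γ := by
  have hc : Continuous fun ε : ℝ => (fun i => l i - ε) := by fun_prop
  have h0 : (fun i => l i - (0 : ℝ)) ∈ Γ := by simpa using hl
  have := hc.continuousAt.preimage_mem_nhds (hΓ.isOpen.mem_nhds h0)
  obtain ⟨ε, hε, h⟩ := Metric.mem_nhds_iff.1 this
  refine ⟨ε / 2, by positivity, h (?_ : ε / 2 ∈ Metric.ball (0 : ℝ) ε)⟩
  rw [Metric.mem_ball, dist_zero_right, Real.norm_eq_abs, abs_of_pos (by positivity)]
  linarith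

lemma IsAdmissibleCone.mono (hΓ : IsAdmissibleCone Γ) {l m : Fin n → ℝ} (hl : l ∈ Γ)
    (hm : ∀ i, l i ≤ m i) : m ∈ Γ := by
  obtain ⟨ε, hε, h⟩ := hΓ.exists_sub_mem hl
  have := hΓ.add_mem h (m := fun i => m i - l i + ε) fun i => by linarith [hm i]
  convert this using 1
  ext i
  simp only [Pi.add_apply]
  ring

lemma IsAdmissibleCone.zero_notMem (hΓ : IsAdmissibleCone Γ) : (0 : Fin n → ℝ) ∉ Γ := by
  intro h0
  refine hΓ.ne_univ (Set.eq_univ_of_forall fun l => ?_)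
  have hc : Continuous fun t : ℝ => t • l := by fun_prop
  have h1 : (0 : ℝ) • l ∈ Γ := by simpa using h0
  obtain ⟨ε, hε, h⟩ := Metric.mem_nhds_iff.1
    (hc.continuousAt.preimage_mem_nhds (hΓ.isOpen.mem_nhds h1))
  have h2 : (ε / 2) • l ∈ Γ := by
    refine h (?_ : ε / 2 ∈ Metric.ball (0 : ℝ) ε)
    rw [Metric.mem_ball, dist_zero_right, Real.norm_eq_abs, abs_of_pos (by positivity)]
    linarith
  have h3 := hΓ.cone (2 / ε) (by positivity) _ h2
  rwa [smul_smul, div_mul_div_comm, mul_comm, div_self (by positivity), one_smul] at h3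

lemma IsAdmissibleCone.mem_of_pos (hΓ : IsAdmissibleCone Γ) {l : Fin n → ℝ}
    (hl : ∀ i, 0 < l i) : l ∈ Γ := by
  obtain ⟨m, hm⟩ := hΓ.nonempty
  obtain ⟨t, ht, h⟩ : ∃ t > 0, ∀ i, t * m i < l i := by
    have hc : ∀ i, ∀ᶠ t in 𝓝[>] (0 : ℝ), t * m i < l i := fun i => by
      have : Tendsto (fun t : ℝ => t * m i) (𝓝[>] 0) (𝓝 (0 * m i)) :=
        ((continuous_id.mul continuous_const).tendsto 0).mono_left nhdsWithin_le_nhds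
      exact this.eventually_lt_const (by simpa using hl i)
    obtain ⟨t, h, ht⟩ := ((eventually_all.2 hc).and self_mem_nhdsWithin).exists
    exact ⟨t, ht, h⟩
  exact hΓ.mono (hΓ.cone t ht m hm) fun i => (h i).le

/-- The closure of an admissible cone consists of the points that enter the cone after every
positive translation along the diagonal. -/
lemma IsAdmissibleCone.mem_closure_iff (hΓ : IsAdmissibleCone Γ) {l : Fin n → ℝ} :
    l ∈ closure Γ ↔ ∀ ε > 0, (fun i => l i + ε) ∈ Γ := by
  constructor
  · intro hl ε hε
    obtain ⟨m, hm, hd⟩ := Metric.mem_closure_iff.1 hl ε hε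
    refine hΓ.mono hm fun i => ?_
    have := (dist_le_pi_dist l m i).trans_lt hd
    rw [Real.dist_eq, abs_lt] at this
    linarith
  · intro h
    rw [Metric.mem_closure_iff]
    intro ε hε
    refine ⟨_, h (ε / 2) (by positivity), ?_⟩
    rw [dist_pi_lt_iff hε]
    intro i
    rw [Real.dist_eq, show l i - (l i + ε / 2) = -(ε / 2) by ring, abs_neg,
      abs_of_pos (by positivity)]
    linarith

/-- `F` lies in the cone: it dominates a quadratic form that is diagonal in some orthonormal basis,
with diagonal entries forming a vector of `Γ`. For a quadratic form `F` this says that its vector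
of eigenvalues lies in `Γ`; the relation is monotone in `F` by definition. -/
def InCone (Γ : Set (Fin n → ℝ)) (F : E n → ℝ) : Prop :=
  ∃ (b : OrthonormalBasis (Fin n) ℝ (E n)) (d : Fin n → ℝ), d ∈ Γ ∧
    ∀ h, ∑ i, d i * ⟪b i, h⟫ ^ 2 ≤ F h

/-- The counterpart of `InCone` for the closure of `Γ`. -/
def InClosedCone (Γ : Set (Fin n → ℝ)) (F : E n → ℝ) : Prop :=
  ∀ ε > 0, InCone Γ fun h => F h + ε * ‖h‖ ^ 2

lemma InCone.mono {F G : E n → ℝ} (hF : InCone Γ F) (h : ∀ x, F x ≤ G x) : InCone Γ G := by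
  obtain ⟨b, d, hd, hb⟩ := hF
  exact ⟨b, d, hd, fun x => (hb x).trans (h x)⟩

lemma InCone.of_mul (hΓ : IsAdmissibleCone Γ) {F G : E n → ℝ} (hF : InCone Γ F) {t : ℝ}
    (ht : 0 < t) (h : ∀ x, t * F x ≤ G x) : InCone Γ G := by
  obtain ⟨b, d, hd, hb⟩ := hF
  refine ⟨b, t • d, hΓ.cone t ht d hd, fun x => le_trans ?_ (h x)⟩
  simp only [Pi.smul_apply, smul_eq_mul, mul_assoc, ← Finset.mul_sum]
  exact mul_le_mul_of_nonneg_left (hb x) ht.le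

lemma sum_sq_inner (b : OrthonormalBasis (Fin n) ℝ (E n)) (h : E n) :
    ∑ i, ⟪b i, h⟫ ^ 2 = ‖h‖ ^ 2 := by
  simpa using b.sum_sq_norm_inner_right h

lemma InCone.exists_sub (hΓ : IsAdmissibleCone Γ) {F : E n → ℝ} (hF : InCone Γ F) :
    ∃ ε > 0, InCone Γ fun h => F h - ε * ‖h‖ ^ 2 := by
  obtain ⟨b, d, hd, hb⟩ := hF
  obtain ⟨ε, hε, h⟩ := hΓ.exists_sub_mem hd
  refine ⟨ε, hε, b, _, h, fun x => ?_⟩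
  simp only [sub_mul, Finset.sum_sub_distrib, ← Finset.mul_sum, sum_sq_inner]
  linarith [hb x]

lemma InClosedCone.mono {F G : E n → ℝ} (hF : InClosedCone Γ F) (h : ∀ x, F x ≤ G x) :
    InClosedCone Γ G :=
  fun ε hε => (hF ε hε).mono fun x => by linarith [h x]

lemma InClosedCone.of_mul (hΓ : IsAdmissibleCone Γ) {F G : E n → ℝ} (hF : InClosedCone Γ F) {t : ℝ}
    (ht : 0 < t) (h : ∀ x, t * F x ≤ G x) : InClosedCone Γ G :=
  fun ε hε => (hF (ε / t) (by positivity)).of_mul hΓ ht fun x => by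
    rw [mul_add, ← mul_assoc, mul_div_cancel₀ _ ht.ne']
    linarith [h x]

lemma InClosedCone.of_forall_add {F : E n → ℝ}
    (h : ∀ ε > 0, InClosedCone Γ fun x => F x + ε * ‖x‖ ^ 2) : InClosedCone Γ F :=
  fun ε hε => (h (ε / 2) (by positivity) (ε / 2) (by positivity)).mono fun x => by
    nlinarith [sq_nonneg ‖x‖]

lemma InCone.comp_isometry {F : E n → ℝ} (hF : InCone Γ F) (R : E n ≃ₗᵢ[ℝ] E n) :
    InCone Γ fun h => F (R h) := by
  obtain ⟨b, d, hd, hb⟩ := hF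
  refine ⟨b.map R.symm, d, hd, fun x => ?_⟩
  simpa [LinearIsometryEquiv.inner_map_eq_flip] using hb (R x)

lemma InClosedCone.comp_isometry {F : E n → ℝ} (hF : InClosedCone Γ F) (R : E n ≃ₗᵢ[ℝ] E n) :
    InClosedCone Γ fun h => F (R h) :=
  fun ε hε => by simpa using (hF ε hε).comp_isometry R

/-- Weyl's monotonicity principle: the ordered eigenvalues are monotone in the quadratic form. -/
lemma le_of_diagonal_le {b b' : OrthonormalBasis (Fin n) ℝ (E n)} {d d' : Fin n → ℝ}
    (hd : Antitone d) (hd' : Antitone d')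
    (h : ∀ x, ∑ i, d i * ⟪b i, x⟫ ^ 2 ≤ ∑ i, d' i * ⟪b' i, x⟫ ^ 2) (i : Fin n) : d i ≤ d' i := by
  -- `x` is orthogonal to `b j` for `j > i` and to `b' j` for `j < i`
  let f : E n →ₗ[ℝ] ({j : Fin n // j ≠ i} → ℝ) :=
    LinearMap.pi fun j => if i < j.1 then (innerₗ (E n) (b j.1)) else (innerₗ (E n) (b' j.1))
  have hdim : Module.finrank ℝ ({j : Fin n // j ≠ i} → ℝ) < Module.finrank ℝ (E n) := by
    rw [Module.finrank_fintype_fun_eq_card, finrank_euclideanSpace, Fintype.card_fin]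
    have := Fintype.card_subtype_lt (p := fun j : Fin n => j ≠ i) (x := i) (by simp)
    simpa using this
  obtain ⟨x, hx, hx0⟩ := (Submodule.ne_bot_iff _).1 (LinearMap.ker_ne_bot_of_finrank_lt (f := f) hdim)
  have hfx : ∀ j, j ≠ i → f x = 0 → (if i < j then ⟪b j, x⟫ else ⟪b' j, x⟫) = 0 := by
    intro j hj hf
    have := congrFun hf ⟨j, hj⟩
    simp only [f, LinearMap.pi_apply, Pi.zero_apply] at this
    split_ifs at this ⊢ with hij <;> simpa using this
  have h1 : d i * ‖x‖ ^ 2 ≤ ∑ j, d j * ⟪b j, x⟫ ^ 2 := by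
    rw [← sum_sq_inner b x, Finset.mul_sum]
    refine Finset.sum_le_sum fun j _ => ?_
    rcases lt_or_ge i j with hij | hij
    · have := hfx j hij.ne' hx
      rw [if_pos hij] at this
      simp [this]
    · exact mul_le_mul_of_nonneg_right (hd hij) (sq_nonneg _)
  have h2 : ∑ j, d' j * ⟪b' j, x⟫ ^ 2 ≤ d' i * ‖x‖ ^ 2 := by
    rw [← sum_sq_inner b' x, Finset.mul_sum]
    refine Finset.sum_le_sum fun j _ => ?_
    rcases lt_or_ge j i with hij | hij
    · have := hfx j hij.ne hx
      rw [if_neg hij.not_gt] at this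
      simp [this]
    · exact mul_le_mul_of_nonneg_right (hd' hij) (sq_nonneg _)
  have h3 : 0 < ‖x‖ ^ 2 := by positivity
  exact le_of_mul_le_mul_right ((h1.trans (h x)).trans h2) h3

lemma exists_perm_antitone (d : Fin n → ℝ) : ∃ σ : Equiv.Perm (Fin n), Antitone (d ∘ σ) := by
  refine ⟨Tuple.sort fun i => -d i, fun i j hij => ?_⟩
  have := Tuple.monotone_sort (fun i => -d i) hij
  simpa using this

lemma sum_comp_perm (b : OrthonormalBasis (Fin n) ℝ (E n)) (d : Fin n → ℝ)
    (σ : Equiv.Perm (Fin n)) (x : E n) :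
    ∑ i, (d ∘ σ) i * ⟪(b.reindex σ.symm) i, x⟫ ^ 2 = ∑ i, d i * ⟪b i, x⟫ ^ 2 := by
  simpa using Equiv.sum_comp σ fun i => d i * ⟪b i, x⟫ ^ 2

/-- For diagonal forms, `InCone` is membership of the vector of diagonal entries in `Γ`. -/
lemma inCone_diagonal_iff (hΓ : IsAdmissibleCone Γ) (b : OrthonormalBasis (Fin n) ℝ (E n))
    (d : Fin n → ℝ) : InCone Γ (fun h => ∑ i, d i * ⟪b i, h⟫ ^ 2) ↔ d ∈ Γ := by
  refine ⟨?_, fun h => ⟨b, d, h, fun x => le_rfl⟩⟩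
  rintro ⟨b', d', hd', h⟩
  obtain ⟨σ, hσ⟩ := exists_perm_antitone d
  obtain ⟨σ', hσ'⟩ := exists_perm_antitone d'
  have key := le_of_diagonal_le (b := b'.reindex σ'.symm) (b' := b.reindex σ.symm) hσ' hσ
    (fun x => by rw [sum_comp_perm, sum_comp_perm]; exact h x)
  have h1 : d ∘ σ ∈ Γ := hΓ.mono (hΓ.symmetric σ' d' hd') key
  have h2 := hΓ.symmetric σ.symm _ h1
  simpa [Function.comp_assoc] using h2

lemma inClosedCone_diagonal_iff (hΓ : IsAdmissibleCone Γ) (b : OrthonormalBasis (Fin n) ℝ (E n))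
    (d : Fin n → ℝ) : InClosedCone Γ (fun h => ∑ i, d i * ⟪b i, h⟫ ^ 2) ↔ d ∈ closure Γ := by
  rw [hΓ.mem_closure_iff]
  refine forall₂_congr fun ε _ => ?_
  rw [← inCone_diagonal_iff hΓ b]
  simp only [add_mul, Finset.sum_add_distrib, ← Finset.mul_sum, sum_sq_inner]

/-- The quadratic form of a matrix. -/
def matrixForm (M : Matrix (Fin n) (Fin n) ℝ) (h : E n) : ℝ := ∑ i, ∑ j, M i j * h i * h j

lemma matrixForm_eq_sum_eigenvalues {M : Matrix (Fin n) (Fin n) ℝ} (hM : M.IsHermitian) (h : E n) :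
    matrixForm M h = ∑ i, hM.eigenvalues i * ⟪hM.eigenvectorBasis i, h⟫ ^ 2 := by
  have h1 : matrixForm M h = ⟪h, M.toEuclideanLin h⟫ := by
    simp only [matrixForm, PiLp.inner_apply, Matrix.toLpLin_apply, Matrix.mulVec, dotProduct,
      Finset.sum_mul, RCLike.inner_apply, conj_trivial]
    exact Finset.sum_congr rfl fun i _ => Finset.sum_congr rfl fun j _ => by ring
  have h2 : ∀ i, ⟪hM.eigenvectorBasis i, M.toEuclideanLin h⟫
      = hM.eigenvalues i * ⟪hM.eigenvectorBasis i, h⟫ := by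
    intro i
    have hs : LinearMap.IsSymmetric M.toEuclideanLin := Matrix.isSymmetric_toEuclideanLin_iff.2 hM
    rw [← hs, ← real_inner_smul_left]
    congr 1
    ext j
    simpa using congrFun (hM.mulVec_eigenvectorBasis i) j
  rw [h1, ← hM.eigenvectorBasis.sum_inner_mul_inner]
  refine Finset.sum_congr rfl fun i _ => ?_
  rw [h2, real_inner_comm]
  ring

lemma eigenvalues_mem_iff (hΓ : IsAdmissibleCone Γ) {M : Matrix (Fin n) (Fin n) ℝ}
    (hM : M.IsHermitian) : hM.eigenvalues ∈ Γ ↔ InCone Γ (matrixForm M) := by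
  rw [← inCone_diagonal_iff hΓ hM.eigenvectorBasis]
  simp only [← matrixForm_eq_sum_eigenvalues]

lemma eigenvalues_mem_closure_iff (hΓ : IsAdmissibleCone Γ) {M : Matrix (Fin n) (Fin n) ℝ}
    (hM : M.IsHermitian) : hM.eigenvalues ∈ closure Γ ↔ InClosedCone Γ (matrixForm M) := by
  rw [← inClosedCone_diagonal_iff hΓ hM.eigenvectorBasis]
  simp only [← matrixForm_eq_sum_eigenvalues]

/-- The form `a |h|² + c ⟨u, h⟩²` with a unit vector `u` has the eigenvalues `a + c, a, …, a`. -/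
lemma exists_basis_rankOne (hn : 0 < n) {u : E n} (hu : ‖u‖ = 1) :
    ∃ b : OrthonormalBasis (Fin n) ℝ (E n), ∀ (a c : ℝ) (h : E n),
      a * ‖h‖ ^ 2 + c * ⟪u, h⟫ ^ 2
        = ∑ i : Fin n, (if (i : ℕ) = 0 then a + c else a) * ⟪b i, h⟫ ^ 2 := by
  let i0 : Fin n := ⟨0, hn⟩
  have ho : Orthonormal ℝ (({i0} : Set (Fin n)).domRestrict fun _ => u) := by
    refine ⟨fun _ => hu, fun i j hij => absurd (Subsingleton.elim i j) hij⟩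
  obtain ⟨b, hb⟩ := ho.exists_orthonormalBasis_extension_of_card_eq (by simp)
  refine ⟨b, fun a c h => ?_⟩
  have hbu : b i0 = u := hb i0 rfl
  have hi : ∀ i : Fin n, (i : ℕ) = 0 ↔ i = i0 := fun i => by
    rw [Fin.ext_iff]
  rw [← sum_sq_inner b h]
  have : ∀ i : Fin n, (if (i : ℕ) = 0 then a + c else a) * ⟪b i, h⟫ ^ 2
      = a * ⟪b i, h⟫ ^ 2 + (if i = i0 then c * ⟪b i, h⟫ ^ 2 else 0) := by
    intro i
    simp only [hi]
    split_ifs <;> ring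
  simp only [this, Finset.sum_add_distrib, ← Finset.mul_sum, Finset.sum_ite_eq', Finset.mem_univ,
    if_true, hbu]

/-! ### Second order jets -/

/-- `X` is a quadratic form, given by a bounded operator (which need not be symmetric). -/
def IsQuad (X : E n → ℝ) : Prop := ∃ T : E n →L[ℝ] E n, ∀ h, X h = ⟪T h, h⟫

lemma IsQuad.add {X Y : E n → ℝ} (hX : IsQuad X) (hY : IsQuad Y) :
    IsQuad fun h => X h + Y h := by
  obtain ⟨T, hT⟩ := hX
  obtain ⟨S, hS⟩ := hY
  exact ⟨T + S, fun h => by simp [hT, hS, inner_add_left]⟩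

lemma IsQuad.const_mul {X : E n → ℝ} (hX : IsQuad X) (c : ℝ) : IsQuad fun h => c * X h := by
  obtain ⟨T, hT⟩ := hX
  exact ⟨c • T, fun h => by simp [hT, real_inner_smul_left]⟩

lemma isQuad_normSq : IsQuad fun h : E n => ‖h‖ ^ 2 :=
  ⟨ContinuousLinearMap.id ℝ _, fun h => by simp⟩

lemma isQuad_innerSq (p : E n) : IsQuad fun h : E n => ⟪p, h⟫ ^ 2 :=
  ⟨(innerSL ℝ p).smulRight p, fun h => by
    simp [real_inner_smul_left, sq]⟩

lemma IsQuad.neg {X : E n → ℝ} (hX : IsQuad X) : IsQuad fun h => -X h := by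
  simpa using hX.const_mul (-1)

lemma IsQuad.comp {X : E n → ℝ} (hX : IsQuad X) (R : E n →L[ℝ] E n) : IsQuad fun h => X (R h) := by
  obtain ⟨T, hT⟩ := hX
  exact ⟨(ContinuousLinearMap.adjoint R).comp (T.comp R), fun h => by
    simp [hT, ContinuousLinearMap.adjoint_inner_left]⟩

lemma IsQuad.smul_apply {X : E n → ℝ} (hX : IsQuad X) (t : ℝ) (h : E n) :
    X (t • h) = t ^ 2 * X h := by
  obtain ⟨T, hT⟩ := hX
  simp only [hT, map_smul, real_inner_smul_left, real_inner_smul_right]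
  ring

lemma IsQuad.exists_bound {X : E n → ℝ} (hX : IsQuad X) : ∃ C > 0, ∀ h, |X h| ≤ C * ‖h‖ ^ 2 := by
  obtain ⟨T, hT⟩ := hX
  refine ⟨‖T‖ + 1, by positivity, fun h => ?_⟩
  rw [hT]
  calc |⟪T h, h⟫| ≤ ‖T h‖ * ‖h‖ := abs_real_inner_le_norm _ _
    _ ≤ (‖T‖ * ‖h‖) * ‖h‖ := by gcongr; exact T.le_opNorm h
    _ ≤ (‖T‖ + 1) * ‖h‖ ^ 2 := by nlinarith [sq_nonneg ‖h‖]

/-- `(p, X)` is a second order superjet of `u` at `x`: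
`u (x + h) ≤ u x + ⟨p, h⟩ + X h / 2 + o(|h|²)`. Subjets of `u` are expressed as superjets
of `-u`. -/
structure UpperJet (u : E n → ℝ) (x p : E n) (X : E n → ℝ) : Prop where
  isQuad : IsQuad X
  bound : ∀ κ > 0, ∀ᶠ h in 𝓝 (0 : E n), u (x + h) ≤ u x + ⟪p, h⟫ + X h / 2 + κ * ‖h‖ ^ 2

lemma UpperJet.of_le {u w : E n → ℝ} {x p : E n} {X : E n → ℝ} (hw : UpperJet w x p X)
    (hx : u x = w x) (h : ∀ᶠ z in 𝓝 x, u z ≤ w z) : UpperJet u x p X := by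
  refine ⟨hw.isQuad, fun κ hκ => ?_⟩
  have ht : Tendsto (fun h => x + h) (𝓝 (0 : E n)) (𝓝 x) := by
    have : Continuous fun h : E n => x + h := by fun_prop
    simpa using this.tendsto 0
  filter_upwards [hw.bound κ hκ, ht.eventually h] with k h1 h2
  rw [hx]
  exact h2.trans h1

lemma UpperJet.add {u w : E n → ℝ} {x p p' : E n} {X X' : E n → ℝ} (hu : UpperJet u x p X)
    (hw : UpperJet w x p' X') :
    UpperJet (fun z => u z + w z) x (p + p') fun h => X h + X' h := by
  refine ⟨hu.isQuad.add hw.isQuad, fun κ hκ => ?_⟩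
  filter_upwards [hu.bound (κ / 2) (by positivity), hw.bound (κ / 2) (by positivity)] with k h1 h2
  rw [inner_add_left]
  linarith

lemma UpperJet.const_mul {u : E n → ℝ} {x p : E n} {X : E n → ℝ} (hu : UpperJet u x p X) {c : ℝ}
    (hc : 0 < c) : UpperJet (fun z => c * u z) x (c • p) fun h => c * X h := by
  refine ⟨hu.isQuad.const_mul c, fun κ hκ => ?_⟩
  filter_upwards [hu.bound (κ / c) (by positivity)] with k h1
  have := mul_le_mul_of_nonneg_left h1 hc.le
  rw [real_inner_smul_left]
  calc c * u (x + k) ≤ _ := this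
    _ = _ := by field_simp

lemma UpperJet.of_eq {u : E n → ℝ} {x p : E n} {X : E n → ℝ} (hX : IsQuad X)
    (h : ∀ h, u (x + h) = u x + ⟪p, h⟫ + X h / 2) : UpperJet u x p X := by
  refine ⟨hX, fun κ hκ => Eventually.of_forall fun k => ?_⟩
  rw [h]
  have : 0 ≤ κ * ‖k‖ ^ 2 := by positivity
  linarith

lemma upperJet_neg_normSq (x y : E n) :
    UpperJet (fun z => -‖z - y‖ ^ 2) x (-((2 : ℝ) • (x - y))) fun h => -(2 * ‖h‖ ^ 2) := by
  refine .of_eq (isQuad_normSq.const_mul 2).neg fun h => ?_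
  rw [show x + h - y = (x - y) + h by abel, norm_add_sq_real, inner_neg_left, real_inner_smul_left]
  ring

lemma upperJet_inner (x p : E n) (c : ℝ) : UpperJet (fun z => c + ⟪p, z⟫) x p fun _ => 0 :=
  .of_eq (by simpa using isQuad_normSq.const_mul 0) fun h => by
    rw [inner_add_right]
    ring

/-- Taylor's formula of order two with the Peano remainder. -/
lemma taylor_two {F F' : ℝ → ℝ} {t c : ℝ} (hF : ∀ᶠ s in 𝓝 t, HasDerivAt F (F' s) s)
    (hF' : HasDerivAt F' c t) {κ : ℝ} (hκ : 0 < κ) :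
    ∀ᶠ s in 𝓝 (0 : ℝ), |F (t + s) - F t - F' t * s - c / 2 * s ^ 2| ≤ κ * s ^ 2 := by
  have h1 := (hasDerivAt_iff_isLittleO.1 hF').def hκ
  obtain ⟨r, hr, hb⟩ := Metric.eventually_nhds_iff_ball.1 (hF.and h1)
  filter_upwards [Metric.ball_mem_nhds (0 : ℝ) hr] with s hs
  rw [mem_ball_zero_iff] at hs
  let G : ℝ → ℝ := fun z => F (t + z) - F t - F' t * z - c / 2 * z ^ 2
  have hG : ∀ z ∈ closedBall (0 : ℝ) |s|, HasDerivWithinAt G (F' (t + z) - F' t - c * z)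
      (closedBall (0 : ℝ) |s|) z := by
    intro z hz
    rw [mem_closedBall_zero_iff] at hz
    have hz' : t + z ∈ ball t r := by
      rw [Metric.mem_ball, dist_eq_norm, add_sub_cancel_left]
      exact hz.trans_lt hs
    have hd := (hb _ hz').1
    have h2 : HasDerivAt (fun z => F (t + z)) (F' (t + z)) z := hd.comp_const_add t z
    have h3 := ((h2.sub_const (F t)).sub ((hasDerivAt_id z).const_mul (F' t))).sub
      (((hasDerivAt_id z).pow 2).const_mul (c / 2))
    refine (h3.congr_deriv ?_).hasDerivWithinAt
    simp
    ring
  have hbound : ∀ z ∈ closedBall (0 : ℝ) |s|, ‖F' (t + z) - F' t - c * z‖ ≤ κ * |s| := by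
    intro z hz
    rw [mem_closedBall_zero_iff] at hz
    have hz' : t + z ∈ ball t r := by
      rw [Metric.mem_ball, dist_eq_norm, add_sub_cancel_left]
      exact hz.trans_lt hs
    have := (hb _ hz').2
    simp only [add_sub_cancel_left, smul_eq_mul] at this
    calc ‖F' (t + z) - F' t - c * z‖ = ‖F' (t + z) - F' t - z * c‖ := by rw [mul_comm]
      _ ≤ κ * ‖z‖ := this
      _ ≤ κ * |s| := by gcongr
  have := (convex_closedBall (0 : ℝ) |s|).norm_image_sub_le_of_norm_hasDerivWithin_le hG hbound
    (show (0 : ℝ) ∈ closedBall (0 : ℝ) |s| by simp) (show s ∈ closedBall (0 : ℝ) |s| by simp)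
  have e0 : G 0 = 0 := by simp [G]
  rw [e0] at this
  simp only [sub_zero, Real.norm_eq_abs] at this
  calc |G s| ≤ κ * |s| * |s| := this
    _ = κ * s ^ 2 := by rw [mul_assoc, ← sq, sq_abs]

/-- Second order expansion of a `C²` function of a quadratic polynomial. -/
lemma taylor_two_comp {F F' : ℝ → ℝ} {t c : ℝ} (hF : ∀ᶠ s in 𝓝 t, HasDerivAt F (F' s) s)
    (hF' : HasDerivAt F' c t) (p : E n) {X : E n → ℝ} (hX : IsQuad X) {κ : ℝ} (hκ : 0 < κ) :
    ∀ᶠ h in 𝓝 (0 : E n), |F (t + (⟪p, h⟫ + X h / 2)) - F t - F' t * (⟪p, h⟫ + X h / 2)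
      - c / 2 * ⟪p, h⟫ ^ 2| ≤ κ * ‖h‖ ^ 2 := by
  obtain ⟨C, hC, hXC⟩ := hX.exists_bound
  set A := ‖p‖ + C with hA
  have hA0 : 0 < A := by positivity
  have hg : Tendsto (fun h : E n => ⟪p, h⟫ + X h / 2) (𝓝 0) (𝓝 0) := by
    obtain ⟨T, hT⟩ := hX
    have : Continuous fun h : E n => ⟪p, h⟫ + X h / 2 := by
      simp only [hT]
      fun_prop
    simpa [hT] using this.tendsto 0
  have hκ' : 0 < κ / (2 * A ^ 2) := by positivity
  have hr : 0 < min 1 (κ / (2 * (|c| * C * A + 1))) := by positivity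
  filter_upwards [hg.eventually (taylor_two hF hF' hκ'), ball_mem_nhds (0 : E n) hr] with h h1 h2
  rw [mem_ball_zero_iff, lt_min_iff] at h2
  obtain ⟨h2, h3⟩ := h2
  set N := ‖h‖
  have hN : 0 ≤ N := norm_nonneg h
  set a := ⟪p, h⟫
  have ha : |a| ≤ ‖p‖ * N := abs_real_inner_le_norm _ _
  have hb := hXC h
  set b := X h / 2 with hbdef
  have hb : |b| ≤ C * N ^ 2 := by
    rw [hbdef, abs_div, abs_two]
    nlinarith [sq_nonneg N]
  have hN2 : N ^ 2 ≤ N := by nlinarith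
  have hab : |a + b| ≤ A * N := by
    calc |a + b| ≤ |a| + |b| := abs_add_le _ _
      _ ≤ ‖p‖ * N + C * N ^ 2 := add_le_add ha hb
      _ ≤ A * N := by rw [hA]; nlinarith
  have h2ab : |2 * a + b| ≤ 2 * (A * N) := by
    calc |2 * a + b| = |a + (a + b)| := by ring_nf
      _ ≤ |a| + |a + b| := abs_add_le _ _
      _ ≤ A * N + A * N := by
        refine add_le_add (ha.trans ?_) hab
        rw [hA]; nlinarith
      _ = _ := by ring
  have e1 : κ / (2 * A ^ 2) * (a + b) ^ 2 ≤ κ / 2 * N ^ 2 := by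
    have : (a + b) ^ 2 ≤ (A * N) ^ 2 := sq_le_sq' (by linarith [neg_abs_le (a + b)])
      ((le_abs_self _).trans hab)
    calc κ / (2 * A ^ 2) * (a + b) ^ 2 ≤ κ / (2 * A ^ 2) * (A * N) ^ 2 := by gcongr
      _ = κ / 2 * N ^ 2 := by field_simp
  have e2 : |c / 2 * (b * (2 * a + b))| ≤ κ / 2 * N ^ 2 := by
    rw [abs_mul, abs_mul, abs_div, abs_two]
    calc |c| / 2 * (|b| * |2 * a + b|) ≤ |c| / 2 * ((C * N ^ 2) * (2 * (A * N))) := by gcongr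
      _ = (|c| * C * A * N) * N ^ 2 := by ring
      _ ≤ κ / 2 * N ^ 2 := by
        refine mul_le_mul_of_nonneg_right ?_ (sq_nonneg _)
        have : 0 < |c| * C * A + 1 := by positivity
        rw [lt_div_iff₀ (by positivity)] at h3
        nlinarith
  have e3 : F (t + (a + b)) - F t - F' t * (a + b) - c / 2 * a ^ 2
      = (F (t + (a + b)) - F t - F' t * (a + b) - c / 2 * (a + b) ^ 2)
        + c / 2 * (b * (2 * a + b)) := by ring
  rw [e3]
  refine (abs_add_le _ _).trans ?_
  linarith

/-- The chain rule for superjets under an increasing `C²` function. -/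
lemma UpperJet.comp_monotoneOn {u : E n → ℝ} {x p : E n} {X : E n → ℝ} (hu : UpperJet u x p X)
    {F F' : ℝ → ℝ} {c : ℝ} {S : Set ℝ} (hS : S ∈ 𝓝 (u x)) (hm : MonotoneOn F S)
    (huS : ∀ z, u z ∈ S) (hF : ∀ s ∈ S, HasDerivAt F (F' s) s) (hF' : HasDerivAt F' c (u x)) :
    UpperJet (fun z => F (u z)) x (F' (u x) • p) fun h => F' (u x) * X h + c * ⟪p, h⟫ ^ 2 := by
  refine ⟨(hu.isQuad.const_mul _).add ((isQuad_innerSq p).const_mul c), fun κ hκ => ?_⟩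
  set t := u x
  obtain ⟨δ, hδ, hδκ⟩ : ∃ δ > 0, |F' t| * δ ≤ κ / 2 := by
    refine ⟨κ / (2 * (|F' t| + 1)), by positivity, ?_⟩
    rw [mul_div_assoc', div_le_div_iff₀ (by positivity) (by positivity)]
    nlinarith [abs_nonneg (F' t)]
  have hY : IsQuad fun h : E n => X h + 2 * δ * ‖h‖ ^ 2 :=
    hu.isQuad.add (isQuad_normSq.const_mul _)
  have hg : Tendsto (fun h : E n => t + (⟪p, h⟫ + (X h + 2 * δ * ‖h‖ ^ 2) / 2)) (𝓝 0) (𝓝 t) := by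
    have h0 : X 0 = 0 := by simpa using hu.isQuad.smul_apply 0 0
    obtain ⟨T, hT⟩ := hY
    have : Continuous fun h : E n => t + (⟪p, h⟫ + (X h + 2 * δ * ‖h‖ ^ 2) / 2) := by
      simp only [hT]
      fun_prop
    convert this.tendsto 0 using 2
    simp [h0]
  filter_upwards [hu.bound δ hδ, taylor_two_comp (eventually_of_mem hS hF) hF' p hY (half_pos hκ),
    hg.eventually hS] with h h1 h2 h3
  have h4 := (abs_le.1 h2).2
  have h5 : F (u (x + h)) ≤ F (t + (⟪p, h⟫ + (X h + 2 * δ * ‖h‖ ^ 2) / 2)) :=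
    hm (huS _) h3 (by linarith)
  have h6 : F' t * (δ * ‖h‖ ^ 2) ≤ κ / 2 * ‖h‖ ^ 2 := by
    rw [← mul_assoc]
    refine mul_le_mul_of_nonneg_right ?_ (sq_nonneg _)
    exact (mul_le_mul_of_nonneg_right (le_abs_self _) hδ.le).trans hδκ
  rw [real_inner_smul_left]
  linarith

/-- Radial functions `F (|x - y|²)` have the expected second order expansion. -/
lemma upperJet_radial {F F' : ℝ → ℝ} {c : ℝ} {x y : E n}
    (hF : ∀ᶠ s in 𝓝 (‖x - y‖ ^ 2), HasDerivAt F (F' s) s) (hF' : HasDerivAt F' c (‖x - y‖ ^ 2)) :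
    UpperJet (fun z => F (‖z - y‖ ^ 2)) x ((2 * F' (‖x - y‖ ^ 2)) • (x - y))
      fun h => 2 * F' (‖x - y‖ ^ 2) * ‖h‖ ^ 2 + 4 * c * ⟪x - y, h⟫ ^ 2 := by
  refine ⟨(isQuad_normSq.const_mul _).add ((isQuad_innerSq _).const_mul _), fun κ hκ => ?_⟩
  filter_upwards [taylor_two_comp hF hF' ((2 : ℝ) • (x - y)) (isQuad_normSq.const_mul 2) hκ]
    with h h1
  have h2 := (abs_le.1 h1).2
  have e : ‖x + h - y‖ ^ 2 = ‖x - y‖ ^ 2 + (⟪(2 : ℝ) • (x - y), h⟫ + 2 * ‖h‖ ^ 2 / 2) := by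
    rw [show x + h - y = (x - y) + h by abel, norm_add_sq_real, real_inner_smul_left]
    ring
  rw [e]
  rw [real_inner_smul_left] at h2 ⊢
  rw [real_inner_smul_left]
  linarith

/-! ### The equation for `q = exp (-v)` -/

/-- The supersolution condition for `v = -log q`, in terms of the superjets of `q`. In terms of `q`
the matrix `A[v]` is `q ∇²q - ½ |∇q|² I`. -/
def SuperOn (Γ : Set (Fin n → ℝ)) (U : Set (E n)) (q : E n → ℝ) : Prop :=
  ∀ x ∈ U, ∀ p X, UpperJet q x p X →
    InClosedCone Γ fun h => q x * X h - ‖p‖ ^ 2 / 2 * ‖h‖ ^ 2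

/-- The subsolution condition for `v = -log q`, in terms of the superjets of `-q`. -/
def SubOn (Γ : Set (Fin n → ℝ)) (U : Set (E n)) (q : E n → ℝ) : Prop :=
  ∀ x ∈ U, ∀ p X, UpperJet (fun z => -q z) x p X →
    ¬ InCone Γ fun h => -(q x) * X h - ‖p‖ ^ 2 / 2 * ‖h‖ ^ 2

lemma matrixForm_of_bilin (L : E n →L[ℝ] E n →L[ℝ] ℝ) (h : E n) :
    matrixForm (Matrix.of fun i j => L (EuclideanSpace.single i 1) (EuclideanSpace.single j 1)) h
      = L h h := by
  have hs : h = ∑ i, h i • EuclideanSpace.single i (1 : ℝ) := by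
    simpa using ((EuclideanSpace.basisFun (Fin n) ℝ).sum_repr h).symm
  conv_rhs => rw [hs]
  simp only [map_sum, map_smul, _root_.sum_apply, _root_.smul_apply,
    smul_eq_mul, matrixForm, Matrix.of_apply, Finset.mul_sum]
  rw [Finset.sum_comm]
  exact Finset.sum_congr rfl fun i _ => Finset.sum_congr rfl fun j _ => by ring

lemma matrixForm_mobiusHessian (v : E n → ℝ) (x h : E n) :
    matrixForm (mobiusHessian v x) h = Real.exp (-2 * v x) *
      (-(fderiv ℝ (fderiv ℝ v) x h h) + ⟪gradient v x, h⟫ ^ 2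
        - ‖gradient v x‖ ^ 2 / 2 * ‖h‖ ^ 2) := by
  rw [← matrixForm_of_bilin]
  have h1 : ⟪gradient v x, h⟫ ^ 2 = ∑ i, ∑ j, gradient v x i * gradient v x j * h i * h j := by
    rw [PiLp.inner_apply, sq, Finset.sum_mul_sum]
    exact Finset.sum_congr rfl fun i _ => Finset.sum_congr rfl fun j _ => by
      simp only [RCLike.inner_apply, conj_trivial]
      ring
  have h2 : ‖h‖ ^ 2 = ∑ i, ∑ j, (1 : Matrix (Fin n) (Fin n) ℝ) i j * h i * h j := by
    rw [EuclideanSpace.norm_sq_eq]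
    refine Finset.sum_congr rfl fun i _ => ?_
    simp [Matrix.one_apply, sq]
  rw [h1, h2]
  simp only [matrixForm, mobiusHessian, hessian, Finset.mul_sum, ← Finset.sum_neg_distrib,
    ← Finset.sum_add_distrib, ← Finset.sum_sub_distrib]
  refine Finset.sum_congr rfl fun i _ => Finset.sum_congr rfl fun j _ => ?_
  simp only [Matrix.smul_apply, Matrix.sub_apply, Matrix.add_apply, Matrix.neg_apply,
    Matrix.vecMulVec_apply, Matrix.of_apply, smul_eq_mul]
  ring

/-- The quadratic polynomial at `x` with value `c`, gradient `p` and Hessian form `⟨T h, h⟩`. -/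
noncomputable def quadPoly (c : ℝ) (x p : E n) (T : E n →L[ℝ] E n) (z : E n) : ℝ :=
  c + ⟪p, z - x⟫ + ⟪T (z - x), z - x⟫ * (1 / 2)

lemma contDiff_quadPoly (c : ℝ) (x p : E n) (T : E n →L[ℝ] E n) :
    ContDiff ℝ 2 (quadPoly c x p T) := by
  have h : ContDiff ℝ 2 fun z : E n => z - x := contDiff_id.sub contDiff_const
  exact (contDiff_const.add (contDiff_const.inner ℝ h)).add
    (((T.contDiff.comp h).inner ℝ h).mul contDiff_const)

lemma hasFDerivAt_quadPoly (c : ℝ) (x p : E n) (T : E n →L[ℝ] E n) (z : E n) :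
    HasFDerivAt (quadPoly c x p T) (innerSL ℝ p + (1 / 2 : ℝ) •
      (((innerSL ℝ).comp T : E n →L[ℝ] E n →L[ℝ] ℝ)
        + ((innerSL ℝ).comp T : E n →L[ℝ] E n →L[ℝ] ℝ).flip) (z - x)) z := by
  have h1 : HasFDerivAt (fun z : E n => z - x) (ContinuousLinearMap.id ℝ (E n)) z :=
    (hasFDerivAt_id z).sub_const x
  have h2 := (T.hasFDerivAt (x := z - x)).comp z h1
  have h3 := (h2.inner ℝ h1).mul_const (1 / 2 : ℝ)
  have h4 := ((innerSL ℝ p).hasFDerivAt (x := z - x)).comp z h1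
  have h5 : HasFDerivAt (quadPoly c x p T) _ z := (h4.const_add c).add h3
  refine h5.congr_fderiv ?_
  ext w
  simp [fderivInnerCLM_apply, real_inner_comm, inner_sub_left, inner_sub_right]
  ring

lemma gradient_quadPoly (c : ℝ) (x p : E n) (T : E n →L[ℝ] E n) :
    gradient (quadPoly c x p T) x = p := by
  have h := (hasFDerivAt_quadPoly c x p T x).fderiv
  rw [gradient, h, LinearIsometryEquiv.symm_apply_eq]
  ext w
  simp

lemma hessian_quadPoly (c : ℝ) (x p : E n) (T : E n →L[ℝ] E n) (h : E n) :
    fderiv ℝ (fderiv ℝ (quadPoly c x p T)) x h h = ⟪T h, h⟫ := by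
  have e : fderiv ℝ (quadPoly c x p T) = fun z => innerSL ℝ p + (1 / 2 : ℝ) •
      (((innerSL ℝ).comp T : E n →L[ℝ] E n →L[ℝ] ℝ)
        + ((innerSL ℝ).comp T : E n →L[ℝ] E n →L[ℝ] ℝ).flip) (z - x) :=
    funext fun z => (hasFDerivAt_quadPoly c x p T z).fderiv
  set S := ((innerSL ℝ).comp T : E n →L[ℝ] E n →L[ℝ] ℝ)
        + ((innerSL ℝ).comp T : E n →L[ℝ] E n →L[ℝ] ℝ).flip with hS
  have h1 : HasFDerivAt (fun z : E n => z - x) (ContinuousLinearMap.id ℝ (E n)) x :=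
    (hasFDerivAt_id x).sub_const x
  have h2 := ((HasFDerivAt.comp (g := S) x S.hasFDerivAt h1).const_smul (1 / 2 : ℝ)).const_add
    (innerSL ℝ p)
  rw [e]
  have h3 : fderiv ℝ (fun z => innerSL ℝ p + (1 / 2 : ℝ) • S (z - x)) x
      = (1 / 2 : ℝ) • (S.comp (ContinuousLinearMap.id ℝ (E n))) := h2.fderiv
  rw [h3]
  simp [hS]
  ring

lemma matrixForm_mobiusHessian_quadPoly (c : ℝ) (x p : E n) (T : E n →L[ℝ] E n) (h : E n) :
    matrixForm (mobiusHessian (quadPoly c x p T) x) h = Real.exp (-2 * c) *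
      (-⟪T h, h⟫ + ⟪p, h⟫ ^ 2 - ‖p‖ ^ 2 / 2 * ‖h‖ ^ 2) := by
  rw [matrixForm_mobiusHessian, gradient_quadPoly, hessian_quadPoly]
  simp [quadPoly]

/-- The supersolution condition in terms of the superjets of `-v`. -/
lemma IsViscositySupersolution.inClosedCone (hΓ : IsAdmissibleCone Γ) {v : E n → ℝ}
    (hv : IsViscositySupersolution Γ v) {x p : E n} {X : E n → ℝ}
    (hj : UpperJet (fun z => -v z) x p X) :
    InClosedCone Γ fun h => X h + ⟪p, h⟫ ^ 2 - ‖p‖ ^ 2 / 2 * ‖h‖ ^ 2 := by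
  refine .of_forall_add fun ε hε => ?_
  obtain ⟨T, hT⟩ := (hj.isQuad.add (isQuad_normSq.const_mul ε)).neg
  have ht : TouchesBelow (quadPoly (v x) x (-p) T) v x := by
    refine ⟨by simp [quadPoly], ?_⟩
    have ht : Tendsto (fun z => z - x) (𝓝 x) (𝓝 (0 : E n)) := by
      have : Continuous fun z : E n => z - x := by fun_prop
      simpa using this.tendsto x
    filter_upwards [ht.eventually (hj.bound (ε / 2) (by positivity))] with z hz
    rw [add_sub_cancel] at hz
    rw [quadPoly, ← hT, inner_neg_left]
    linarith
  have h1 := hv.2 x _ (contDiff_quadPoly _ _ _ _).contDiffAt ht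
  rw [eigA, eigenvalues_mem_closure_iff hΓ] at h1
  refine h1.of_mul hΓ (Real.exp_pos (2 * v x)) fun h => ?_
  rw [matrixForm_mobiusHessian_quadPoly, ← mul_assoc, ← Real.exp_add, ← hT]
  simp only [inner_neg_left, norm_neg]
  rw [show 2 * v x + -2 * v x = 0 by ring, Real.exp_zero]
  linarith

/-- The subsolution condition in terms of the superjets of `v`. -/
lemma IsViscositySubsolution.not_inCone (hΓ : IsAdmissibleCone Γ) {v : E n → ℝ}
    (hv : IsViscositySubsolution Γ v) {x p : E n} {X : E n → ℝ} (hj : UpperJet v x p X) :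
    ¬ InCone Γ fun h => -X h + ⟪p, h⟫ ^ 2 - ‖p‖ ^ 2 / 2 * ‖h‖ ^ 2 := by
  intro hc
  obtain ⟨ε, hε, hc⟩ := hc.exists_sub hΓ
  obtain ⟨T, hT⟩ := hj.isQuad.add (isQuad_normSq.const_mul ε)
  have ht : TouchesAbove (quadPoly (v x) x p T) v x := by
    refine ⟨by simp [quadPoly], ?_⟩
    have ht : Tendsto (fun z => z - x) (𝓝 x) (𝓝 (0 : E n)) := by
      have : Continuous fun z : E n => z - x := by fun_prop
      simpa using this.tendsto x
    filter_upwards [ht.eventually (hj.bound (ε / 2) (by positivity))] with z hz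
    rw [add_sub_cancel] at hz
    rw [quadPoly, ← hT]
    linarith
  have h1 := hv.2 x _ (contDiff_quadPoly _ _ _ _).contDiffAt ht
  rw [eigA, Set.mem_compl_iff, eigenvalues_mem_iff hΓ] at h1
  refine h1 (hc.of_mul hΓ (Real.exp_pos (-2 * v x)) fun h => ?_)
  rw [matrixForm_mobiusHessian_quadPoly, ← hT]
  refine mul_le_mul_of_nonneg_left ?_ (Real.exp_pos _).le
  linarith

lemma IsViscositySupersolution.superOn (hΓ : IsAdmissibleCone Γ) {v : E n → ℝ}
    (hv : IsViscositySupersolution Γ v) : SuperOn Γ univ fun x => Real.exp (-v x) := by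
  intro x _ p X hj
  have hq := Real.exp_pos (-v x)
  set q := Real.exp (-v x) with hqdef
  have h1 := hj.comp_monotoneOn (F := Real.log) (F' := fun s => s⁻¹) (c := -(q ^ 2)⁻¹)
    (S := Ioi 0) (Ioi_mem_nhds hq) Real.strictMonoOn_log.monotoneOn (fun z => Real.exp_pos _)
    (fun s hs => Real.hasDerivAt_log (ne_of_gt hs)) (hasDerivAt_inv hq.ne')
  simp only [Real.log_exp] at h1
  refine (hv.inClosedCone hΓ h1).of_mul hΓ (t := q ^ 2) (by positivity) fun h => le_of_eq ?_
  rw [real_inner_smul_left, norm_smul, Real.norm_eq_abs, mul_pow (|_|), sq_abs]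
  simp only [← hqdef]
  field_simp
  ring

lemma IsViscositySubsolution.subOn (hΓ : IsAdmissibleCone Γ) {v : E n → ℝ}
    (hv : IsViscositySubsolution Γ v) : SubOn Γ univ fun x => Real.exp (-v x) := by
  intro x _ p X hj hc
  have hq := Real.exp_pos (-v x)
  set q := Real.exp (-v x) with hqdef
  have h1 := hj.comp_monotoneOn (F := fun s => -Real.log (-s)) (F' := fun s => -s⁻¹)
    (c := (q ^ 2)⁻¹) (S := Iio 0) (Iio_mem_nhds (by simpa using hq))
    (fun a ha b hb hab => by
      have hb' : 0 < -b := by simpa using hb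
      exact neg_le_neg (Real.log_le_log hb' (neg_le_neg hab)))
    (fun z => by simpa using Real.exp_pos _)
    (fun s hs => by
      have hs' : s ≠ 0 := ne_of_lt hs
      have := ((Real.hasDerivAt_log (neg_ne_zero.2 hs')).comp s (hasDerivAt_neg s)).neg
      refine this.congr_deriv ?_
      rw [inv_neg]
      ring)
    (by
      have := (hasDerivAt_inv (neg_ne_zero.2 hq.ne')).neg
      refine this.congr_deriv ?_
      rw [neg_neg, neg_sq])
  simp only [neg_neg, Real.log_exp] at h1
  refine hv.not_inCone hΓ h1 (hc.of_mul hΓ (t := (q ^ 2)⁻¹) (by positivity) fun h => le_of_eq ?_)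
  rw [real_inner_smul_left, norm_smul, Real.norm_eq_abs, mul_pow (|_|), sq_abs]
  simp only [← hqdef]
  field_simp
  ring

/-! ### Functions between paraboloids -/

/-- `a` lies between two paraboloids of opening `C` that touch at `x` with the slope `p`. -/
def Sandwich (a : E n → ℝ) (C : ℝ) (x p : E n) : Prop :=
  ∀ z, |a z - a x - ⟪p, z - x⟫| ≤ C * ‖z - x‖ ^ 2

/-- The slope depends on the point in a Lipschitz way; in particular it is unique. -/
lemma Sandwich.norm_sub_le {a : E n → ℝ} {C : ℝ} {x y p r : E n} (hx : Sandwich a C x p)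
    (hy : Sandwich a C y r) : ‖p - r‖ ≤ 6 * C * ‖x - y‖ := by
  have key : ∀ k : E n, ⟪r - p, k⟫ ≤ C * (‖(x - y) + k‖ ^ 2 + ‖x - y‖ ^ 2 + ‖k‖ ^ 2) := by
    intro k
    have h1 := (abs_le.1 (hx (x + k))).2
    have h2 := (abs_le.1 (hy (x + k))).1
    have h3 := (abs_le.1 (hy x)).2
    rw [add_sub_cancel_left] at h1
    rw [show x + k - y = (x - y) + k by abel, inner_add_right] at h2
    rw [inner_sub_left]
    linarith
  rw [norm_sub_rev]
  rcases eq_or_ne r p with hrp | hrp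
  · have hC : 0 ≤ C * ‖x - y‖ ^ 2 := (abs_nonneg _).trans (hy x)
    rcases (norm_nonneg (x - y)).eq_or_lt with h0 | h0
    · simp [← h0, hrp]
    · rw [hrp, sub_self, norm_zero]
      have : 0 ≤ C := nonneg_of_mul_nonneg_left hC (by positivity)
      positivity
  have hm : 0 < ‖r - p‖ := norm_pos_iff.2 (sub_ne_zero.2 hrp)
  set m := ‖r - p‖
  set D := ‖x - y‖
  have h0 : ∀ t > 0, t * m ≤ C * ((D + t) ^ 2 + D ^ 2 + t ^ 2) ∨ C < 0 := by
    intro t ht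
    by_cases hC : C < 0
    · exact Or.inr hC
    left
    have hk := key ((t / m) • (r - p))
    have hn : ‖(t / m) • (r - p)‖ = t := by
      rw [norm_smul, Real.norm_eq_abs, abs_of_pos (by positivity)]
      exact div_mul_cancel₀ _ hm.ne'
    rw [real_inner_smul_right, real_inner_self_eq_norm_sq, hn] at hk
    have e : t / m * m ^ 2 = t * m := by field_simp
    rw [e] at hk
    refine hk.trans (mul_le_mul_of_nonneg_left ?_ (not_lt.1 hC))
    have := norm_add_le (x - y) ((t / m) • (r - p))
    rw [hn] at this
    gcongr
  rcases (norm_nonneg (x - y)).eq_or_lt with hD | hD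
  · have hD : D = 0 := hD.symm
    -- coinciding points: all small `t` are admissible, which forces `m = 0`
    exfalso
    by_cases hC : C ≤ 0
    · have hk := key (r - p)
      rw [real_inner_self_eq_norm_sq] at hk
      nlinarith [sq_nonneg ‖x - y + (r - p)‖, sq_nonneg ‖x - y‖, sq_nonneg ‖r - p‖]
    · push Not at hC
      have := (h0 (m / (4 * C)) (by positivity)).resolve_right hC.le.not_gt
      rw [hD] at this
      have e : C * ((0 + m / (4 * C)) ^ 2 + 0 ^ 2 + (m / (4 * C)) ^ 2) = m / (4 * C) * m / 2 := by
        field_simp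
        ring
      rw [e] at this
      have : 0 < m / (4 * C) * m := by positivity
      linarith
  · have hC : 0 ≤ C :=
      nonneg_of_mul_nonneg_left ((abs_nonneg _).trans (hy x)) (by positivity : 0 < ‖x - y‖ ^ 2)
    have := (h0 D hD).resolve_right hC.not_gt
    have hD' : 0 < D := hD
    refine le_of_mul_le_mul_left (a := D) ?_ hD'
    calc D * m ≤ _ := this
      _ = D * (6 * C * D) := by ring

/-- Near a density point of `S`, every point is close to a point of `S`, at a distance that is
small compared to the distance to the density point. -/
lemma exists_mem_near_of_density {μ : MeasureTheory.Measure (E n)} [μ.IsAddHaarMeasure]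
    {S : Set (E n)} {x : E n}
    (hx : Tendsto (fun r => μ (S ∩ closedBall x r) / μ (closedBall x r)) (𝓝[>] 0) (𝓝 1))
    {κ : ℝ} (hκ : 0 < κ) :
    ∀ᶠ r in 𝓝[>] (0 : ℝ), ∀ ξ ∈ closedBall x r, ∃ ξ' ∈ S, ‖ξ' - ξ‖ ≤ κ * r := by
  wlog hκ1 : κ ≤ 1 generalizing κ
  · filter_upwards [this one_pos le_rfl, self_mem_nhdsWithin] with r hr hr0 ξ hξ
    have hr0 : 0 < r := hr0
    obtain ⟨ξ', h1, h2⟩ := hr ξ hξ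
    exact ⟨ξ', h1, h2.trans (by nlinarith)⟩
  set θ : ENNReal := ENNReal.ofReal (1 - (κ / 2) ^ Module.finrank ℝ (E n)) with hθ
  have hθ1 : θ < 1 := by
    rw [hθ, ENNReal.ofReal_lt_one]
    have : 0 < (κ / 2) ^ Module.finrank ℝ (E n) := by positivity
    linarith
  have h2 : Tendsto (fun r : ℝ => 2 * r) (𝓝[>] 0) (𝓝[>] 0) := by
    refine tendsto_nhdsWithin_iff.2 ⟨?_, ?_⟩
    · have : Tendsto (fun r : ℝ => 2 * r) (𝓝 0) (𝓝 (2 * 0)) :=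
        (continuous_const.mul continuous_id).tendsto 0
      rw [mul_zero] at this
      exact this.mono_left nhdsWithin_le_nhds
    · filter_upwards [self_mem_nhdsWithin] with r hr
      have hr : 0 < r := hr
      simpa using hr
  filter_upwards [(hx.comp h2).eventually (lt_mem_nhds hθ1), self_mem_nhdsWithin] with r hr hr0 ξ hξ
  have hr0 : 0 < r := hr0
  by_contra! hcon
  have hsub : S ∩ closedBall x (2 * r) ⊆ closedBall x (2 * r) \ closedBall ξ (κ * r) := by
    rintro z ⟨hzS, hz⟩
    refine ⟨hz, fun hz' => ?_⟩
    rw [mem_closedBall, dist_eq_norm] at hz'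
    exact absurd hz' (not_le.2 (hcon z hzS))
  have hsub2 : closedBall ξ (κ * r) ⊆ closedBall x (2 * r) := by
    refine closedBall_subset_closedBall' ?_
    rw [mem_closedBall] at hξ
    nlinarith
  have hB : μ (closedBall x (2 * r)) ≠ ⊤ := MeasureTheory.measure_closedBall_lt_top.ne
  have hB0 : μ (closedBall x (2 * r)) ≠ 0 := (measure_closedBall_pos μ x (by positivity)).ne'
  have e1 : μ (closedBall ξ (κ * r))
      = ENNReal.ofReal ((κ / 2) ^ Module.finrank ℝ (E n)) * μ (closedBall x (2 * r)) := by
    rw [show κ * r = (κ / 2) * (2 * r) by ring,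
      MeasureTheory.Measure.addHaar_closedBall_mul_of_pos μ ξ (by positivity),
      MeasureTheory.Measure.addHaar_closedBall_center μ x]
  have hle : μ (S ∩ closedBall x (2 * r)) ≤ θ * μ (closedBall x (2 * r)) := by
    refine (MeasureTheory.measure_mono hsub).trans ?_
    rw [MeasureTheory.measure_sdiff hsub2 measurableSet_closedBall.nullMeasurableSet
      MeasureTheory.measure_closedBall_lt_top.ne, e1, hθ, ENNReal.ofReal_sub _ (by positivity),
      ENNReal.ofReal_one, ENNReal.sub_mul (fun _ _ => hB), one_mul]
  have : μ (S ∩ closedBall x (2 * r)) / μ (closedBall x (2 * r)) ≤ θ :=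
    ENNReal.div_le_of_le_mul hle
  exact absurd hr (not_lt.2 this)

/-- If `a` lies between paraboloids at the points of `S` and the slope is differentiable within `S`
at a density point `x` of `S`, then `a` has a second order expansion at `x`. The increment of `a`
along a segment from `x` is computed on a fine partition, using the paraboloids at points of `S`
near the nodes. -/
lemma expansion_of_sandwich {a : E n → ℝ} {C : ℝ} {S : Set (E n)} {p : E n → E n} {x : E n}
    (hS : ∀ ξ ∈ S, Sandwich a C ξ (p ξ)) {T : E n →L[ℝ] E n}
    (hT : HasFDerivWithinAt p T S x)
    (hd : ∀ κ > 0, ∀ᶠ r in 𝓝[>] (0 : ℝ), ∀ ξ ∈ closedBall x r, ∃ ξ' ∈ S, ‖ξ' - ξ‖ ≤ κ * r)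
    {κ : ℝ} (hκ : 0 < κ) :
    ∀ᶠ h in 𝓝 (0 : E n), |a (x + h) - a x - ⟪p x, h⟫ - ⟪T h, h⟫ / 2| ≤ κ * ‖h‖ ^ 2 := by
  wlog hC : 0 ≤ C generalizing C
  · exact this (C := 0) (fun ξ hξ z => (hS ξ hξ z).trans (by nlinarith [sq_nonneg ‖z - ξ‖])) le_rfl
  set A := 2 * ‖T‖ + 5 * C with hA
  obtain ⟨N, hN⟩ := exists_nat_gt (2 * A / κ + 1)
  have hN0 : (0 : ℝ) < N := by
    have : 0 ≤ 2 * A / κ := by positivity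
    linarith
  have hN1 : (1 : ℝ) ≤ N := by
    have : 0 ≤ 2 * A / κ := by positivity
    linarith
  have hAN : A / N ≤ κ / 2 := by
    rw [div_le_iff₀ hN0]
    have : 2 * A / κ < N := by linarith
    rw [div_lt_iff₀ hκ] at this
    linarith
  have h1 := hT.isLittleO.def (show 0 < κ / 4 by positivity)
  rw [eventually_nhdsWithin_iff, Metric.eventually_nhds_iff_ball] at h1
  obtain ⟨r1, hr1, h1⟩ := h1
  have h2 := hd (1 / N) (by positivity)
  rw [eventually_nhdsWithin_iff, Metric.eventually_nhds_iff_ball] at h2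
  obtain ⟨r2, hr2, h2⟩ := h2
  filter_upwards [ball_mem_nhds (0 : E n) (show 0 < min (r1 / 2) r2 by positivity)] with h hh
  rw [mem_ball_zero_iff, lt_min_iff] at hh
  rcases eq_or_ne h 0 with rfl | hh0
  · simp
  have hH : 0 < ‖h‖ := norm_pos_iff.2 hh0
  set H := ‖h‖ with hHdef
  have hnet := h2 H (by rw [mem_ball_zero_iff, Real.norm_eq_abs, abs_of_pos hH]; exact hh.2) hH
  set b := ⟪p x, h⟫
  set c := ⟪T h, h⟫ with hc
  have hcb : |c| ≤ ‖T‖ * H ^ 2 := by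
    calc |c| ≤ ‖T h‖ * ‖h‖ := abs_real_inner_le_norm _ _
      _ ≤ (‖T‖ * H) * H := by gcongr; exact T.le_opNorm h
      _ = _ := by ring
  have step : ∀ i : ℕ, i ≤ N → |a (x + ((i : ℝ) / N) • h) - a x - (b * (i / N) + c / 2 * (i / N) ^ 2)|
      ≤ i * (κ * H ^ 2 / N) := by
    intro i
    induction i with
    | zero => simp
    | succ i ih =>
      intro hi
      have ih := ih (Nat.le_of_succ_le hi)
      set t : ℝ := (i : ℝ) / N with ht
      have ht0 : 0 ≤ t := by positivity
      have ht1 : t ≤ 1 := by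
        rw [ht, div_le_one hN0]
        exact_mod_cast Nat.le_of_succ_le hi
      have hts : ((i + 1 : ℕ) : ℝ) / N = t + 1 / N := by
        rw [ht]; push_cast; ring
      rw [hts]
      set s : ℝ := 1 / N with hs
      have hs0 : 0 < s := by positivity
      have hs1 : s ≤ 1 := by rw [hs, div_le_one hN0]; exact hN1
      obtain ⟨ξ, hξS, hξ⟩ := hnet (x + t • h) (by
        rw [mem_closedBall, dist_eq_norm, add_sub_cancel_left, norm_smul, Real.norm_eq_abs,
          abs_of_nonneg ht0]
        nlinarith)
      set e := x + t • h - ξ with he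
      have hen : ‖e‖ ≤ s * H := by rw [he, norm_sub_rev]; exact hξ
      have hξx : ξ - x = t • h - e := by rw [he]; abel
      have hξn : ‖ξ - x‖ ≤ 2 * H := by
        rw [hξx]
        calc ‖t • h - e‖ ≤ ‖t • h‖ + ‖e‖ := norm_sub_le _ _
          _ ≤ t * H + s * H := by
            rw [norm_smul, Real.norm_eq_abs, abs_of_nonneg ht0]
            exact add_le_add le_rfl hen
          _ ≤ 2 * H := by nlinarith
      -- the slope at `ξ`
      set ω := p ξ - p x - T (ξ - x) with hω
      have hωn : ‖ω‖ ≤ κ / 4 * (2 * H) := by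
        refine (h1 ξ ?_ hξS).trans (by gcongr)
        rw [Metric.mem_ball, dist_eq_norm]
        linarith [hh.1]
      have hs1' := abs_le.1 (hS ξ hξS (x + t • h))
      have hs2' := abs_le.1 (hS ξ hξS (x + (t + s) • h))
      have e1 : x + (t + s) • h - ξ = e + s • h := by rw [he, add_smul]; abel
      rw [← he] at hs1'
      rw [e1, inner_add_right, real_inner_smul_right] at hs2'
      have hn1 : C * ‖e‖ ^ 2 ≤ C * (s * H) ^ 2 := by gcongr
      have hn2 : C * ‖e + s • h‖ ^ 2 ≤ C * (2 * (s * H)) ^ 2 := by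
        gcongr
        calc ‖e + s • h‖ ≤ ‖e‖ + ‖s • h‖ := norm_add_le _ _
          _ ≤ s * H + s * H := by
            rw [norm_smul, Real.norm_eq_abs, abs_of_pos hs0]
            exact add_le_add hen le_rfl
          _ = _ := by ring
      have hpξ : ⟪p ξ, h⟫ = b + (t * c - ⟪T e, h⟫) + ⟪ω, h⟫ := by
        rw [show p ξ = p x + T (ξ - x) + ω by rw [hω]; abel, inner_add_left, inner_add_left, hξx,
          map_sub, map_smul, inner_sub_left, real_inner_smul_left]
      have hTe : |⟪T e, h⟫| ≤ ‖T‖ * (s * H) * H := by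
        calc |⟪T e, h⟫| ≤ ‖T e‖ * ‖h‖ := abs_real_inner_le_norm _ _
          _ ≤ (‖T‖ * ‖e‖) * H := by gcongr; exact T.le_opNorm e
          _ ≤ _ := by gcongr
      have hωh : |⟪ω, h⟫| ≤ κ / 4 * (2 * H) * H :=
        (abs_real_inner_le_norm _ _).trans (by gcongr)
      rw [hpξ] at hs2'
      have hsN : s * N = 1 := by rw [hs]; field_simp
      have hsA : s * A ≤ κ / 2 := by
        calc s * A = A / N := by rw [hs]; ring
          _ ≤ _ := hAN
      have hb1 : |s * ⟪T e, h⟫| ≤ s * (‖T‖ * (s * H) * H) := by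
        rw [abs_mul, abs_of_pos hs0]; gcongr
      have hb2 : |s * ⟪ω, h⟫| ≤ s * (κ / 4 * (2 * H) * H) := by
        rw [abs_mul, abs_of_pos hs0]; gcongr
      have hb3 : |s ^ 2 / 2 * c| ≤ s ^ 2 / 2 * (‖T‖ * H ^ 2) := by
        rw [abs_mul, abs_of_pos (by positivity)]; gcongr
      have hfin : s * (‖T‖ * (s * H) * H) + s * (κ / 4 * (2 * H) * H) + s ^ 2 / 2 * (‖T‖ * H ^ 2)
          + C * (s * H) ^ 2 + C * (2 * (s * H)) ^ 2 ≤ κ * H ^ 2 * s := by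
        have : s * H ^ 2 * (s * A) ≤ s * H ^ 2 * (κ / 2) := by gcongr
        have hT0 : 0 ≤ s ^ 2 * H ^ 2 * ‖T‖ := by positivity
        rw [hA] at this
        linarith
      have hinc : |a (x + (t + s) • h) - a (x + t • h) - (b * s + c * t * s + c / 2 * s ^ 2)|
          ≤ κ * H ^ 2 * s := by
        have hb1 := abs_le.1 hb1
        have hb2 := abs_le.1 hb2
        have hb3 := abs_le.1 hb3
        rw [abs_le]
        constructor <;> linarith
      have e2 : a (x + (t + s) • h) - a x - (b * (t + s) + c / 2 * (t + s) ^ 2)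
          = (a (x + t • h) - a x - (b * t + c / 2 * t ^ 2))
            + (a (x + (t + s) • h) - a (x + t • h) - (b * s + c * t * s + c / 2 * s ^ 2)) := by ring
      rw [e2]
      refine (abs_add_le _ _).trans ?_
      have e3 : ((i + 1 : ℕ) : ℝ) * (κ * H ^ 2 / N) = i * (κ * H ^ 2 / N) + κ * H ^ 2 * s := by
        rw [hs]; push_cast; ring
      rw [e3]
      exact add_le_add ih hinc
  have := step N le_rfl
  rw [div_self hN0.ne', one_smul] at this
  calc |a (x + h) - a x - b - c / 2| = |a (x + h) - a x - (b * 1 + c / 2 * 1 ^ 2)| := by ring_nf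
    _ ≤ N * (κ * H ^ 2 / N) := this
    _ = κ * H ^ 2 := by field_simp

/-! ### Sup-convolutions and the maximum principle for semicontinuous functions -/

/-- `a` is the sup-convolution `x ↦ sup_{y ∈ K} (u y - |x - y|² / (2 δ))`. -/
structure IsSupConv (K : Set (E n)) (u : E n → ℝ) (δ : ℝ) (a : E n → ℝ) : Prop where
  le : ∀ x, ∀ y ∈ K, u y - ‖x - y‖ ^ 2 / (2 * δ) ≤ a x
  exists_eq : ∀ x, ∃ y ∈ K, a x = u y - ‖x - y‖ ^ 2 / (2 * δ)

lemma exists_isSupConv {K : Set (E n)} (hK : IsCompact K) (hne : K.Nonempty) {u : E n → ℝ}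
    (hu : ContinuousOn u K) (δ : ℝ) : ∃ a, IsSupConv K u δ a := by
  have h : ∀ x : E n, ∃ y ∈ K, ∀ z ∈ K,
      u z - ‖x - z‖ ^ 2 / (2 * δ) ≤ u y - ‖x - y‖ ^ 2 / (2 * δ) := by
    intro x
    have hc : ContinuousOn (fun y => u y - ‖x - y‖ ^ 2 / (2 * δ)) K :=
      hu.sub (by fun_prop)
    obtain ⟨y, hy, hm⟩ := hK.exists_isMaxOn hne hc
    exact ⟨y, hy, fun z hz => hm hz⟩
  choose y hy hm using h
  exact ⟨fun x => u (y x) - ‖x - y x‖ ^ 2 / (2 * δ), fun x z hz => hm x z hz,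
    fun x => ⟨y x, hy x, rfl⟩⟩

/-- Superjets of a sup-convolution are superjets of the function at the point where the supremum
is attained. -/
lemma IsSupConv.upperJet {K : Set (E n)} {u a : E n → ℝ} {δ : ℝ} (ha : IsSupConv K u δ a)
    {x y p : E n} {X : E n → ℝ} (hy : K ∈ 𝓝 y) (hxy : a x = u y - ‖x - y‖ ^ 2 / (2 * δ))
    (hj : UpperJet a x p X) : UpperJet u y p X := by
  refine ⟨hj.isQuad, fun κ hκ => ?_⟩
  have ht : Tendsto (fun h => y + h) (𝓝 (0 : E n)) (𝓝 y) := by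
    have : Continuous fun h : E n => y + h := by fun_prop
    simpa using this.tendsto 0
  filter_upwards [hj.bound κ hκ, ht.eventually hy] with h h1 h2
  have h3 := ha.le (x + h) (y + h) h2
  rw [add_sub_add_right_eq_sub] at h3
  linarith

lemma IsSupConv.lower_bound {K : Set (E n)} {u a : E n → ℝ} {δ : ℝ} (ha : IsSupConv K u δ a)
    {x y : E n} (hy : y ∈ K) (hxy : a x = u y - ‖x - y‖ ^ 2 / (2 * δ)) (z : E n) :
    a x + ⟪δ⁻¹ • (y - x), z - x⟫ - 1 / (2 * δ) * ‖z - x‖ ^ 2 ≤ a z := by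
  have h := ha.le z y hy
  have e : ‖z - y‖ ^ 2 = ‖x - y‖ ^ 2 - 2 * ⟪y - x, z - x⟫ + ‖z - x‖ ^ 2 := by
    rw [show z - y = (z - x) - (y - x) by abel, norm_sub_sq_real, norm_sub_rev y x,
      real_inner_comm]
    ring
  rw [e] at h
  rw [real_inner_smul_left]
  refine le_trans (le_of_eq ?_) h
  rw [hxy]
  ring

/-- If `a` and `b` have supporting paraboloids from below at a maximum point of `a + b - q`, then
they also have supporting paraboloids from above. -/
lemma sandwich_of_isMax {a b : E n → ℝ} {C : ℝ} {x p r q : E n}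
    (ha : ∀ z, a x + ⟪p, z - x⟫ - C * ‖z - x‖ ^ 2 ≤ a z)
    (hb : ∀ z, b x + ⟪r, z - x⟫ - C * ‖z - x‖ ^ 2 ≤ b z)
    (hm : ∀ z, a z + b z - ⟪q, z⟫ ≤ a x + b x - ⟪q, x⟫) (hq : p + r = q) : Sandwich a C x p := by
  intro z
  have h1 := ha z
  have h2 := hb z
  have h3 := hm z
  have h4 : ⟪q, z⟫ - ⟪q, x⟫ = ⟪p, z - x⟫ + ⟪r, z - x⟫ := by
    rw [← inner_sub_right, ← hq, inner_add_left]
  rw [abs_le]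
  constructor <;> linarith

/-- If all small linear perturbations of `a + b` have maximum points at which `a` and `b` lie
between paraboloids, then at some of these points both functions have second order expansions:
the set of these points has positive measure, since the perturbation is a Lipschitz function of the
point, and the slopes are differentiable almost everywhere in it. -/
lemma exists_expansion {a b : E n → ℝ} {C η : ℝ} (hC : 0 ≤ C) (hη : 0 < η) {x p r : E n → E n}
    (ha : ∀ q, ‖q‖ ≤ η → Sandwich a C (x q) (p q)) (hb : ∀ q, ‖q‖ ≤ η → Sandwich b C (x q) (r q))
    (hq : ∀ q, ‖q‖ ≤ η → p q + r q = q) :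
    ∃ q, ‖q‖ ≤ η ∧ ∃ T T' : E n →L[ℝ] E n, ∀ κ > 0, ∀ᶠ h in 𝓝 (0 : E n),
      |a (x q + h) - a (x q) - ⟪p q, h⟫ - ⟪T h, h⟫ / 2| ≤ κ * ‖h‖ ^ 2 ∧
      |b (x q + h) - b (x q) - ⟪r q, h⟫ - ⟪T' h, h⟫ / 2| ≤ κ * ‖h‖ ^ 2 := by
  set S := x '' closedBall 0 η with hS
  choose! s hs hxs using fun ξ (hξ : ξ ∈ S) => hξ
  have hsη : ∀ ξ ∈ S, ‖s ξ‖ ≤ η := fun ξ hξ => mem_closedBall_zero_iff.1 (hs ξ hξ)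
  have haS : ∀ ξ ∈ S, Sandwich a C ξ (p (s ξ)) := fun ξ hξ => by
    simpa [hxs ξ hξ] using ha _ (hsη ξ hξ)
  have hbS : ∀ ξ ∈ S, Sandwich b C ξ (r (s ξ)) := fun ξ hξ => by
    simpa [hxs ξ hξ] using hb _ (hsη ξ hξ)
  have hLp : LipschitzOnWith (Real.toNNReal (6 * C)) (fun ξ => p (s ξ)) S :=
    LipschitzOnWith.of_dist_le_mul fun ξ hξ ζ hζ => by
      rw [dist_eq_norm, dist_eq_norm, Real.coe_toNNReal _ (by positivity)]
      exact (haS ξ hξ).norm_sub_le (haS ζ hζ)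
  have hLr : LipschitzOnWith (Real.toNNReal (6 * C)) (fun ξ => r (s ξ)) S :=
    LipschitzOnWith.of_dist_le_mul fun ξ hξ ζ hζ => by
      rw [dist_eq_norm, dist_eq_norm, Real.coe_toNNReal _ (by positivity)]
      exact (hbS ξ hξ).norm_sub_le (hbS ζ hζ)
  have hLs : LipschitzOnWith (Real.toNNReal (12 * C)) s S :=
    LipschitzOnWith.of_dist_le_mul fun ξ hξ ζ hζ => by
      rw [dist_eq_norm, dist_eq_norm, Real.coe_toNNReal _ (by positivity)]
      have e : s ξ - s ζ = (p (s ξ) - p (s ζ)) + (r (s ξ) - r (s ζ)) := by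
        nth_rewrite 1 [← hq _ (hsη ξ hξ), ← hq _ (hsη ζ hζ)]
        abel
      rw [e]
      refine (norm_add_le _ _).trans ?_
      linarith [(haS ξ hξ).norm_sub_le (haS ζ hζ), (hbS ξ hξ).norm_sub_le (hbS ζ hζ)]
  have hinv : ∀ q, ‖q‖ ≤ η → s (x q) = q := by
    intro q hqη
    have hxq : x q ∈ S := ⟨q, mem_closedBall_zero_iff.2 hqη, rfl⟩
    have h1 := (haS _ hxq).norm_sub_le (ha q hqη)
    have h2 := (hbS _ hxq).norm_sub_le (hb q hqη)
    rw [sub_self, norm_zero, mul_zero, norm_le_zero_iff, sub_eq_zero] at h1 h2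
    rw [← hq _ (hsη _ hxq), h1, h2, hq q hqη]
  set μ : MeasureTheory.Measure (E n) := MeasureTheory.Measure.hausdorffMeasure n with hμ
  have hpos : μ S ≠ 0 := by
    intro h0
    have h1 := hLs.hausdorffMeasure_image_le (d := n) (by positivity)
    rw [← hμ, h0, mul_zero] at h1
    have h2 : closedBall (0 : E n) η ⊆ s '' S := fun q hqη =>
      ⟨x q, ⟨q, hqη, rfl⟩, hinv q (mem_closedBall_zero_iff.1 hqη)⟩
    have h3 := (measure_closedBall_pos μ (0 : E n) hη).trans_le (MeasureTheory.measure_mono h2)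
    exact absurd h1 (not_le.2 h3)
  have h1 : ∀ᵐ ξ ∂μ.restrict S, DifferentiableWithinAt ℝ (fun ξ => p (s ξ)) S ξ ∨ ξ ∉ S :=
    MeasureTheory.ae_restrict_of_ae (hLp.ae_differentiableWithinAt_of_mem.mono fun ξ h => by tauto)
  have h2 : ∀ᵐ ξ ∂μ.restrict S, DifferentiableWithinAt ℝ (fun ξ => r (s ξ)) S ξ ∨ ξ ∉ S :=
    MeasureTheory.ae_restrict_of_ae (hLr.ae_differentiableWithinAt_of_mem.mono fun ξ h => by tauto)
  have h3 := Besicovitch.ae_tendsto_measure_inter_div μ S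
  have h4 := (h1.and h2).and h3
  obtain ⟨ξ, hξS, ⟨hξ1, hξ2⟩, hξ3⟩ : ∃ ξ ∈ S,
      ((DifferentiableWithinAt ℝ (fun ξ => p (s ξ)) S ξ ∨ ξ ∉ S) ∧
        (DifferentiableWithinAt ℝ (fun ξ => r (s ξ)) S ξ ∨ ξ ∉ S)) ∧
      Tendsto (fun r => μ (S ∩ closedBall ξ r) / μ (closedBall ξ r)) (𝓝[>] 0) (𝓝 1) := by
    by_contra! hcon
    rw [MeasureTheory.ae_iff] at h4
    refine hpos (le_antisymm ?_ bot_le)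
    calc μ S ≤ μ ({ξ | ¬(((DifferentiableWithinAt ℝ (fun ξ => p (s ξ)) S ξ ∨ ξ ∉ S) ∧
        (DifferentiableWithinAt ℝ (fun ξ => r (s ξ)) S ξ ∨ ξ ∉ S)) ∧
        Tendsto (fun r => μ (S ∩ closedBall ξ r) / μ (closedBall ξ r)) (𝓝[>] 0) (𝓝 1))} ∩ S) :=
          MeasureTheory.measure_mono fun ξ hξ => ⟨fun h => hcon ξ hξ h.1 h.2, hξ⟩
      _ ≤ _ := MeasureTheory.Measure.le_restrict_apply _ _
      _ = 0 := h4
  have hξ1 := hξ1.resolve_right (not_not.2 hξS)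
  have hξ2 := hξ2.resolve_right (not_not.2 hξS)
  refine ⟨s ξ, hsη ξ hξS, fderivWithin ℝ (fun ξ => p (s ξ)) S ξ,
    fderivWithin ℝ (fun ξ => r (s ξ)) S ξ, fun κ hκ => ?_⟩
  rw [hxs ξ hξS]
  exact (expansion_of_sandwich haS hξ1.hasFDerivWithinAt
    (fun κ hκ => exists_mem_near_of_density hξ3 hκ) hκ).and
    (expansion_of_sandwich hbS hξ2.hasFDerivWithinAt
    (fun κ hκ => exists_mem_near_of_density hξ3 hκ) hκ)

/-- The perturbed and penalised maximum points are interior if the penalisation is strong and the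
perturbation is small. -/
lemma exists_penalisation {K Ω : Set (E n)} (hK : IsCompact K) (hΩ : IsOpen Ω)
    {u w : E n → ℝ} (hu : ContinuousOn u K) (hw : ContinuousOn w K) {y₀ : E n} (hy₀ : y₀ ∈ K)
    (hlt : ∀ y ∈ K \ Ω, u y + w y < u y₀ + w y₀) :
    ∃ δ > 0, ∃ η₀ > 0, ∀ q : E n, ‖q‖ ≤ η₀ → ∀ y ∈ K, ∀ z ∈ K,
      u y₀ + w y₀ - ⟪q, y₀⟫ ≤ u y + w z - ‖y - z‖ ^ 2 / (4 * δ) - ⟪q, (1 / 2 : ℝ) • (y + z)⟫ →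
      y ∈ Ω ∧ z ∈ Ω := by
  obtain ⟨θ, hθ, hlt⟩ : ∃ θ > 0, ∀ y ∈ K \ Ω, u y + w y ≤ u y₀ + w y₀ - θ := by
    rcases (K \ Ω).eq_empty_or_nonempty with he | hne
    · exact ⟨1, one_pos, by simp [he]⟩
    · obtain ⟨y, hy, hm⟩ := (hK.diff hΩ).exists_isMaxOn hne
        ((hu.add hw).mono sdiff_subset)
      exact ⟨u y₀ + w y₀ - (u y + w y), by linarith [hlt y hy], fun z hz => by
        have : u z + w z ≤ u y + w y := hm hz
        linarith⟩
  obtain ⟨R, hR0, hR⟩ : ∃ R > 0, ∀ y ∈ K, ‖y‖ ≤ R := by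
    obtain ⟨R, hR⟩ := hK.isBounded.exists_norm_le
    exact ⟨max R 1, by positivity, fun y hy => (hR y hy).trans (le_max_left _ _)⟩
  obtain ⟨B, hB⟩ := hK.exists_bound_of_continuousOn hu
  obtain ⟨B', hB'⟩ := hK.exists_bound_of_continuousOn hw
  have hB0 : 0 ≤ B := (norm_nonneg _).trans (hB y₀ hy₀)
  have hB0' : 0 ≤ B' := (norm_nonneg _).trans (hB' y₀ hy₀)
  obtain ⟨ρ, hρ, hρu⟩ := Metric.uniformContinuousOn_iff.1
    (hK.uniformContinuousOn_of_continuous hu) (θ / 4) (by positivity)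
  obtain ⟨ρ', hρ', hρw⟩ := Metric.uniformContinuousOn_iff.1
    (hK.uniformContinuousOn_of_continuous hw) (θ / 4) (by positivity)
  set η₀ := θ / (8 * R) with hη₀
  have hη0 : 0 < η₀ := by positivity
  set A := 2 * B + 2 * B' + 2 * R * η₀ + 1 with hA
  have hA0 : 0 < A := by positivity
  set m := min ρ ρ'
  have hm : 0 < m := lt_min hρ hρ'
  refine ⟨m ^ 2 / (8 * A), by positivity, η₀, hη0, fun q hq y hy z hz h => ?_⟩
  have hin1 : |⟪q, y₀⟫| ≤ η₀ * R :=
    (abs_real_inner_le_norm _ _).trans (mul_le_mul hq (hR _ hy₀) (norm_nonneg _) hη0.le)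
  have hin2 : |⟪q, (1 / 2 : ℝ) • (y + z)⟫| ≤ η₀ * R := by
    refine (abs_real_inner_le_norm _ _).trans (mul_le_mul hq ?_ (norm_nonneg _) hη0.le)
    rw [norm_smul]
    have := norm_add_le y z
    have := hR y hy
    have := hR z hz
    norm_num
    linarith
  have e : 4 * (m ^ 2 / (8 * A)) = m ^ 2 / (2 * A) := by field_simp; norm_num
  rw [e, div_div_eq_mul_div] at h
  have hηR : η₀ * R = θ / 8 := by rw [hη₀]; field_simp
  have hin1 := abs_le.1 hin1
  have hin2 := abs_le.1 hin2
  have hb1 := abs_le.1 (hB y hy)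
  have hb2 := abs_le.1 (hB y₀ hy₀)
  have hb3 := abs_le.1 (hB' z hz)
  have hb4 := abs_le.1 (hB' y₀ hy₀)
  have hyz : ‖y - z‖ < m := by
    have h1 : ‖y - z‖ ^ 2 * (2 * A) / m ^ 2 ≤ A := by rw [hA]; linarith
    rw [div_le_iff₀ (by positivity)] at h1
    have h2 : ‖y - z‖ ^ 2 < m ^ 2 := by nlinarith [sq_pos_of_pos hm]
    exact lt_of_pow_lt_pow_left₀ 2 hm.le h2
  have hpen : 0 ≤ ‖y - z‖ ^ 2 * (2 * A) / m ^ 2 := by positivity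
  have h1 := hρu y hy z hz (by rw [dist_eq_norm]; exact hyz.trans_le (min_le_left _ _))
  have h2 := hρw y hy z hz (by rw [dist_eq_norm]; exact hyz.trans_le (min_le_right _ _))
  rw [Real.dist_eq, abs_lt] at h1 h2
  constructor
  · by_contra hcon
    linarith [hlt y ⟨hy, hcon⟩]
  · by_contra hcon
    linarith [hlt z ⟨hz, hcon⟩]

/-- The maximum principle for continuous functions (the theorem on sums): if `u + w` is larger at
some point than outside of `Ω`, then `u` and `w` have superjets at points of `Ω`
whose slopes almost cancel and whose second order parts have nonpositive sum. -/
theorem exists_upperJets {K Ω : Set (E n)} (hK : IsCompact K) (hΩ : IsOpen Ω) (hΩK : Ω ⊆ K)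
    {u w : E n → ℝ} (hu : ContinuousOn u K) (hw : ContinuousOn w K) {y₀ : E n} (hy₀ : y₀ ∈ K)
    (hlt : ∀ y ∈ K \ Ω, u y + w y < u y₀ + w y₀) :
    ∃ R > 0, ∀ η > 0, ∃ y ∈ Ω, ∃ z ∈ Ω, ∃ p r X Z, UpperJet u y p X ∧ UpperJet w z r Z ∧
      (∀ h, X h + Z h ≤ 0) ∧ ‖p‖ ≤ R ∧ ‖r‖ ≤ R ∧ ‖p + r‖ ≤ η := by
  obtain ⟨δ, hδ, η₀, hη₀, hpen⟩ := exists_penalisation hK hΩ hu hw hy₀ hlt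
  obtain ⟨a, ha⟩ := exists_isSupConv hK ⟨y₀, hy₀⟩ hu δ
  obtain ⟨b, hb⟩ := exists_isSupConv hK ⟨y₀, hy₀⟩ hw δ
  have hmax : ∀ q : E n, ∃ yz ∈ K ×ˢ K, ∀ yz' ∈ K ×ˢ K,
      u yz'.1 + w yz'.2 - ‖yz'.1 - yz'.2‖ ^ 2 / (4 * δ) - ⟪q, (1 / 2 : ℝ) • (yz'.1 + yz'.2)⟫
      ≤ u yz.1 + w yz.2 - ‖yz.1 - yz.2‖ ^ 2 / (4 * δ) - ⟪q, (1 / 2 : ℝ) • (yz.1 + yz.2)⟫ := by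
    intro q
    have hc : ContinuousOn (fun yz : E n × E n => u yz.1 + w yz.2 - ‖yz.1 - yz.2‖ ^ 2 / (4 * δ)
        - ⟪q, (1 / 2 : ℝ) • (yz.1 + yz.2)⟫) (K ×ˢ K) := by
      refine (((hu.comp continuousOn_fst fun _ h => h.1).add
        (hw.comp continuousOn_snd fun _ h => h.2)).sub ?_).sub ?_ <;> fun_prop
    obtain ⟨yz, h1, h2⟩ := (hK.prod hK).exists_isMaxOn ⟨(y₀, y₀), hy₀, hy₀⟩ hc
    exact ⟨yz, h1, fun _ h => h2 h⟩
  choose yz hyz hyzmax using hmax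
  let x : E n → E n := fun q => (1 / 2 : ℝ) • ((yz q).1 + (yz q).2) - (δ / 2) • q
  let p : E n → E n := fun q => δ⁻¹ • ((yz q).1 - x q)
  let r : E n → E n := fun q => δ⁻¹ • ((yz q).2 - x q)
  have hpr : ∀ q, p q + r q = q := by
    intro q
    simp only [p, r, x, ← smul_add]
    rw [inv_smul_eq_iff₀ hδ.ne']
    module
  -- completing the square in the variable `ξ`
  have hsq : ∀ q ξ y z : E n, ‖ξ - y‖ ^ 2 / (2 * δ) + ‖ξ - z‖ ^ 2 / (2 * δ) + ⟪q, ξ⟫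
      = ‖y - z‖ ^ 2 / (4 * δ) + ⟪q, (1 / 2 : ℝ) • (y + z)⟫ - δ / 4 * ‖q‖ ^ 2
        + δ⁻¹ * ‖ξ - ((1 / 2 : ℝ) • (y + z) - (δ / 2) • q)‖ ^ 2 := by
    intro q ξ y z
    set c := ξ - ((1 / 2 : ℝ) • (y + z) - (δ / 2) • q) with hc
    set d := (1 / 2 : ℝ) • (y - z) with hd
    have e1 : ξ - y = (c - (δ / 2) • q) - d := by rw [hc, hd]; module
    have e2 : ξ - z = (c - (δ / 2) • q) + d := by rw [hc, hd]; module
    have e3 : ξ = c + (1 / 2 : ℝ) • (y + z) - (δ / 2) • q := by rw [hc]; module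
    have e4 : ‖y - z‖ ^ 2 = 4 * ‖d‖ ^ 2 := by
      rw [hd, norm_smul, mul_pow]
      norm_num
      ring
    have e5 : ⟪q, ξ⟫ = ⟪q, c⟫ + ⟪q, (1 / 2 : ℝ) • (y + z)⟫ - δ / 2 * ‖q‖ ^ 2 := by
      rw [e3, inner_sub_right, inner_add_right, real_inner_smul_right q q,
        real_inner_self_eq_norm_sq]
    have e6 : ‖c - (δ / 2) • q‖ ^ 2 = ‖c‖ ^ 2 - δ * ⟪q, c⟫ + δ ^ 2 / 4 * ‖q‖ ^ 2 := by
      rw [norm_sub_sq_real, real_inner_smul_right, norm_smul, real_inner_comm, mul_pow,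
        Real.norm_eq_abs, sq_abs]
      ring
    rw [e5, e4, e1, e2, norm_sub_sq_real, norm_add_sq_real, e6]
    field_simp
    ring
  have hglob : ∀ q ξ, ∀ y ∈ K, ∀ z ∈ K,
      u y - ‖ξ - y‖ ^ 2 / (2 * δ) + (w z - ‖ξ - z‖ ^ 2 / (2 * δ)) - ⟪q, ξ⟫
      ≤ u (yz q).1 - ‖x q - (yz q).1‖ ^ 2 / (2 * δ)
        + (w (yz q).2 - ‖x q - (yz q).2‖ ^ 2 / (2 * δ)) - ⟪q, x q⟫ := by
    intro q ξ y hy z hz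
    have h1 := hsq q ξ y z
    have h2 := hsq q (x q) (yz q).1 (yz q).2
    have h3 : ‖x q - ((1 / 2 : ℝ) • ((yz q).1 + (yz q).2) - (δ / 2) • q)‖ = 0 := by
      rw [norm_eq_zero, sub_eq_zero]
    rw [h3] at h2
    have h4 := hyzmax q (y, z) ⟨hy, hz⟩
    have h5 : 0 ≤ δ⁻¹ * ‖ξ - ((1 / 2 : ℝ) • (y + z) - (δ / 2) • q)‖ ^ 2 := by positivity
    simp only at h4
    linarith
  have hax : ∀ q, a (x q) = u (yz q).1 - ‖x q - (yz q).1‖ ^ 2 / (2 * δ) := by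
    intro q
    refine le_antisymm ?_ (ha.le _ _ (hyz q).1)
    obtain ⟨y, hy, h⟩ := ha.exists_eq (x q)
    rw [h]
    linarith [hglob q (x q) y hy _ (hyz q).2]
  have hbx : ∀ q, b (x q) = w (yz q).2 - ‖x q - (yz q).2‖ ^ 2 / (2 * δ) := by
    intro q
    refine le_antisymm ?_ (hb.le _ _ (hyz q).2)
    obtain ⟨y, hy, h⟩ := hb.exists_eq (x q)
    rw [h]
    linarith [hglob q (x q) _ (hyz q).1 y hy]
  have habmax : ∀ q ξ, a ξ + b ξ - ⟪q, ξ⟫ ≤ a (x q) + b (x q) - ⟪q, x q⟫ := by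
    intro q ξ
    obtain ⟨y, hy, h⟩ := ha.exists_eq ξ
    obtain ⟨z, hz, h'⟩ := hb.exists_eq ξ
    rw [h, h', hax, hbx]
    exact hglob q ξ y hy z hz
  have hla := fun q => ha.lower_bound (hyz q).1 (hax q)
  have hlb := fun q => hb.lower_bound (hyz q).2 (hbx q)
  have hsa : ∀ q, Sandwich a (1 / (2 * δ)) (x q) (p q) := fun q =>
    sandwich_of_isMax (hla q) (hlb q) (habmax q) (hpr q)
  have hsb : ∀ q, Sandwich b (1 / (2 * δ)) (x q) (r q) := fun q =>
    sandwich_of_isMax (hlb q) (hla q) (fun z => by linarith [habmax q z])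
      (by rw [add_comm]; exact hpr q)
  obtain ⟨R, hR⟩ := hK.isBounded.exists_norm_le
  refine ⟨δ⁻¹ * R + 1 / 2 + |R|, ?_, fun η hη => ?_⟩
  · have : 0 ≤ R := (norm_nonneg _).trans (hR _ hy₀)
    positivity
  have hη' : 0 < min 1 (min η η₀) := by positivity
  obtain ⟨q, hq, T, T', hexp⟩ := exists_expansion (by positivity) hη' (fun q _ => hsa q) (fun q _ => hsb q)
    fun q _ => hpr q
  rw [le_min_iff, le_min_iff] at hq
  obtain ⟨hq1, hqη, hqη₀⟩ := hq
  obtain ⟨hyΩ, hzΩ⟩ := hpen q hqη₀ _ (hyz q).1 _ (hyz q).2 (by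
    have h0 := hyzmax q (y₀, y₀) ⟨hy₀, hy₀⟩
    have e : (1 / 2 : ℝ) • (y₀ + y₀) = y₀ := by module
    simp only [e, sub_self, norm_zero] at h0
    linarith [show (0 : ℝ) ^ 2 / (4 * δ) = 0 by simp])
  have hKn : ∀ y ∈ Ω, K ∈ 𝓝 y := fun y hy => mem_of_superset (hΩ.mem_nhds hy) hΩK
  have hQ : ∀ S : E n →L[ℝ] E n, IsQuad fun h => ⟪S h, h⟫ := fun S => ⟨S, fun _ => rfl⟩
  have hja : UpperJet a (x q) (p q) fun h => ⟪T h, h⟫ := ⟨hQ T, fun κ hκ => by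
    filter_upwards [hexp κ hκ] with h hh
    linarith [(abs_le.1 hh.1).2]⟩
  have hjb : UpperJet b (x q) (r q) fun h => ⟪T' h, h⟫ := ⟨hQ T', fun κ hκ => by
    filter_upwards [hexp κ hκ] with h hh
    linarith [(abs_le.1 hh.2).2]⟩
  have hbound : ∀ y ∈ K, ∀ z ∈ K, ‖δ⁻¹ • (y - ((1 / 2 : ℝ) • (y + z) - (δ / 2) • q))‖
      ≤ δ⁻¹ * R + 1 / 2 + |R| := by
    intro y hy z hz
    have e : δ⁻¹ • (y - ((1 / 2 : ℝ) • (y + z) - (δ / 2) • q))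
        = (δ⁻¹ * (1 / 2)) • (y - z) + (1 / 2 : ℝ) • q := by
      have : (1 / 2 : ℝ) • q = δ⁻¹ • ((δ / 2) • q) := by
        rw [smul_smul]; congr 1; field_simp
      rw [this, mul_smul, ← smul_add]
      congr 1
      module
    rw [e]
    have h1 := norm_sub_le y z
    have h2 := hR y hy
    have h3 := hR z hz
    have h4 : 0 < δ⁻¹ := by positivity
    calc _ ≤ ‖(δ⁻¹ * (1 / 2)) • (y - z)‖ + ‖(1 / 2 : ℝ) • q‖ := norm_add_le _ _
      _ = δ⁻¹ * (1 / 2) * ‖y - z‖ + 1 / 2 * ‖q‖ := by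
        rw [norm_smul, norm_smul, Real.norm_eq_abs, Real.norm_eq_abs, abs_of_pos (by positivity),
          abs_of_pos (by norm_num : (0 : ℝ) < 1 / 2)]
      _ ≤ δ⁻¹ * (1 / 2) * (2 * R) + 1 / 2 * 1 := by gcongr; linarith
      _ ≤ _ := by linarith [abs_nonneg R]
  refine ⟨_, hyΩ, _, hzΩ, p q, r q, _, _, ha.upperJet (hKn _ hyΩ) (hax q) hja,
    hb.upperJet (hKn _ hzΩ) (hbx q) hjb, fun h => ?_, hbound _ (hyz q).1 _ (hyz q).2, ?_, ?_⟩
  · -- the second order expansion of `a + b - q` at its maximum point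
    by_contra! hpos
    set c := ⟪T h, h⟫ + ⟪T' h, h⟫ with hc
    have hh : 0 < ‖h‖ := by
      rw [norm_pos_iff]
      rintro rfl
      simp [hc] at hpos
    have hκ : 0 < c / (8 * ‖h‖ ^ 2) := by positivity
    have ht : Tendsto (fun t : ℝ => t • h) (𝓝[>] 0) (𝓝 0) := by
      have : Continuous fun t : ℝ => t • h := by fun_prop
      simpa using (this.tendsto 0).mono_left nhdsWithin_le_nhds
    obtain ⟨t, hte, ht0⟩ := ((ht.eventually (hexp _ hκ)).and self_mem_nhdsWithin).exists
    have ht0 : 0 < t := ht0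
    have h1 := (abs_le.1 hte.1).1
    have h2 := (abs_le.1 hte.2).1
    have h3 := habmax q (x q + t • h)
    have e : ⟪p q, t • h⟫ + ⟪r q, t • h⟫ = ⟪q, t • h⟫ := by rw [← inner_add_left, hpr]
    rw [inner_add_right] at h3
    have e1 : ∀ S : E n →L[ℝ] E n, ⟪S (t • h), t • h⟫ = t ^ 2 * ⟪S h, h⟫ := fun S => by
      rw [map_smul, real_inner_smul_left, real_inner_smul_right]; ring
    have e2 : c / (8 * ‖h‖ ^ 2) * ‖t • h‖ ^ 2 = t ^ 2 * c / 8 := by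
      rw [norm_smul, Real.norm_eq_abs, mul_pow, sq_abs]
      field_simp
    rw [e1, e2] at h1 h2
    have h4 : 0 < t ^ 2 * c := by positivity
    have h5 : t ^ 2 * c = t ^ 2 * ⟪T h, h⟫ + t ^ 2 * ⟪T' h, h⟫ := by rw [hc]; ring
    linarith
  · have := hbound _ (hyz q).2 _ (hyz q).1
    rwa [add_comm (yz q).2] at this
  · rw [hpr]
    exact hqη

/-! ### The comparison principle -/

/-- If `q` satisfies the equation at a point then `Q = q + τ (1 + s |x|²)` satisfies it with a
positive margin, as long as `s |x|² ≤ 1/2`. Here `Y` and `P` are the second order part and the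
slope of `Q`. -/
lemma strict_margin {q τ s a b c H Y : ℝ} (hq : 0 < q) (hτ : 0 < τ) (hs : 0 < s)
    (hsb : s * b ^ 2 ≤ 1 / 2) (hc : |c| ≤ a * b) (hH : 0 ≤ H) :
    (q + τ * (1 + s * b ^ 2)) / q * (q * (Y - 2 * τ * s * H) - a ^ 2 / 2 * H) + τ * s * q * H
      ≤ (q + τ * (1 + s * b ^ 2)) * Y - (a ^ 2 + 4 * τ * s * c + 4 * τ ^ 2 * s ^ 2 * b ^ 2) / 2 * H := by
  have hc := (abs_le.1 hc).2
  have h1 : 0 ≤ (a - 2 * s * q * b) ^ 2 / (2 * q) := by positivity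
  have e1 : (a - 2 * s * q * b) ^ 2 / (2 * q) = a ^ 2 / (2 * q) - 2 * s * (a * b) + 2 * s ^ 2 * b ^ 2 * q := by
    field_simp
    ring
  have h2 : 0 ≤ s * b ^ 2 * (a ^ 2 / (2 * q)) := by positivity
  have h3 : 0 ≤ (1 - s * b ^ 2 * 2) * (s * q) := mul_nonneg (by linarith) (by positivity)
  have h4 : 0 ≤ s * τ * (1 - s * b ^ 2) := mul_nonneg (by positivity) (by linarith)
  have key : s * q ≤ (1 + s * b ^ 2) * (a ^ 2 / (2 * q)) - 2 * s * c - 2 * τ * s ^ 2 * b ^ 2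
      + 2 * s * (q + τ * (1 + s * b ^ 2)) := by
    have h5 : 0 ≤ s * (a * b - c) := mul_nonneg hs.le (by linarith)
    have h6 : 0 ≤ s * τ * (s * b ^ 2) := by positivity
    nlinarith
  have h7 := mul_le_mul_of_nonneg_left key (mul_nonneg hτ.le hH)
  have e2 : (q + τ * (1 + s * b ^ 2)) * Y - (a ^ 2 + 4 * τ * s * c + 4 * τ ^ 2 * s ^ 2 * b ^ 2) / 2 * H
      - (q + τ * (1 + s * b ^ 2)) / q * (q * (Y - 2 * τ * s * H) - a ^ 2 / 2 * H)
      = τ * H * ((1 + s * b ^ 2) * (a ^ 2 / (2 * q)) - 2 * s * c - 2 * τ * s ^ 2 * b ^ 2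
      + 2 * s * (q + τ * (1 + s * b ^ 2))) := by
    field_simp
    ring
  linarith

/-- The superjets of `log (q + τ (1 + s |x|²))`, for a supersolution `q`, satisfy the strict
supersolution condition. -/
lemma SuperOn.strict (hΓ : IsAdmissibleCone Γ) {Ω : Set (E n)} {q : E n → ℝ} {τ s : ℝ} (hΩ : IsOpen Ω)
    (hpos : ∀ z ∈ Ω, 0 < q z) (hq : SuperOn Γ Ω q) (hτ : 0 < τ) (hs : 0 < s) {z r : E n}
    {Z : E n → ℝ} (hz : z ∈ Ω) (hsz : s * ‖z‖ ^ 2 ≤ 1 / 2)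
    (hj : UpperJet (fun z => Real.log (q z + τ * (1 + s * ‖z‖ ^ 2))) z r Z) :
    InClosedCone Γ fun h => Z h + ⟪r, h⟫ ^ 2 - ‖r‖ ^ 2 / 2 * ‖h‖ ^ 2
      - τ * s * q z / (q z + τ * (1 + s * ‖z‖ ^ 2)) ^ 2 * ‖h‖ ^ 2 := by
  have hqz := hpos z hz
  have hQ : 0 < q z + τ * (1 + s * ‖z‖ ^ 2) := by positivity
  set Q := q z + τ * (1 + s * ‖z‖ ^ 2) with hQdef
  have h1 := hj.comp_monotoneOn (F := Real.exp) (F' := Real.exp) (c := Q) (S := univ) univ_mem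
    (Real.exp_monotone.monotoneOn _) (fun _ => mem_univ _) (fun s _ => Real.hasDerivAt_exp s)
    (by simpa [← hQdef, Real.exp_log hQ] using Real.hasDerivAt_exp (Real.log Q))
  rw [← hQdef, Real.exp_log hQ] at h1
  have h2 : UpperJet (fun z => q z + τ * (1 + s * ‖z‖ ^ 2)) z (Q • r)
      (fun h => Q * Z h + Q * ⟪r, h⟫ ^ 2) := by
    refine h1.of_le (by rw [← hQdef, Real.exp_log hQ]) ?_
    filter_upwards [hΩ.mem_nhds hz] with x hx
    have := hpos x hx
    rw [Real.exp_log (by positivity)]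
  have h3 := (upperJet_neg_normSq z 0).const_mul (mul_pos hτ hs)
  have h4 := (h2.add h3).add (upperJet_inner z 0 (-τ))
  have h5 : UpperJet q z _ _ := h4.of_le (u := q)
    (by simp only [sub_zero, inner_zero_left]; ring)
    (Eventually.of_forall fun x => by simp only [sub_zero, inner_zero_left]; linarith)
  refine (hq z hz _ _ h5).of_mul hΓ (t := 1 / (q z * Q)) (by positivity) fun h => ?_
  set p := Q • r + (τ * s) • -((2 : ℝ) • (z - 0)) + 0 with hp
  have hP : Q • r = p + (2 * τ * s) • z := by
    rw [hp, sub_zero]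
    module
  have hn : Q ^ 2 * ‖r‖ ^ 2 = ‖p‖ ^ 2 + 4 * τ * s * ⟪p, z⟫ + 4 * τ ^ 2 * s ^ 2 * ‖z‖ ^ 2 := by
    have : ‖Q • r‖ ^ 2 = Q ^ 2 * ‖r‖ ^ 2 := by
      rw [norm_smul, mul_pow, Real.norm_eq_abs, sq_abs]
    rw [← this, hP, norm_add_sq_real, real_inner_smul_right, norm_smul, mul_pow, Real.norm_eq_abs,
      sq_abs]
    ring
  have h6 := strict_margin (H := ‖h‖ ^ 2) (Y := Q * Z h + Q * ⟪r, h⟫ ^ 2) hqz hτ hs hsz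
    (abs_real_inner_le_norm p z) (sq_nonneg _)
  rw [← hn, ← hQdef] at h6
  have h7 := mul_le_mul_of_nonneg_left h6 (show 0 ≤ 1 / Q ^ 2 by positivity)
  have e1 : 1 / Q ^ 2 * (Q * (Q * Z h + Q * ⟪r, h⟫ ^ 2) - Q ^ 2 * ‖r‖ ^ 2 / 2 * ‖h‖ ^ 2)
      = Z h + ⟪r, h⟫ ^ 2 - ‖r‖ ^ 2 / 2 * ‖h‖ ^ 2 := by
    field_simp
  have e2 : 1 / Q ^ 2 * (Q / q z * (q z * (Q * Z h + Q * ⟪r, h⟫ ^ 2 - 2 * τ * s * ‖h‖ ^ 2)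
      - ‖p‖ ^ 2 / 2 * ‖h‖ ^ 2) + τ * s * q z * ‖h‖ ^ 2)
      = 1 / (q z * Q) * (q z * (Q * Z h + Q * ⟪r, h⟫ ^ 2 - 2 * τ * s * ‖h‖ ^ 2)
      - ‖p‖ ^ 2 / 2 * ‖h‖ ^ 2) + τ * s * q z / Q ^ 2 * ‖h‖ ^ 2 := by
    field_simp
  rw [e1, e2] at h7
  have e3 : q z * (Q * Z h + Q * ⟪r, h⟫ ^ 2 - 2 * τ * s * ‖h‖ ^ 2)
      = q z * (Q * Z h + Q * ⟪r, h⟫ ^ 2 + τ * s * -(2 * ‖h‖ ^ 2) + 0) := by ring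
  rw [e3] at h7
  linarith

/-- The comparison principle for positive functions. The theorem on sums is applied to `-log q₁` and
`log (q₂ + τ (1 + s |x|²))`: the gradient terms of the two equations agree up to the small error in
the slopes, which the strict margin of the perturbed supersolution absorbs. -/
theorem comparison (hΓ : IsAdmissibleCone Γ) {K Ω : Set (E n)} (hK : IsCompact K) (hΩ : IsOpen Ω)
    (hΩK : Ω ⊆ K) {q₁ q₂ : E n → ℝ} (hc₁ : ContinuousOn q₁ K) (hc₂ : ContinuousOn q₂ K)
    (hpos₁ : ∀ z ∈ K, 0 < q₁ z) (hpos₂ : ∀ z ∈ K, 0 < q₂ z) (hsub : SubOn Γ Ω q₁)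
    (hsup : SuperOn Γ Ω q₂) (hb : ∀ z ∈ K \ Ω, q₂ z ≤ q₁ z) : ∀ z ∈ K, q₂ z ≤ q₁ z := by
  by_contra! hcon
  obtain ⟨y₀, hy₀, hlt⟩ := hcon
  obtain ⟨R₀, hR₀⟩ := hK.isBounded.exists_norm_le
  obtain ⟨s, hs, hsK⟩ : ∃ s > 0, ∀ z ∈ K, s * ‖z‖ ^ 2 ≤ 1 / 2 := by
    refine ⟨1 / (2 * (R₀ ^ 2 + 1)), by positivity, fun z hz => ?_⟩
    have : ‖z‖ ^ 2 ≤ R₀ ^ 2 := by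
      have := hR₀ z hz
      gcongr
    rw [one_div_mul_eq_div, div_le_div_iff₀ (by positivity) two_pos]
    linarith
  obtain ⟨m, hm, hmK⟩ : ∃ m > 0, ∀ z ∈ K, m ≤ q₁ z := by
    obtain ⟨z, hz, h⟩ := hK.exists_isMinOn ⟨y₀, hy₀⟩ hc₁
    exact ⟨q₁ z, hpos₁ z hz, fun x hx => h hx⟩
  set γ := q₂ y₀ / q₁ y₀ - 1 with hγ
  have hγ0 : 0 < γ := by
    rw [hγ, sub_pos, one_lt_div (hpos₁ _ hy₀)]
    exact hlt
  set τ := γ * m / 4 with hτ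
  have hτ0 : 0 < τ := by positivity
  have hQpos : ∀ z ∈ K, 0 < q₂ z + τ * (1 + s * ‖z‖ ^ 2) := fun z hz => by
    have := hpos₂ z hz
    positivity
  have hcQ : ContinuousOn (fun z => q₂ z + τ * (1 + s * ‖z‖ ^ 2)) K := hc₂.add (by fun_prop)
  have hcu : ContinuousOn (fun z => -Real.log (q₁ z)) K :=
    (hc₁.log fun z hz => (hpos₁ z hz).ne').neg
  have hcw : ContinuousOn (fun z => Real.log (q₂ z + τ * (1 + s * ‖z‖ ^ 2))) K :=
    hcQ.log fun z hz => (hQpos z hz).ne'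
  obtain ⟨c, hc, hcK⟩ : ∃ c > 0, ∀ z ∈ K,
      c ≤ τ * s * q₂ z / (q₂ z + τ * (1 + s * ‖z‖ ^ 2)) ^ 2 := by
    have : ContinuousOn (fun z => τ * s * q₂ z / (q₂ z + τ * (1 + s * ‖z‖ ^ 2)) ^ 2) K :=
      (continuousOn_const.mul hc₂).div (hcQ.pow 2) fun z hz => (pow_pos (hQpos z hz) 2).ne'
    obtain ⟨z, hz, h⟩ := hK.exists_isMinOn ⟨y₀, hy₀⟩ this
    refine ⟨_, ?_, fun x hx => h hx⟩
    have := hpos₂ z hz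
    have := hQpos z hz
    positivity
  obtain ⟨R, hR, hjets⟩ := exists_upperJets hK hΩ hΩK hcu hcw hy₀ (by
    intro y hy
    have h1 := hpos₁ y hy.1
    have h2 := hpos₁ y₀ hy₀
    have e : ∀ z ∈ K, -Real.log (q₁ z) + Real.log (q₂ z + τ * (1 + s * ‖z‖ ^ 2))
        = Real.log ((q₂ z + τ * (1 + s * ‖z‖ ^ 2)) / q₁ z) := fun z hz => by
      rw [Real.log_div (hQpos z hz).ne' (hpos₁ z hz).ne']
      ring
    rw [e y hy.1, e y₀ hy₀]
    refine Real.log_lt_log (div_pos (hQpos y hy.1) h1) ?_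
    have h3 : (q₂ y + τ * (1 + s * ‖y‖ ^ 2)) / q₁ y ≤ 1 + γ / 2 := by
      rw [div_le_iff₀ h1]
      have h4 := hb y hy
      have h5 := hsK y hy.1
      have h6 : τ * (1 + s * ‖y‖ ^ 2) ≤ τ * 2 := by gcongr; linarith
      have h7 : γ / 2 * m ≤ γ / 2 * q₁ y := by gcongr; exact hmK y hy.1
      rw [hτ] at h6 ⊢
      linarith
    have h8 : 1 + γ ≤ (q₂ y₀ + τ * (1 + s * ‖y₀‖ ^ 2)) / q₁ y₀ := by
      rw [hγ, add_sub_cancel]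
      gcongr
      have : 0 ≤ τ * (1 + s * ‖y₀‖ ^ 2) := by positivity
      linarith
    linarith)
  obtain ⟨y, hy, z, hz, p, r, X, Z, hju, hjw, hXZ, hp, hr, hpr⟩ :=
    hjets (c / (6 * R)) (by positivity)
  have hq1 := hpos₁ y (hΩK hy)
  have h1 := hju.comp_monotoneOn (F := fun s => -Real.exp (-s)) (F' := fun s => Real.exp (-s))
    (c := -q₁ y) (S := univ) univ_mem
    (fun a _ b _ hab => neg_le_neg (Real.exp_le_exp.2 (neg_le_neg hab))) (fun _ => mem_univ _)
    (fun s _ => by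
      have := ((Real.hasDerivAt_exp (-s)).comp s (hasDerivAt_neg s)).neg
      refine this.congr_deriv (by ring))
    (by
      have := (Real.hasDerivAt_exp (-(-Real.log (q₁ y)))).comp (-Real.log (q₁ y))
        (hasDerivAt_neg (-Real.log (q₁ y)))
      refine this.congr_deriv ?_
      rw [neg_neg, Real.exp_log hq1]
      ring)
  rw [neg_neg, Real.exp_log hq1] at h1
  have h2 : UpperJet (fun z => -q₁ z) y _ _ := h1.of_le
    (by rw [neg_neg, Real.exp_log hq1])
    (by
      filter_upwards [hΩ.mem_nhds hy] with x hx
      rw [neg_neg, Real.exp_log (hpos₁ x (hΩK hx))])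
  refine hsub y hy _ _ h2 ?_
  have h3 := hsup.strict hΓ hΩ (fun z hz => hpos₂ z (hΩK hz)) hτ0 hs hz (hsK z (hΩK hz)) hjw
  refine (h3 (c / 2) (by positivity)).of_mul hΓ (t := q₁ y ^ 2) (by positivity) fun h => ?_
  rw [norm_smul, mul_pow, Real.norm_eq_abs, sq_abs]
  have e : -q₁ y * (q₁ y * X h + -q₁ y * ⟪p, h⟫ ^ 2) - q₁ y ^ 2 * ‖p‖ ^ 2 / 2 * ‖h‖ ^ 2
      = q₁ y ^ 2 * (-X h + ⟪p, h⟫ ^ 2 - ‖p‖ ^ 2 / 2 * ‖h‖ ^ 2) := by ring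
  rw [e]
  refine mul_le_mul_of_nonneg_left ?_ (by positivity)
  have h4 : τ * s * q₂ z / (q₂ z + τ * (1 + s * ‖z‖ ^ 2)) ^ 2 * ‖h‖ ^ 2 ≥ c * ‖h‖ ^ 2 := by
    gcongr
    exact hcK z (hΩK hz)
  -- the slopes `p` and `-r` are so close that the margin is not lost
  have h5 : |⟪r, h⟫ ^ 2 - ⟪p, h⟫ ^ 2| ≤ c / 3 * ‖h‖ ^ 2 := by
    have e1 : ⟪r, h⟫ ^ 2 - ⟪p, h⟫ ^ 2 = ⟪p + r, h⟫ * ⟪r - p, h⟫ := by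
      rw [inner_add_left, inner_sub_left]; ring
    rw [e1, abs_mul]
    have h6 : ‖r - p‖ ≤ 2 * R := (norm_sub_le _ _).trans (by linarith)
    calc |⟪p + r, h⟫| * |⟪r - p, h⟫| ≤ (‖p + r‖ * ‖h‖) * (‖r - p‖ * ‖h‖) := by
          gcongr <;> exact abs_real_inner_le_norm _ _
      _ ≤ (c / (6 * R) * ‖h‖) * (2 * R * ‖h‖) := by gcongr
      _ = c / 3 * ‖h‖ ^ 2 := by field_simp; ring
  have h6 : |‖r‖ ^ 2 - ‖p‖ ^ 2| ≤ c / 3 := by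
    have e1 : ‖r‖ ^ 2 - ‖p‖ ^ 2 = (‖r‖ - ‖p‖) * (‖r‖ + ‖p‖) := by ring
    have h7 : |‖r‖ - ‖p‖| ≤ c / (6 * R) := by
      have := abs_norm_sub_norm_le r (-p)
      rw [norm_neg, sub_neg_eq_add, add_comm r p] at this
      exact this.trans hpr
    rw [e1, abs_mul, abs_of_nonneg (by positivity : 0 ≤ ‖r‖ + ‖p‖)]
    calc |‖r‖ - ‖p‖| * (‖r‖ + ‖p‖) ≤ c / (6 * R) * (2 * R) := by gcongr; linarith
      _ = c / 3 := by field_simp; norm_num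
  have h7 := (abs_le.1 h5).2
  have h8 := mul_le_mul_of_nonneg_right (abs_le.1 h6).1 (sq_nonneg ‖h‖)
  have h9 := hXZ h
  linarith

/-! ### Invariance under inversions -/

/-- The transform of `q = exp (-v)` under the inversion in the sphere of centre `y` and radius
`√a`; it corresponds to the transform of `v` which leaves the Möbius Hessian invariant. -/
noncomputable def kelvin (y : E n) (a : ℝ) (q : E n → ℝ) (x : E n) : ℝ :=
  ‖x - y‖ ^ 2 / a * q (y + (a / ‖x - y‖ ^ 2) • (x - y))

lemma exists_reflection (ζ : E n) : ∃ R : E n ≃ₗᵢ[ℝ] E n,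
    ∀ h, R h = h - (2 * (⟪ζ, h⟫ / ‖ζ‖ ^ 2)) • ζ :=
  ⟨(ℝ ∙ ζ).reflection.trans (LinearIsometryEquiv.neg ℝ), fun h => by
    simp only [LinearIsometryEquiv.trans_apply, LinearIsometryEquiv.coe_neg,
      Submodule.reflection_singleton_apply]
    rw [neg_sub, two_mul, add_smul, two_smul]
    simp⟩

/-- Inverting twice in the same sphere is the identity. -/
lemma kelvin_eq {y ζ : E n} {a : ℝ} (ha : 0 < a) (hζ : ζ ≠ 0) (q : E n → ℝ) :
    q (y + ζ) = ‖ζ‖ ^ 2 / a * kelvin y a q (y + (a / ‖ζ‖ ^ 2) • ζ) := by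
  have h1 : 0 < ‖ζ‖ := norm_pos_iff.2 hζ
  have h2 : ‖(a / ‖ζ‖ ^ 2) • ζ‖ ^ 2 = a ^ 2 / ‖ζ‖ ^ 2 := by
    rw [norm_smul, mul_pow, Real.norm_eq_abs, sq_abs]
    field_simp
  rw [kelvin, add_sub_cancel_left, h2, smul_smul]
  have h3 : a / (a ^ 2 / ‖ζ‖ ^ 2) * (a / ‖ζ‖ ^ 2) = 1 := by field_simp
  rw [h3, one_smul, ← mul_assoc]
  have h4 : ‖ζ‖ ^ 2 / a * (a ^ 2 / ‖ζ‖ ^ 2 / a) = 1 := by field_simp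
  rw [h4, one_mul]

lemma IsQuad.exists_bound_add {X : E n → ℝ} (hX : IsQuad X) : ∃ C > 0, ∀ u e,
    X (u + e) ≤ X u + C * (2 * ‖u‖ * ‖e‖ + ‖e‖ ^ 2) ∧ |X u| ≤ C * ‖u‖ ^ 2 := by
  obtain ⟨T, hT⟩ := hX
  have h0 : ∀ u e, ⟪T u, e⟫ ≤ (‖T‖ + 1) * (‖u‖ * ‖e‖) := fun u e => by
    calc ⟪T u, e⟫ ≤ ‖T u‖ * ‖e‖ := real_inner_le_norm _ _
      _ ≤ (‖T‖ * ‖u‖) * ‖e‖ := by gcongr; exact T.le_opNorm u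
      _ ≤ (‖T‖ + 1) * (‖u‖ * ‖e‖) := by nlinarith [mul_nonneg (norm_nonneg u) (norm_nonneg e)]
  refine ⟨‖T‖ + 1, by positivity, fun u e => ⟨?_, ?_⟩⟩
  · rw [hT, hT, map_add, inner_add_left, inner_add_right, inner_add_right]
    have h1 := h0 u e
    have h2 := h0 e u
    have h3 := h0 e e
    nlinarith
  · rw [hT, abs_le]
    have h1 := h0 u u
    have h2 := h0 u (-u)
    rw [inner_neg_right, norm_neg] at h2
    constructor <;> nlinarith

set_option maxHeartbeats 400000 in
/-- A superjet of the transform of `q` gives one of `q` at the inverted point. -/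
lemma UpperJet.of_kelvin {q : E n → ℝ} {y ζ p : E n} {a : ℝ} {X : E n → ℝ} (ha : 0 < a)
    (hζ : ζ ≠ 0) {R : E n ≃ₗᵢ[ℝ] E n} (hR : ∀ h, R h = h - (2 * (⟪ζ, h⟫ / ‖ζ‖ ^ 2)) • ζ)
    (hj : UpperJet (kelvin y a q) (y + (a / ‖ζ‖ ^ 2) • ζ) p X) :
    UpperJet q (y + ζ) (R p + (2 * kelvin y a q (y + (a / ‖ζ‖ ^ 2) • ζ) / a) • ζ)
      fun h => 2 * (kelvin y a q (y + (a / ‖ζ‖ ^ 2) • ζ) / a - ⟪p, ζ⟫ / ‖ζ‖ ^ 2) * ‖h‖ ^ 2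
        + a / ‖ζ‖ ^ 2 * X (R h) := by
  have hN : 0 < ‖ζ‖ := norm_pos_iff.2 hζ
  set s := ‖ζ‖ ^ 2 with hs
  have hs0 : 0 < s := by positivity
  set Q := kelvin y a q with hQ
  set x := y + (a / s) • ζ with hx
  refine ⟨(isQuad_normSq.const_mul _).add
    ((hj.isQuad.comp (R : E n →L[ℝ] E n)).const_mul (a / s)), fun κ hκ => ?_⟩
  obtain ⟨C, hC, hXC⟩ := hj.isQuad.exists_bound_add
  -- the displacement of the inverted point
  let k : E n → E n := fun h => (a / ‖ζ + h‖ ^ 2) • (ζ + h) - (a / s) • ζ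
  have hD0 : ‖ζ + (0 : E n)‖ ^ 2 ≠ 0 := by rw [add_zero]; positivity
  have hcD : ContinuousAt (fun h : E n => a / ‖ζ + h‖ ^ 2) 0 :=
    ContinuousAt.div continuousAt_const (by fun_prop) hD0
  have hk : Tendsto k (𝓝 0) (𝓝 0) := by
    have h1 : ContinuousAt k 0 := (hcD.smul (by fun_prop)).sub continuousAt_const
    have h2 : k 0 = 0 := by simp [k, hs]
    simpa [ContinuousAt, h2] using h1
  set η := κ / (4 * (C + a / s)) with hη
  have hη0 : 0 < η := by positivity
  have hκ1 : 0 < κ * s / (32 * a) := by positivity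
  have e1 := hk.eventually (hj.bound (κ * s / (32 * a)) hκ1)
  have e2 : ∀ᶠ h in 𝓝 (0 : E n), |a / ‖ζ + h‖ ^ 2 - a / s| < min η (a / s) := by
    have h1 : Tendsto (fun h : E n => |a / ‖ζ + h‖ ^ 2 - a / s|) (𝓝 0) (𝓝 |a / s - a / s|) := by
      have := (hcD.sub (continuousAt_const (y := a / s))).abs
      simpa [ContinuousAt, hs] using this
    rw [sub_self, abs_zero] at h1
    exact h1.eventually (Iio_mem_nhds (by positivity))
  have e3 : ∀ᶠ h in 𝓝 (0 : E n), C * (2 * (‖h‖ / ‖ζ‖) + (‖h‖ / ‖ζ‖) ^ 2) < η ∧ ‖h‖ / ‖ζ‖ < 1 := by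
    have h1 : Continuous fun h : E n => C * (2 * (‖h‖ / ‖ζ‖) + (‖h‖ / ‖ζ‖) ^ 2) := by fun_prop
    have h2 : Continuous fun h : E n => ‖h‖ / ‖ζ‖ := by fun_prop
    refine ((h1.tendsto 0).eventually (Iio_mem_nhds ?_)).and
      ((h2.tendsto 0).eventually (Iio_mem_nhds ?_))
    · simpa using hη0
    · simp
  have e4 : ∀ᶠ h in 𝓝 (0 : E n), ζ + h ≠ 0 := by
    have h1 : Continuous fun h : E n => ζ + h := by fun_prop
    exact (h1.tendsto 0).eventually (isOpen_ne.mem_nhds (by simpa using hζ))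
  filter_upwards [e1, e2, e3, e4] with h h1 h2 h3 h4
  have hD1 : 0 < ‖ζ + h‖ := norm_pos_iff.2 h4
  set D := ‖ζ + h‖ ^ 2 with hD
  have hD1 : 0 < D := by positivity
  have hDe : D = s + 2 * ⟪ζ, h⟫ + ‖h‖ ^ 2 := norm_add_sq_real ζ h
  set e : E n := -((‖h‖ ^ 2 / s) • ζ) with he
  have hne : ‖e‖ = ‖h‖ * (‖h‖ / ‖ζ‖) := by
    rw [he, norm_neg, norm_smul, Real.norm_eq_abs, abs_of_nonneg (by positivity), hs]
    field_simp
  have hRn : ‖R h‖ = ‖h‖ := R.norm_map h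
  have hke : k h = (a / D) • (R h + e) := by
    have h5 : (a / s) • ζ = (a / D) • ((D / s) • ζ) := by
      rw [smul_smul]
      congr 1
      field_simp
    have h6 : D / s = 1 + 2 * (⟪ζ, h⟫ / s) + ‖h‖ ^ 2 / s := by
      rw [hDe]; field_simp
    simp only [k]
    rw [h5, ← smul_sub, h6, hR, he]
    congr 1
    module
  have hq : q (y + ζ + h) = D / a * Q (x + k h) := by
    have := kelvin_eq (y := y) ha h4 q
    rw [add_assoc, this, hx]
    congr 2
    simp only [k]
    abel
  have hq0 : q (y + ζ) = s / a * Q x := kelvin_eq ha hζ q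
  have h5 : D / a * Q (x + k h) ≤ D / a * (Q x + ⟪p, k h⟫ + X (k h) / 2
      + κ * s / (32 * a) * ‖k h‖ ^ 2) := by gcongr
  have hinner : D / a * ⟪p, k h⟫ = ⟪R p, h⟫ - ‖h‖ ^ 2 * (⟪p, ζ⟫ / s) := by
    have h6 : ⟪p, R h⟫ = ⟪R p, h⟫ := by
      rw [hR, hR, inner_sub_right, inner_sub_left, real_inner_smul_right, real_inner_smul_left,
        real_inner_comm ζ p]
      ring
    rw [hke, real_inner_smul_right, inner_add_right, h6, he, inner_neg_right,
      real_inner_smul_right]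
    field_simp
    ring
  have hX : D / a * (X (k h) / 2) = a / D / 2 * X (R h + e) := by
    rw [hke, hj.isQuad.smul_apply]
    field_simp
  have hkn : D / a * (κ * s / (32 * a) * ‖k h‖ ^ 2)
      = a / D * (κ * s / (32 * a)) * ‖R h + e‖ ^ 2 := by
    rw [hke, norm_smul, mul_pow, Real.norm_eq_abs, sq_abs]
    field_simp
  obtain ⟨h2a, h2b⟩ := lt_min_iff.1 h2
  obtain ⟨h3a, h3b⟩ := h3
  set N := ‖h‖ with hNdef
  have hN0 : 0 ≤ N := norm_nonneg h
  have haD : 0 < a / D := by positivity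
  have haD2 : a / D ≤ 2 * (a / s) := by linarith [(abs_lt.1 h2b).2]
  have hX1 : X (R h + e) ≤ X (R h) + η * N ^ 2 := by
    refine (hXC (R h) e).1.trans ?_
    rw [hRn, hne]
    have : C * (2 * N * (N * (N / ‖ζ‖)) + (N * (N / ‖ζ‖)) ^ 2)
        = C * (2 * (N / ‖ζ‖) + (N / ‖ζ‖) ^ 2) * N ^ 2 := by ring
    rw [this]
    gcongr
  have hX2 : a / D / 2 * X (R h) ≤ a / s / 2 * X (R h) + η * C / 2 * N ^ 2 := by
    have h6 := (hXC (R h) 0).2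
    rw [hRn] at h6
    have h7 : (a / D - a / s) * X (R h) ≤ η * (C * N ^ 2) := by
      refine (le_abs_self _).trans ?_
      rw [abs_mul]
      gcongr
    linarith
  have hX3 : a / D / 2 * (η * N ^ 2) ≤ a / s * (η * N ^ 2) := by
    refine mul_le_mul_of_nonneg_right ?_ (by positivity)
    linarith
  have hX4 : a / D / 2 * X (R h + e) ≤ a / D / 2 * (X (R h) + η * N ^ 2) := by gcongr
  have hn1 : ‖R h + e‖ ^ 2 ≤ (2 * N) ^ 2 := by
    gcongr
    refine (norm_add_le _ _).trans ?_
    rw [hRn, hne]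
    nlinarith
  have hn2 : a / D * (κ * s / (32 * a)) * ‖R h + e‖ ^ 2 ≤ κ / 4 * N ^ 2 := by
    calc a / D * (κ * s / (32 * a)) * ‖R h + e‖ ^ 2
        ≤ 2 * (a / s) * (κ * s / (32 * a)) * (2 * N) ^ 2 := by gcongr
      _ = κ / 4 * N ^ 2 := by field_simp; ring
  have hη1 : (C + a / s) * η = κ / 4 := by
    rw [hη, ← div_div, mul_div_cancel₀ _ (by positivity)]
  have hη2 : (η * C / 2 + a / s * η) * N ^ 2 ≤ κ / 4 * N ^ 2 := by
    gcongr
    nlinarith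
  have hκN : 0 ≤ κ * N ^ 2 := by positivity
  have hDQ : D / a * Q x = s / a * Q x + (2 * ⟪ζ, h⟫ + N ^ 2) * (Q x / a) := by
    rw [hDe]; ring
  rw [hq, hq0, inner_add_left, real_inner_smul_left]
  refine h5.trans ?_
  have h8 : D / a * (Q x + ⟪p, k h⟫ + X (k h) / 2 + κ * s / (32 * a) * ‖k h‖ ^ 2)
      = D / a * Q x + D / a * ⟪p, k h⟫ + D / a * (X (k h) / 2)
        + D / a * (κ * s / (32 * a) * ‖k h‖ ^ 2) := by ring
  rw [h8, hDQ, hinner, hX, hkn]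
  have h9 : 2 * Q x / a * ⟪ζ, h⟫ = 2 * ⟪ζ, h⟫ * (Q x / a) := by ring
  rw [h9]
  linarith

/-- The transform of a supersolution is a supersolution. -/
lemma SuperOn.kelvin {q : E n → ℝ} {y : E n} {a : ℝ} (ha : 0 < a)
    (hq : SuperOn Γ univ q) : SuperOn Γ {y}ᶜ (kelvin y a q) := by
  intro x hx p X hj
  have hx0 : x - y ≠ 0 := sub_ne_zero.2 hx
  have hN : 0 < ‖x - y‖ := norm_pos_iff.2 hx0
  set ζ := (a / ‖x - y‖ ^ 2) • (x - y) with hζ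
  have hζ0 : ζ ≠ 0 := smul_ne_zero (by positivity) hx0
  have hζn : ‖ζ‖ ^ 2 = a ^ 2 / ‖x - y‖ ^ 2 := by
    rw [hζ, norm_smul, mul_pow, Real.norm_eq_abs, sq_abs]
    field_simp
  have hxe : x = y + (a / ‖ζ‖ ^ 2) • ζ := by
    rw [hζn, hζ, smul_smul]
    have : a / (a ^ 2 / ‖x - y‖ ^ 2) * (a / ‖x - y‖ ^ 2) = 1 := by field_simp
    rw [this, one_smul, add_sub_cancel]
  obtain ⟨R, hR⟩ := exists_reflection ζ
  rw [hxe] at hj ⊢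
  have h1 := hq _ (mem_univ _) _ _ (hj.of_kelvin ha hζ0 hR)
  have h2 := kelvin_eq (y := y) ha hζ0 q
  set Q := MobiusLiouville.kelvin y a q (y + (a / ‖ζ‖ ^ 2) • ζ)
  have hs : 0 < ‖ζ‖ := norm_pos_iff.2 hζ0
  refine (h1.comp_isometry R.symm).mono fun h => le_of_eq ?_
  have h3 : ‖R p + (2 * Q / a) • ζ‖ ^ 2
      = ‖p‖ ^ 2 - 4 * Q / a * ⟪p, ζ⟫ + 4 * Q ^ 2 / a ^ 2 * ‖ζ‖ ^ 2 := by
    rw [norm_add_sq_real, R.norm_map, norm_smul, mul_pow, Real.norm_eq_abs, sq_abs,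
      real_inner_smul_right, hR, inner_sub_left, real_inner_smul_left, real_inner_self_eq_norm_sq,
      real_inner_comm ζ p]
    field_simp
    ring
  rw [h3, h2, R.apply_symm_apply, R.symm.norm_map]
  field_simp
  ring

/-! ### Radial barriers -/

/-- The form `a |h|² + c ⟨w, h⟩²` has the eigenvalues `a + c |w|², a, …, a`. -/
lemma exists_basis_rankOne' (hn : 0 < n) {w : E n} (hw : w ≠ 0) (a c : ℝ) :
    ∃ b : OrthonormalBasis (Fin n) ℝ (E n), (fun h => a * ‖h‖ ^ 2 + c * ⟪w, h⟫ ^ 2)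
      = fun h => ∑ i : Fin n, (if (i : ℕ) = 0 then a + c * ‖w‖ ^ 2 else a) * ⟪b i, h⟫ ^ 2 := by
  have hw' : ‖w‖ ≠ 0 := norm_ne_zero_iff.2 hw
  obtain ⟨b, hb⟩ := exists_basis_rankOne hn (u := ‖w‖⁻¹ • w) (by
    rw [norm_smul, norm_inv, norm_norm, inv_mul_cancel₀ hw'])
  refine ⟨b, funext fun h => ?_⟩
  rw [← hb, real_inner_smul_left]
  field_simp

lemma inCone_rankOne_iff (hΓ : IsAdmissibleCone Γ) (hn : 0 < n) {w : E n} (hw : w ≠ 0)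
    (a c : ℝ) : InCone Γ (fun h => a * ‖h‖ ^ 2 + c * ⟪w, h⟫ ^ 2) ↔
      (fun i : Fin n => if (i : ℕ) = 0 then a + c * ‖w‖ ^ 2 else a) ∈ Γ := by
  obtain ⟨b, hb⟩ := exists_basis_rankOne' hn hw a c
  rw [hb, inCone_diagonal_iff hΓ]

lemma inClosedCone_rankOne_iff (hΓ : IsAdmissibleCone Γ) (hn : 0 < n) {w : E n} (hw : w ≠ 0)
    (a c : ℝ) : InClosedCone Γ (fun h => a * ‖h‖ ^ 2 + c * ⟪w, h⟫ ^ 2) ↔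
      (fun i : Fin n => if (i : ℕ) = 0 then a + c * ‖w‖ ^ 2 else a) ∈ closure Γ := by
  obtain ⟨b, hb⟩ := exists_basis_rankOne' hn hw a c
  rw [hb, inClosedCone_diagonal_iff hΓ]

/-- The vector `(t, -1, …, -1)`. -/
def firstCoord (n : ℕ) (t : ℝ) : Fin n → ℝ := fun i => if (i : ℕ) = 0 then t else -1

lemma firstCoord_one : firstCoord n 1 = lambdaStar n := rfl

lemma continuous_firstCoord : Continuous (firstCoord n) :=
  continuous_pi fun i => by
    by_cases h : (i : ℕ) = 0 <;> simp only [firstCoord, h, if_true, if_false] <;> fun_prop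

/-- A function which exceeds its values on the boundary has an interior maximum. -/
lemma exists_interior_max {K Ω : Set (E n)} (hK : IsCompact K) {f : E n → ℝ}
    (hf : ContinuousOn f K) {c : ℝ} (hb : ∀ z ∈ K \ Ω, f z ≤ c) {x : E n} (hx : x ∈ K)
    (hc : c < f x) : ∃ z ∈ Ω, c < f z ∧ ∀ w ∈ K, f w ≤ f z := by
  obtain ⟨z, hz, hm⟩ := hK.exists_isMaxOn ⟨x, hx⟩ hf
  have h1 : c < f z := hc.trans_le (hm hx)
  refine ⟨z, ?_, h1, fun w hw => hm hw⟩
  by_contra h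
  exact absurd (hb z ⟨hz, h⟩) (not_le.2 h1)

/-- Annuli around `y`, described by the square of the distance to `y`. -/
lemma annulus_facts (y : E n) (σ S : ℝ) :
    IsCompact {z : E n | σ ≤ ‖z - y‖ ^ 2 ∧ ‖z - y‖ ^ 2 ≤ S} ∧
    IsOpen {z : E n | σ < ‖z - y‖ ^ 2 ∧ ‖z - y‖ ^ 2 < S} := by
  have hc : Continuous fun z : E n => ‖z - y‖ ^ 2 := by fun_prop
  refine ⟨?_, (isOpen_lt continuous_const hc).inter (isOpen_lt hc continuous_const)⟩
  refine Metric.isCompact_of_isClosed_isBounded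
    ((isClosed_le continuous_const hc).inter (isClosed_le hc continuous_const))
    ((isBounded_closedBall (x := y) (r := √S)).subset fun z hz => ?_)
  rw [mem_closedBall, dist_eq_norm]
  exact Real.le_sqrt_of_sq_le hz.2

lemma hasDerivAt_neg_barrier {c L s : ℝ} {K : ℕ} (hs : s ≠ 0) :
    HasDerivAt (fun s => -(c * (L - Real.log s) ^ (K + 2)))
      (c * (K + 2) * (L - Real.log s) ^ (K + 1) / s) s ∧
    HasDerivAt (fun s => c * (K + 2) * (L - Real.log s) ^ (K + 1) / s)
      (-(c * (K + 2) * (L - Real.log s) ^ K * (K + 1 + (L - Real.log s)) / s ^ 2)) s := by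
  have h1 : HasDerivAt (fun s => L - Real.log s) (-s⁻¹) s := by
    simpa using (Real.hasDerivAt_log hs).const_sub L
  constructor
  · refine ((h1.pow (K + 2)).const_mul c).neg.congr_deriv ?_
    push_cast
    field_simp
  · refine (((h1.pow (K + 1)).const_mul (c * (K + 2))).div (hasDerivAt_id s) hs).congr_deriv ?_
    push_cast
    simp only [id]
    field_simp
    simp only [Pi.pow_apply]
    ring

lemma hasDerivAt_barrier {c L s : ℝ} {K : ℕ} (hs : s ≠ 0) (hl : Real.log s - L ≠ 0) :
    HasDerivAt (fun s => c / (Real.log s - L) ^ K)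
      (-(c * K / ((Real.log s - L) ^ (K + 1) * s))) s ∧
    HasDerivAt (fun s => -(c * K / ((Real.log s - L) ^ (K + 1) * s)))
      (c * K * (K + 1 + (Real.log s - L)) / ((Real.log s - L) ^ (K + 2) * s ^ 2)) s := by
  have h1 : HasDerivAt (fun s => Real.log s - L) s⁻¹ s := (Real.hasDerivAt_log hs).sub_const L
  constructor
  · refine ((hasDerivAt_const s c).div (h1.pow K) (pow_ne_zero K hl)).congr_deriv ?_
    rcases K with _ | K
    · simp
    · simp only [Nat.add_sub_cancel, Pi.pow_apply]
      field_simp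
      push_cast
      ring
  · refine ((hasDerivAt_const s (c * K)).div ((h1.pow (K + 1)).mul (hasDerivAt_id s))
      (mul_ne_zero (pow_ne_zero (K + 1) hl) hs)).neg.congr_deriv ?_
    simp only [Nat.add_sub_cancel, Pi.pow_apply, Pi.mul_apply, id]
    push_cast
    field_simp
    ring

/-- If `λ* ∈ Γ`, a power of `L - log |z - y|²` with a large exponent is a strict supersolution,
so that a subsolution can not be touched by it from below. -/
lemma SubOn.not_touch_log (hΓ : IsAdmissibleCone Γ) (hn : 0 < n) {K : ℕ}
    (hK : firstCoord n (1 - 2 / (K + 2)) ∈ Γ) {q : E n → ℝ} {x y : E n} {c L : ℝ} {U : Set (E n)}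
    (hq : SubOn Γ U q) (hx : x ∈ U) (hxy : x ≠ y) (hc : 0 < c)
    (hL : Real.log (‖x - y‖ ^ 2) < L) (he : q x = c * (L - Real.log (‖x - y‖ ^ 2)) ^ (K + 2))
    (hle : ∀ᶠ z in 𝓝 x, c * (L - Real.log (‖z - y‖ ^ 2)) ^ (K + 2) ≤ q z) : False := by
  have hN : 0 < ‖x - y‖ := norm_pos_iff.2 (sub_ne_zero.2 hxy)
  set s := ‖x - y‖ ^ 2 with hs
  have hs0 : 0 < s := by positivity
  have hj := upperJet_radial (x := x) (y := y)
    (F := fun s => -(c * (L - Real.log s) ^ (K + 2)))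
    (eventually_of_mem (isOpen_ne.mem_nhds hs0.ne') fun t ht => (hasDerivAt_neg_barrier ht).1)
    (hasDerivAt_neg_barrier hs0.ne').2
  have hj2 : UpperJet (fun z => -q z) x _ _ := hj.of_le (by rw [he]) (by
    filter_upwards [hle] with z hz using neg_le_neg hz)
  refine hq x hx _ _ hj2 ?_
  set l := L - Real.log s with hl
  have hl0 : 0 < l := by rw [hl]; linarith
  have hB : 0 < (2 * l + 2 * (K + 2)) := by positivity
  have h1 : InCone Γ (fun h => (-1) * ‖h‖ ^ 2
      + ((2 - 2 / (K + 2)) / s) * ⟪x - y, h⟫ ^ 2) := by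
    rw [inCone_rankOne_iff hΓ hn (sub_ne_zero.2 hxy)]
    refine hΓ.mono hK fun i => ?_
    simp only [firstCoord]
    split_ifs
    · rw [← hs]
      field_simp
      linarith
    · exact le_rfl
  refine h1.of_mul hΓ (t := c ^ 2 * (K + 2) * l ^ (2 * K + 2) / s * (2 * l + 2 * (K + 2)))
    (by positivity) fun h => ?_
  rw [norm_smul, mul_pow, Real.norm_eq_abs, sq_abs, ← hs, he]
  have e1 : -(c * l ^ (K + 2)) * (2 * (c * (K + 2) * l ^ (K + 1) / s) * ‖h‖ ^ 2
      + 4 * -(c * (K + 2) * l ^ K * (K + 1 + l) / s ^ 2) * ⟪x - y, h⟫ ^ 2)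
      - (2 * (c * (K + 2) * l ^ (K + 1) / s)) ^ 2 * s / 2 * ‖h‖ ^ 2
      = c ^ 2 * (K + 2) * l ^ (2 * K + 2) / s * (-(2 * l + 2 * (K + 2)) * ‖h‖ ^ 2
        + 4 * (K + 1 + l) / s * ⟪x - y, h⟫ ^ 2) := by
    field_simp
    ring
  rw [e1, mul_assoc]
  refine mul_le_mul_of_nonneg_left ?_ (by positivity)
  have e2 : (2 * l + 2 * (K + 2)) * (2 - 2 / (K + 2)) ≤ 4 * ((K : ℝ) + 1 + l) := by
    have : (2 * l + 2 * ((K : ℝ) + 2)) * (2 - 2 / (K + 2))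
        = 4 * (K + 1 + l) - 4 * l / (K + 2) := by field_simp; ring
    rw [this]
    have : 0 ≤ 4 * l / ((K : ℝ) + 2) := by positivity
    linarith
  have e3 : (2 * l + 2 * ((K : ℝ) + 2)) * ((2 - 2 / (K + 2)) / s * ⟪x - y, h⟫ ^ 2)
      ≤ 4 * (K + 1 + l) / s * ⟪x - y, h⟫ ^ 2 := by
    have : (2 * l + 2 * ((K : ℝ) + 2)) * ((2 - 2 / (K + 2)) / s * ⟪x - y, h⟫ ^ 2)
      = (2 * l + 2 * ((K : ℝ) + 2)) * (2 - 2 / (K + 2)) / s * ⟪x - y, h⟫ ^ 2 := by ring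
    rw [this]
    gcongr
  linarith

/-- If `λ* ∉ closure Γ`, then a negative power of `log |z - y|² - L` with a large exponent is a
strict subsolution, so that a supersolution can not be touched by it from above. -/
lemma SuperOn.not_touch_log (hΓ : IsAdmissibleCone Γ) (hn : 0 < n) {K : ℕ} (hK0 : 0 < K)
    (hK : firstCoord n (1 + 2 / K) ∉ closure Γ) {q : E n → ℝ} {x y : E n} {c L : ℝ}
    {U : Set (E n)} (hq : SuperOn Γ U q) (hx : x ∈ U) (hxy : x ≠ y) (hc : 0 < c)
    (hL : L < Real.log (‖x - y‖ ^ 2)) (he : q x = c / (Real.log (‖x - y‖ ^ 2) - L) ^ K)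
    (hle : ∀ᶠ z in 𝓝 x, q z ≤ c / (Real.log (‖z - y‖ ^ 2) - L) ^ K) : False := by
  have hN : 0 < ‖x - y‖ := norm_pos_iff.2 (sub_ne_zero.2 hxy)
  set s := ‖x - y‖ ^ 2 with hs
  have hs0 : 0 < s := by positivity
  have hK0' : (0 : ℝ) < K := by exact_mod_cast hK0
  have hev : ∀ᶠ t in 𝓝 s, t ≠ 0 ∧ Real.log t - L ≠ 0 := by
    refine (eventually_ne_nhds hs0.ne').and ?_
    have : ContinuousAt (fun t => Real.log t - L) s :=
      (Real.continuousAt_log hs0.ne').sub continuousAt_const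
    exact this.eventually (isOpen_ne.mem_nhds (sub_pos.2 hL).ne')
  have hj := upperJet_radial (x := x) (y := y)
    (hev.mono fun t ht => (hasDerivAt_barrier (c := c) (K := K) ht.1 ht.2).1)
    (hasDerivAt_barrier hs0.ne' (sub_pos.2 hL).ne').2
  have h1 := hq x hx _ _ (hj.of_le he hle)
  set l := Real.log s - L with hl
  have hl0 : 0 < l := sub_pos.2 hL
  have h2 : InClosedCone Γ (fun h => (-1) * ‖h‖ ^ 2
      + ((2 + 2 / K) / s) * ⟪x - y, h⟫ ^ 2) := by
    refine h1.of_mul hΓ (t := (c ^ 2 * K / (l ^ (2 * K + 2) * s) * (2 * l + 2 * K))⁻¹)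
      (by positivity) fun h => ?_
    rw [inv_mul_le_iff₀ (by positivity), norm_smul, mul_pow, Real.norm_eq_abs, sq_abs, ← hs, he]
    have e1 : c / l ^ K * (2 * -(c * K / (l ^ (K + 1) * s)) * ‖h‖ ^ 2
        + 4 * (c * K * (K + 1 + l) / (l ^ (K + 2) * s ^ 2)) * ⟪x - y, h⟫ ^ 2)
        - (2 * -(c * K / (l ^ (K + 1) * s))) ^ 2 * s / 2 * ‖h‖ ^ 2
        = c ^ 2 * K / (l ^ (2 * K + 2) * s) * (-(2 * l + 2 * K) * ‖h‖ ^ 2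
          + 4 * (K + 1 + l) / s * ⟪x - y, h⟫ ^ 2) := by
      field_simp
      ring
    rw [e1, mul_assoc]
    refine mul_le_mul_of_nonneg_left ?_ (by positivity)
    have e2 : 4 * ((K : ℝ) + 1 + l) ≤ (2 * l + 2 * K) * (2 + 2 / K) := by
      have : (2 * l + 2 * (K : ℝ)) * (2 + 2 / K) = 4 * (K + 1 + l) + 4 * l / K := by
        field_simp; ring
      rw [this]
      have : 0 ≤ 4 * l / (K : ℝ) := by positivity
      linarith
    have e3 : 4 * (K + 1 + l) / s * ⟪x - y, h⟫ ^ 2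
        ≤ (2 * l + 2 * (K : ℝ)) * ((2 + 2 / K) / s * ⟪x - y, h⟫ ^ 2) := by
      have : (2 * l + 2 * (K : ℝ)) * ((2 + 2 / K) / s * ⟪x - y, h⟫ ^ 2)
        = (2 * l + 2 * (K : ℝ)) * (2 + 2 / K) / s * ⟪x - y, h⟫ ^ 2 := by ring
      rw [this]
      gcongr
    linarith
  rw [inClosedCone_rankOne_iff hΓ hn (sub_ne_zero.2 hxy)] at h2
  refine hK ?_
  have e : (-1 : ℝ) + (2 + 2 / K) / s * ‖x - y‖ ^ 2 = 1 + 2 / K := by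
    rw [← hs, div_mul_cancel₀ _ hs0.ne']
    ring
  rw [e] at h2
  exact h2

/-- If `λ* ∈ Γ`, positive subsolutions on `ℝⁿ` are constant: on `|z - y|² < e ^ L` they lie above
multiples of `(L - log |z - y|²) ^ (K + 2)`, which become constant functions as `L → ∞`. -/
theorem SubOn.eq_of_lambdaStar_mem (hΓ : IsAdmissibleCone Γ) (hn : 0 < n)
    (hl : lambdaStar n ∈ Γ) {q : E n → ℝ} (hq : SubOn Γ univ q) (hc : Continuous q)
    (hpos : ∀ x, 0 < q x) (x y : E n) : q y ≤ q x := by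
  obtain ⟨K, hK⟩ : ∃ K : ℕ, firstCoord n (1 - 2 / (K + 2)) ∈ Γ := by
    have h1 : Tendsto (fun K : ℕ => firstCoord n (1 - 2 / ((K : ℝ) + 2))) atTop
        (𝓝 (firstCoord n (1 - 0))) := by
      refine (continuous_firstCoord.tendsto _).comp (tendsto_const_nhds.sub ?_)
      exact tendsto_const_nhds.div_atTop
        (tendsto_atTop_add_const_right _ _ tendsto_natCast_atTop_atTop)
    rw [sub_zero, firstCoord_one] at h1
    exact (h1.eventually (hΓ.isOpen.mem_nhds hl)).exists
  rcases eq_or_ne x y with rfl | hxy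
  · exact le_rfl
  refine le_of_forall_lt fun a ha => ?_
  obtain ⟨a', haa', ha'⟩ := exists_between ha
  refine haa'.trans_le ?_
  rcases le_or_gt a' 0 with ha0 | ha0
  · exact ha0.trans (hpos x).le
  have hN : 0 < ‖x - y‖ := norm_pos_iff.2 (sub_ne_zero.2 hxy)
  -- near `y`, `q` is at least `a'`
  obtain ⟨ρ, hρ, hρx, hρa⟩ : ∃ ρ > 0, ρ < ‖x - y‖ ∧ ∀ z, ‖z - y‖ ≤ ρ → a' ≤ q z := by
    obtain ⟨ρ, hρ, h⟩ := Metric.mem_nhds_iff.1 (hc.continuousAt.eventually (Ioi_mem_nhds ha'))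
    refine ⟨min (ρ / 2) (‖x - y‖ / 2), by positivity,
      (min_le_right _ _).trans_lt (by linarith), fun z hz => ?_⟩
    have : z ∈ ball y ρ := by
      rw [mem_ball, dist_eq_norm]
      exact (hz.trans (min_le_left _ _)).trans_lt (by linarith)
    exact (h this).le
  have key : ∀ L, Real.log (‖x - y‖ ^ 2) < L →
      a' * ((L - Real.log (‖x - y‖ ^ 2)) / (L - Real.log (ρ ^ 2))) ^ (K + 2) ≤ q x := by
    intro L hL
    have hρL : Real.log (ρ ^ 2) < L :=
      (Real.log_lt_log (by positivity) (by gcongr)).trans hL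
    by_contra! hlt
    have hd : 0 < (L - Real.log (ρ ^ 2)) ^ (K + 2) := pow_pos (sub_pos.2 hρL) _
    obtain ⟨hcomp, hopen⟩ := annulus_facts y (ρ ^ 2) (Real.exp L)
    have hne : ∀ z ∈ {z : E n | ρ ^ 2 ≤ ‖z - y‖ ^ 2 ∧ ‖z - y‖ ^ 2 ≤ Real.exp L},
        ‖z - y‖ ^ 2 ≠ 0 := fun z hz => ((pow_pos hρ 2).trans_le hz.1).ne'
    obtain ⟨z, hz, hcz, hmax⟩ := exists_interior_max hcomp
      (f := fun z => (L - Real.log (‖z - y‖ ^ 2)) ^ (K + 2) / q z)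
      (Ω := {z : E n | ρ ^ 2 < ‖z - y‖ ^ 2 ∧ ‖z - y‖ ^ 2 < Real.exp L})
      (c := (L - Real.log (ρ ^ 2)) ^ (K + 2) / a') (x := x)
      (by
        have : ContinuousOn (fun z : E n => ‖z - y‖ ^ 2) {z : E n | ρ ^ 2 ≤ ‖z - y‖ ^ 2 ∧
          ‖z - y‖ ^ 2 ≤ Real.exp L} := by fun_prop
        exact ((continuousOn_const.sub (this.log hne)).pow _).div hc.continuousOn
          fun z _ => (hpos z).ne')
      (by
        rintro z ⟨hzK, hzΩ⟩
        have hor : ‖z - y‖ ^ 2 = ρ ^ 2 ∨ ‖z - y‖ ^ 2 = Real.exp L := by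
          by_contra! h
          exact hzΩ ⟨lt_of_le_of_ne hzK.1 h.1.symm, lt_of_le_of_ne hzK.2 h.2⟩
        rcases hor with h | h
        · simp only [h]
          have : ‖z - y‖ ≤ ρ := by
            nlinarith [norm_nonneg (z - y)]
          have := hρa z this
          gcongr
        · simp only [h, Real.log_exp, sub_self]
          rw [zero_pow (by omega), zero_div]
          positivity)
      ⟨by gcongr, (Real.log_le_iff_le_exp (by positivity)).1 hL.le⟩
      (by
        rw [div_pow] at hlt
        have : 0 < q x := hpos x
        rw [div_lt_div_iff₀ ha0 this]
        rw [mul_div_assoc', lt_div_iff₀ hd] at hlt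
        linarith)
    have hzn : 0 < ‖z - y‖ ^ 2 := (pow_pos hρ 2).trans hz.1
    have hzL : Real.log (‖z - y‖ ^ 2) < L := (Real.log_lt_iff_lt_exp hzn).2 hz.2
    have hzl : 0 < (L - Real.log (‖z - y‖ ^ 2)) ^ (K + 2) := pow_pos (sub_pos.2 hzL) _
    refine hq.not_touch_log hΓ hn hK (mem_univ z) (c := q z / (L - Real.log (‖z - y‖ ^ 2)) ^ (K + 2))
      (y := y) (L := L) ?_ (div_pos (hpos z) hzl) hzL ?_ ?_
    · rintro rfl
      simp at hzn
    · rw [div_mul_cancel₀ _ hzl.ne']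
    · filter_upwards [hopen.mem_nhds hz] with w hw
      have h1 := hmax w ⟨hw.1.le, hw.2.le⟩
      rw [div_le_div_iff₀ (hpos w) (hpos z)] at h1
      rw [div_mul_eq_mul_div, div_le_iff₀ hzl]
      linarith
  have hlim : Tendsto (fun L : ℝ => a' * ((L - Real.log (‖x - y‖ ^ 2)) /
      (L - Real.log (ρ ^ 2))) ^ (K + 2)) atTop (𝓝 (a' * 1 ^ (K + 2))) := by
    refine ((Tendsto.pow ?_ _).const_mul _)
    have h1 : Tendsto (fun L : ℝ => 1 + (Real.log (ρ ^ 2) - Real.log (‖x - y‖ ^ 2)) /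
        (L - Real.log (ρ ^ 2))) atTop (𝓝 (1 + 0)) :=
      tendsto_const_nhds.add (tendsto_const_nhds.div_atTop
        (tendsto_atTop_add_const_right _ _ tendsto_id))
    rw [add_zero] at h1
    refine h1.congr' ?_
    filter_upwards [eventually_gt_atTop (Real.log (ρ ^ 2))] with L hL
    have : L - Real.log (ρ ^ 2) ≠ 0 := (sub_pos.2 hL).ne'
    field_simp
    ring
  rw [one_pow, mul_one] at hlim
  exact le_of_tendsto hlim ((eventually_gt_atTop _).mono key)

/-- If `λ* ∉ closure Γ`, the maximum principle holds for supersolutions on punctured balls, without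
any condition at the centre. The barriers `(log |z - y|² - L) ^ (-K)` are infinite on the sphere
`|z - y|² = e ^ L`, which shrinks to the centre as `L → -∞`. -/
theorem SuperOn.le_of_sphere (hΓ : IsAdmissibleCone Γ) (hn : 0 < n)
    (hl : lambdaStar n ∉ closure Γ) {q : E n → ℝ} {y : E n} {r m : ℝ}
    (hq : SuperOn Γ (ball y r \ {y}) q) (hc : ContinuousOn q (closedBall y r \ {y}))
    (hpos : ∀ x ∈ closedBall y r \ {y}, 0 < q x) (hm : ∀ x ∈ sphere y r, q x ≤ m) {x : E n}
    (hx : x ∈ closedBall y r \ {y}) : q x ≤ m := by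
  obtain ⟨K, hK0, hK⟩ : ∃ K : ℕ, 0 < K ∧ firstCoord n (1 + 2 / K) ∉ closure Γ := by
    have h1 : Tendsto (fun K : ℕ => firstCoord n (1 + 2 / (K : ℝ))) atTop
        (𝓝 (firstCoord n (1 + 0))) := by
      refine (continuous_firstCoord.tendsto _).comp (tendsto_const_nhds.add ?_)
      exact tendsto_const_nhds.div_atTop tendsto_natCast_atTop_atTop
    rw [add_zero, firstCoord_one] at h1
    obtain ⟨K, h2, h3⟩ := ((h1.eventually
      (isClosed_closure.isOpen_compl.mem_nhds hl)).and (eventually_gt_atTop 0)).exists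
    exact ⟨K, h3, h2⟩
  have hxr : ‖x - y‖ ≤ r := by simpa [dist_eq_norm] using hx.1
  have hxy : x ≠ y := by simpa using hx.2
  have hN : 0 < ‖x - y‖ := norm_pos_iff.2 (sub_ne_zero.2 hxy)
  have hr : 0 < r := hN.trans_le hxr
  rcases eq_or_lt_of_le hxr with h | hxr
  · exact hm x (by simpa [dist_eq_norm] using h)
  by_cases hm0 : m ≤ 0
  · exfalso
    obtain ⟨z, hz⟩ : (sphere y r).Nonempty := by
      refine ⟨y + (r / ‖x - y‖) • (x - y), ?_⟩
      rw [mem_sphere, dist_eq_norm, add_sub_cancel_left, norm_smul, Real.norm_eq_abs,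
        abs_of_pos (by positivity)]
      field_simp
    have h1 := hpos z ⟨sphere_subset_closedBall hz, by
      rintro rfl
      simp [hr.ne] at hz⟩
    linarith [hm z hz]
  push Not at hm0
  have key : ∀ L, L < Real.log (‖x - y‖ ^ 2) →
      q x ≤ m * ((Real.log (r ^ 2) - L) / (Real.log (‖x - y‖ ^ 2) - L)) ^ K := by
    intro L hL
    have hρL : L < Real.log (r ^ 2) :=
      hL.trans (Real.log_lt_log (by positivity) (by gcongr))
    by_contra! hlt
    have hd : 0 < (Real.log (‖x - y‖ ^ 2) - L) ^ K := pow_pos (sub_pos.2 hL) _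
    obtain ⟨hcomp, hopen⟩ := annulus_facts y (Real.exp L) (r ^ 2)
    have hsub : {z : E n | Real.exp L ≤ ‖z - y‖ ^ 2 ∧ ‖z - y‖ ^ 2 ≤ r ^ 2}
        ⊆ closedBall y r \ {y} := by
      rintro z ⟨h1, h2⟩
      constructor
      · rw [mem_closedBall, dist_eq_norm]
        exact (sq_le_sq₀ (norm_nonneg _) hr.le).1 h2
      · rintro rfl
        simp only [sub_self, norm_zero, ne_eq, OfNat.ofNat_ne_zero, not_false_eq_true,
          zero_pow] at h1
        linarith [Real.exp_pos L]
    have hne : ∀ z ∈ {z : E n | Real.exp L ≤ ‖z - y‖ ^ 2 ∧ ‖z - y‖ ^ 2 ≤ r ^ 2},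
        ‖z - y‖ ^ 2 ≠ 0 := fun z hz => ((Real.exp_pos L).trans_le hz.1).ne'
    obtain ⟨z, hz, hcz, hmax⟩ := exists_interior_max hcomp
      (f := fun z => q z * (Real.log (‖z - y‖ ^ 2) - L) ^ K)
      (Ω := {z : E n | Real.exp L < ‖z - y‖ ^ 2 ∧ ‖z - y‖ ^ 2 < r ^ 2})
      (c := m * (Real.log (r ^ 2) - L) ^ K) (x := x)
      (by
        have : ContinuousOn (fun z : E n => ‖z - y‖ ^ 2) {z : E n | Real.exp L ≤ ‖z - y‖ ^ 2 ∧
          ‖z - y‖ ^ 2 ≤ r ^ 2} := by fun_prop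
        exact (hc.mono hsub).mul (((this.log hne).sub continuousOn_const).pow _))
      (by
        rintro z ⟨hzK, hzΩ⟩
        have hor : ‖z - y‖ ^ 2 = Real.exp L ∨ ‖z - y‖ ^ 2 = r ^ 2 := by
          by_contra! h
          exact hzΩ ⟨lt_of_le_of_ne hzK.1 h.1.symm, lt_of_le_of_ne hzK.2 h.2⟩
        rcases hor with h | h
        · simp only [h, Real.log_exp, sub_self]
          rw [zero_pow hK0.ne', mul_zero]
          have := pow_pos (sub_pos.2 hρL) K
          positivity
        · simp only [h]
          have : ‖z - y‖ = r := (sq_eq_sq₀ (norm_nonneg _) hr.le).1 h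
          have h2 := hm z (by simpa [dist_eq_norm] using this)
          have := pow_pos (sub_pos.2 hρL) K
          gcongr)
      ⟨(Real.lt_log_iff_exp_lt (by positivity)).1 hL |>.le, by gcongr⟩
      (by
        rw [div_pow, mul_div_assoc', div_lt_iff₀ hd] at hlt
        exact hlt)
    have hzn : 0 < ‖z - y‖ ^ 2 := (Real.exp_pos L).trans hz.1
    have hzL : L < Real.log (‖z - y‖ ^ 2) := (Real.lt_log_iff_exp_lt hzn).2 hz.1
    have hzl : 0 < (Real.log (‖z - y‖ ^ 2) - L) ^ K := pow_pos (sub_pos.2 hzL) _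
    have hzy : z ≠ y := by
      rintro rfl
      simp at hzn
    have hqz := hpos z (hsub ⟨hz.1.le, hz.2.le⟩)
    refine hq.not_touch_log hΓ hn hK0 hK (x := z) ⟨?_, hzy⟩
      (c := q z * (Real.log (‖z - y‖ ^ 2) - L) ^ K)
      (y := y) (L := L) hzy (mul_pos hqz hzl) hzL ?_ ?_
    · rw [mem_ball, dist_eq_norm]
      exact (sq_lt_sq₀ (norm_nonneg _) hr.le).1 hz.2
    · rw [mul_div_cancel_right₀ _ hzl.ne']
    · filter_upwards [hopen.mem_nhds hz] with w hw
      have h1 := hmax w ⟨hw.1.le, hw.2.le⟩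
      have hwn : 0 < ‖w - y‖ ^ 2 := (Real.exp_pos L).trans hw.1
      have hwL : L < Real.log (‖w - y‖ ^ 2) := (Real.lt_log_iff_exp_lt hwn).2 hw.1
      rw [le_div_iff₀ (pow_pos (sub_pos.2 hwL) _)]
      exact h1
  have hlim : Tendsto (fun L : ℝ => m * ((Real.log (r ^ 2) - L) /
      (Real.log (‖x - y‖ ^ 2) - L)) ^ K) atBot (𝓝 (m * 1 ^ K)) := by
    refine ((Tendsto.pow ?_ _).const_mul _)
    have h1 : Tendsto (fun L : ℝ => 1 + (Real.log (r ^ 2) - Real.log (‖x - y‖ ^ 2)) /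
        (Real.log (‖x - y‖ ^ 2) - L)) atBot (𝓝 (1 + 0)) := by
      refine tendsto_const_nhds.add (tendsto_const_nhds.div_atTop ?_)
      exact (tendsto_atTop_add_const_left atBot (Real.log (‖x - y‖ ^ 2))
        tendsto_neg_atBot_atTop).congr fun L => (sub_eq_add_neg _ _).symm
    rw [add_zero] at h1
    refine h1.congr' ?_
    filter_upwards [eventually_lt_atBot (Real.log (‖x - y‖ ^ 2))] with L hL
    have : Real.log (‖x - y‖ ^ 2) - L ≠ 0 := (sub_pos.2 hL).ne'
    field_simp
    ring
  rw [one_pow, mul_one] at hlim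
  exact ge_of_tendsto hlim ((eventually_lt_atBot _).mono key)

/-! ### Moving spheres -/

lemma continuousOn_kelvin {q : E n → ℝ} (hc : Continuous q) (y : E n) (a : ℝ) :
    ContinuousOn (kelvin y a q) {y}ᶜ := by
  have h1 : ∀ x ∈ ({y}ᶜ : Set (E n)), ‖x - y‖ ^ 2 ≠ 0 := fun x hx =>
    pow_ne_zero 2 (norm_ne_zero_iff.2 (sub_ne_zero.2 hx))
  have h2 : ContinuousOn (fun x => y + (a / ‖x - y‖ ^ 2) • (x - y)) {y}ᶜ := by
    refine continuousOn_const.add (ContinuousOn.smul (continuousOn_const.div ?_ h1) ?_) <;> fun_prop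
  have h3 : ContinuousOn (fun x : E n => ‖x - y‖ ^ 2 / a) {y}ᶜ := by fun_prop
  exact h3.mul (hc.comp_continuousOn h2)

lemma kelvin_pos {q : E n → ℝ} (hpos : ∀ x, 0 < q x) {y x : E n} {a : ℝ} (ha : 0 < a)
    (hx : x ≠ y) : 0 < kelvin y a q x := by
  have : 0 < ‖x - y‖ := norm_pos_iff.2 (sub_ne_zero.2 hx)
  have := hpos (y + (a / ‖x - y‖ ^ 2) • (x - y))
  rw [kelvin]
  positivity

lemma kelvin_of_mem_sphere {q : E n → ℝ} {y x : E n} {a : ℝ} (ha : 0 < a)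
    (h : ‖x - y‖ ^ 2 = a) : kelvin y a q x = q x := by
  rw [kelvin, h, div_self ha.ne', one_smul, one_mul, add_sub_cancel]

/-- `q (z) = ‖z‖² Q (z / ‖z‖²)` for the transform `Q` of `q` in the unit sphere. -/
lemma eq_kelvin_zero (q : E n → ℝ) {z : E n} (hz : z ≠ 0) :
    q z = ‖z‖ ^ 2 * kelvin 0 1 q ((1 / ‖z‖ ^ 2) • z) := by
  simpa using kelvin_eq (y := 0) one_pos hz q

/-- If `λ* ∉ closure Γ`, positive supersolutions on `ℝⁿ` grow at most quadratically. The number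
`β` is the upper limit of `q z / ‖z‖²` at infinity. -/
lemma exists_growth (hΓ : IsAdmissibleCone Γ) (hn : 0 < n) (hl : lambdaStar n ∉ closure Γ)
    {q : E n → ℝ} (hc : Continuous q) (hpos : ∀ x, 0 < q x) (hsup : SuperOn Γ univ q) :
    ∃ β ≥ 0, (∀ ε > 0, ∀ᶠ z in Bornology.cobounded (E n), q z ≤ (β + ε) * ‖z‖ ^ 2) ∧
      ∀ b < β, ∃ᶠ z in Bornology.cobounded (E n), b * ‖z‖ ^ 2 < q z := by
  have hbot : (Bornology.cobounded (E n)).NeBot := by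
    have : Nonempty (Fin n) := ⟨⟨0, hn⟩⟩
    exact NormedSpace.cobounded_neBot ℝ (E n)
  let S : Set ℝ := {b | 0 ≤ b ∧ ∀ᶠ z in Bornology.cobounded (E n), q z ≤ b * ‖z‖ ^ 2}
  have hSb : BddBelow S := ⟨0, fun b hb => hb.1⟩
  have hSn : S.Nonempty := by
    have hcK := continuousOn_kelvin hc 0 1
    obtain ⟨m, hm⟩ : ∃ m, ∀ x ∈ sphere (0 : E n) 1, kelvin 0 1 q x ≤ m := by
      obtain ⟨m, hm⟩ := (isCompact_sphere (0 : E n) 1).bddAbove_image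
        (hcK.mono fun x hx => by
          rintro rfl
          simp at hx)
      exact ⟨m, fun x hx => hm (mem_image_of_mem _ hx)⟩
    refine ⟨max m 0, le_max_right _ _, ?_⟩
    filter_upwards [(hasBasis_cobounded_norm (E := E n)).mem_of_mem (i := 1) trivial] with z hz
    have hz1 : 1 ≤ ‖z‖ := hz
    have hz0 : z ≠ 0 := norm_pos_iff.1 (one_pos.trans_le hz1)
    have hzn : ‖(1 / ‖z‖ ^ 2) • z‖ = 1 / ‖z‖ := by
      rw [norm_smul, Real.norm_eq_abs, abs_of_nonneg (by positivity)]
      field_simp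
    rw [eq_kelvin_zero q hz0, mul_comm]
    gcongr
    refine le_trans ?_ (le_max_left m 0)
    refine SuperOn.le_of_sphere hΓ hn hl (y := 0) (r := 1)
      (fun x hx => (hsup.kelvin one_pos) x hx.2) (hcK.mono fun x hx => hx.2)
      (fun x hx => kelvin_pos hpos one_pos hx.2) hm ⟨?_, ?_⟩
    · rw [mem_closedBall_zero_iff, hzn]
      exact (div_le_one (by positivity)).2 hz1
    · exact smul_ne_zero (by positivity) hz0
  refine ⟨sInf S, le_csInf hSn fun b hb => hb.1, fun ε hε => ?_, fun b hb => ?_⟩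
  · obtain ⟨b, hbS, hb⟩ := exists_lt_of_csInf_lt hSn (lt_add_of_pos_right (sInf S) hε)
    filter_upwards [hbS.2] with z hz
    exact hz.trans (by gcongr)
  · rcases lt_or_ge b 0 with h | h
    · exact Eventually.frequently (Eventually.of_forall fun z => lt_of_le_of_lt
        (mul_nonpos_of_nonpos_of_nonneg h.le (by positivity)) (hpos z))
    · have hbS : b ∉ S := fun h => absurd (csInf_le hSb h) (not_le.2 hb)
      have : ¬ ∀ᶠ z in Bornology.cobounded (E n), q z ≤ b * ‖z‖ ^ 2 := fun h' => hbS ⟨h, h'⟩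
      simpa only [Filter.not_eventually, not_le] using this

/-- The growth at infinity is the same as seen from any centre. -/
lemma eventually_growth {q : E n → ℝ} {β : ℝ} (hβ0 : 0 ≤ β)
    (hβ : ∀ ε > 0, ∀ᶠ z in Bornology.cobounded (E n), q z ≤ (β + ε) * ‖z‖ ^ 2) (y : E n)
    {ε : ℝ} (hε : 0 < ε) :
    ∀ᶠ z in Bornology.cobounded (E n), q z ≤ (β + ε) * ‖z - y‖ ^ 2 := by
  have h1 : Tendsto (fun z : E n => ‖z‖ - ‖y‖ * (1 + 4 * (β + ε) / ε)) (Bornology.cobounded (E n))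
      atTop := tendsto_atTop_add_const_right _ _ tendsto_norm_cobounded_atTop
  filter_upwards [hβ (ε / 2) (by positivity), h1.eventually_ge_atTop 0] with z hz h2
  refine hz.trans ?_
  have h3 : ‖z‖ - ‖y‖ ≤ ‖z - y‖ := norm_sub_norm_le z y
  have hy : 0 ≤ ‖y‖ := norm_nonneg y
  have h4 : ‖y‖ * (4 * (β + ε)) ≤ ε * ‖z‖ := by
    have : ‖y‖ * (4 * (β + ε) / ε) ≤ ‖z‖ := by linarith
    have := mul_le_mul_of_nonneg_left this hε.le
    calc _ = ε * (‖y‖ * (4 * (β + ε) / ε)) := by field_simp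
      _ ≤ _ := this
  have h6 : ‖y‖ ≤ ‖z‖ := by nlinarith
  have h5 : (‖z‖ - ‖y‖) ^ 2 ≤ ‖z - y‖ ^ 2 := by
    refine pow_le_pow_left₀ (by linarith) h3 2
  calc (β + ε / 2) * ‖z‖ ^ 2 ≤ (β + ε) * (‖z‖ - ‖y‖) ^ 2 := by
        have : 0 ≤ ‖z‖ := norm_nonneg z
        have := mul_le_mul_of_nonneg_right h4 this
        nlinarith [sq_nonneg ‖y‖]
    _ ≤ _ := by gcongr

/-- Moving spheres: `q` dominates its transform inside a sphere about `y`, up to the radius at which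
the transform takes the value `q y` at `y`. -/
theorem kelvin_le (hΓ : IsAdmissibleCone Γ) {q : E n → ℝ} (hc : Continuous q)
    (hpos : ∀ x, 0 < q x) (hsup : SuperOn Γ univ q) (hsub : SubOn Γ univ q) {β : ℝ} (hβ0 : 0 ≤ β)
    (hβ : ∀ ε > 0, ∀ᶠ z in Bornology.cobounded (E n), q z ≤ (β + ε) * ‖z‖ ^ 2) {x y : E n} {a : ℝ}
    (ha : 0 < a) (hay : β * a ≤ q y) (hx : x ≠ y) (hxa : ‖x - y‖ ^ 2 ≤ a) :
    kelvin y a q x ≤ q x := by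
  have key : ∀ a > 0, β * a < q y → ‖x - y‖ ^ 2 ≤ a → kelvin y a q x ≤ q x := by
    clear hay hxa
    intro a ha hay hxa
    have hN : 0 < ‖x - y‖ := norm_pos_iff.2 (sub_ne_zero.2 hx)
    obtain ⟨ε, hε, hεy⟩ : ∃ ε > 0, (β + ε) * a < q y := by
      refine ⟨(q y - β * a) / (2 * a), by have := sub_pos.2 hay; positivity, ?_⟩
      rw [add_mul, div_mul_eq_mul_div, mul_div_mul_right _ _ ha.ne']
      linarith
    obtain ⟨B, -, hB⟩ := (hasBasis_cobounded_norm (E := E n)).eventually_iff.1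
      (eventually_growth hβ0 hβ y hε)
    obtain ⟨ρ₁, hρ₁, hq⟩ := Metric.mem_nhds_iff.1 (hc.continuousAt.eventually (Ioi_mem_nhds hεy))
    -- the transform is at most `(β + ε) a` near `y`
    obtain ⟨ρ, hρ, hρx, hρ1, hρB⟩ : ∃ ρ > 0, ρ ≤ ‖x - y‖ ∧ ρ < ρ₁ ∧ B + ‖y‖ ≤ a / ρ := by
      have h1 : Tendsto (fun ρ : ℝ => a / ρ) (𝓝[>] 0) atTop :=
        tendsto_inv_nhdsGT_zero.const_mul_atTop ha
      obtain ⟨ρ, ⟨h2, h3⟩, h4⟩ := ((h1.eventually_ge_atTop (B + ‖y‖)).and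
        (eventually_nhdsWithin_of_eventually_nhds (Iio_mem_nhds (lt_min hN hρ₁)))).and
        self_mem_nhdsWithin |>.exists
      exact ⟨ρ, h4, (lt_min_iff.1 h3).1.le, (lt_min_iff.1 h3).2, h2⟩
    have hbd : ∀ z, ‖z - y‖ = ρ → kelvin y a q z ≤ q z := by
      intro z hz
      have h1 : ‖(a / ‖z - y‖ ^ 2) • (z - y)‖ = a / ρ := by
        rw [norm_smul, Real.norm_eq_abs, abs_of_nonneg (by positivity), hz]
        field_simp
      have h2 : B ≤ ‖y + (a / ‖z - y‖ ^ 2) • (z - y)‖ := by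
        have := norm_sub_le (y + (a / ‖z - y‖ ^ 2) • (z - y)) y
        rw [add_sub_cancel_left, h1] at this
        linarith
      have h3 := hB h2
      simp only [add_sub_cancel_left, h1] at h3
      have h4 : z ∈ ball y ρ₁ := by
        rw [mem_ball, dist_eq_norm, hz]
        exact hρ1
      have h5 : (β + ε) * a < q z := hq h4
      refine le_trans ?_ h5.le
      rw [kelvin, hz]
      rw [hz] at h3
      calc ρ ^ 2 / a * q _ ≤ ρ ^ 2 / a * ((β + ε) * (a / ρ) ^ 2) := by gcongr
        _ = (β + ε) * a := by field_simp
    obtain ⟨hcomp, hopen⟩ := annulus_facts y (ρ ^ 2) a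
    have hne : {z : E n | ρ ^ 2 ≤ ‖z - y‖ ^ 2 ∧ ‖z - y‖ ^ 2 ≤ a} ⊆ {y}ᶜ := by
      rintro z hz rfl
      have := hz.1
      rw [sub_self, norm_zero] at this
      nlinarith
    have hΩK : {z : E n | ρ ^ 2 < ‖z - y‖ ^ 2 ∧ ‖z - y‖ ^ 2 < a} ⊆
      {z : E n | ρ ^ 2 ≤ ‖z - y‖ ^ 2 ∧ ‖z - y‖ ^ 2 ≤ a} := fun z hz => ⟨hz.1.le, hz.2.le⟩
    refine comparison hΓ hcomp hopen hΩK hc.continuousOn ((continuousOn_kelvin hc y a).mono hne)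
      (fun z _ => hpos z) (fun z hz => kelvin_pos hpos ha (hne hz)) (fun z _ => hsub z (mem_univ z))
      (fun z hz => hsup.kelvin ha z (hne (hΩK hz))) ?_ x ⟨by gcongr, hxa⟩
    rintro z ⟨hzK, hzΩ⟩
    have hor : ‖z - y‖ ^ 2 = ρ ^ 2 ∨ ‖z - y‖ ^ 2 = a := by
      by_contra! h
      exact hzΩ ⟨lt_of_le_of_ne hzK.1 h.1.symm, lt_of_le_of_ne hzK.2 h.2⟩
    rcases hor with h | h
    · exact hbd z ((sq_eq_sq₀ (norm_nonneg _) hρ.le).1 h)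
    · exact (kelvin_of_mem_sphere ha h).le
  rcases eq_or_lt_of_le hxa with h | hxa
  · exact (kelvin_of_mem_sphere ha h).le
  rcases lt_or_eq_of_le hay with h | hay
  · exact key a ha h hxa.le
  have hβp : 0 < β := by
    rcases eq_or_lt_of_le hβ0 with h | h
    · rw [← h, zero_mul] at hay
      exact absurd (hpos y) (by rw [← hay]; exact lt_irrefl 0)
    · exact h
  have h1 : ContinuousAt (fun b => kelvin y b q x) a := by
    have h2 : Continuous fun b : ℝ => y + (b / ‖x - y‖ ^ 2) • (x - y) := by fun_prop
    exact (continuousAt_const.div continuousAt_id ha.ne').mul (hc.comp h2).continuousAt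
  refine le_of_tendsto (h1.mono_left (nhdsWithin_le_nhds (s := Iio a))) ?_
  filter_upwards [self_mem_nhdsWithin,
    eventually_nhdsWithin_of_eventually_nhds (Ioi_mem_nhds hxa)] with b hb hb'
  have hN : 0 < ‖x - y‖ := norm_pos_iff.2 (sub_ne_zero.2 hx)
  refine key b ((pow_pos hN 2).trans hb') ?_ hb'.le
  rw [← hay]
  exact mul_lt_mul_of_pos_left hb hβp

/-- If `q` grows slower than quadratically, then all spheres can be reached, and `q` is constant. -/
theorem eq_of_growth_zero (hΓ : IsAdmissibleCone Γ) {q : E n → ℝ} (hc : Continuous q)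
    (hpos : ∀ x, 0 < q x) (hsup : SuperOn Γ univ q) (hsub : SubOn Γ univ q)
    (hβ : ∀ ε > 0, ∀ᶠ z in Bornology.cobounded (E n), q z ≤ (0 + ε) * ‖z‖ ^ 2) (x ξ : E n) :
    q ξ ≤ q x := by
  rcases eq_or_ne ξ x with rfl | hne
  · exact le_rfl
  have hN : 0 < ‖ξ - x‖ := norm_pos_iff.2 (sub_ne_zero.2 hne)
  -- `x` and `ξ` are symmetric with respect to a sphere about the far point `x - t (ξ - x)`
  have key : ∀ t > 0, t / (1 + t) * q ξ ≤ q x := by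
    intro t ht
    set y := x - t • (ξ - x) with hy
    set a := t * (1 + t) * ‖ξ - x‖ ^ 2 with ha
    have hxy : x - y = t • (ξ - x) := by rw [hy]; abel
    have hxyn : ‖x - y‖ ^ 2 = t ^ 2 * ‖ξ - x‖ ^ 2 := by
      rw [hxy, norm_smul, mul_pow, Real.norm_eq_abs, sq_abs]
    have h1 := kelvin_le hΓ hc hpos hsup hsub le_rfl hβ (x := x) (y := y) (a := a)
      (by positivity) (by rw [zero_mul]; exact (hpos y).le)
      (by
        rw [← sub_ne_zero, hxy]
        exact smul_ne_zero ht.ne' (sub_ne_zero.2 hne))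
      (by
        rw [hxyn, ha]
        gcongr
        nlinarith)
    rw [kelvin, hxyn, hxy, smul_smul] at h1
    have e1 : t ^ 2 * ‖ξ - x‖ ^ 2 / a = t / (1 + t) := by
      rw [ha]; field_simp
    have e2 : a / (t ^ 2 * ‖ξ - x‖ ^ 2) * t = 1 + t := by
      rw [ha]; field_simp
    have e3 : y + (1 + t) • (ξ - x) = ξ := by
      rw [hy]; module
    rwa [e1, e2, e3] at h1
  have hlim : Tendsto (fun t : ℝ => t / (1 + t) * q ξ) atTop (𝓝 (1 * q ξ)) := by
    refine Tendsto.mul_const _ ?_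
    have h1 : Tendsto (fun t : ℝ => 1 - 1 / (1 + t)) atTop (𝓝 (1 - 0)) :=
      tendsto_const_nhds.sub (tendsto_const_nhds.div_atTop
        (tendsto_atTop_add_const_left _ _ tendsto_id))
    rw [sub_zero] at h1
    refine h1.congr' ?_
    filter_upwards [eventually_gt_atTop 0] with t ht
    field_simp
    ring
  rw [one_mul] at hlim
  exact le_of_tendsto hlim ((eventually_gt_atTop 0).mono key)

/-! ### Supergradients -/

/-- `G` is a supergradient of `N` at `y`: `N z ≤ N y + ⟨G, z - y⟩ + o(‖z - y‖)`. -/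
def IsSupergradient (N : E n → ℝ) (y G : E n) : Prop :=
  ∀ κ > 0, ∀ᶠ z in 𝓝 y, N z ≤ N y + ⟪G, z - y⟫ + κ * ‖z - y‖

lemma IsSupergradient.of_touch {N Φ : E n → ℝ} {y : E n} (hΦ : DifferentiableAt ℝ Φ y)
    (h : ∀ᶠ z in 𝓝 y, N z - Φ z ≤ N y - Φ y) :
    IsSupergradient N y ((InnerProductSpace.toDual ℝ (E n)).symm (fderiv ℝ Φ y)) := by
  intro κ hκ
  filter_upwards [h, hΦ.hasFDerivAt.isLittleO.def hκ] with z h1 h2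
  rw [InnerProductSpace.toDual_symm_apply]
  have := (le_abs_self _).trans h2
  linarith

/-- If all supergradients have derivative at most `c` in the direction `e`, then so has `N`. -/
lemma le_add_of_supergradient {N : E n → ℝ} (hN : Continuous N) {e : E n} (he : e ≠ 0) {c : ℝ}
    (h : ∀ y G, IsSupergradient N y G → ⟪G, e⟫ ≤ c) (y : E n) : N (y + e) ≤ N y + c := by
  by_contra! hlt
  obtain ⟨θ, hθ, hlt⟩ : ∃ θ > 0, N y + c + 2 * θ < N (y + e) :=
    ⟨(N (y + e) - (N y + c)) / 4, by linarith, by linarith⟩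
  have he2 : ⟪e, e⟫ = ‖e‖ ^ 2 := real_inner_self_eq_norm_sq e
  have hen : 0 < ‖e‖ := norm_pos_iff.2 he
  -- coordinates along and orthogonal to `e`
  let t : E n → ℝ := fun z => ⟪e, z - y⟫ / ‖e‖ ^ 2
  let w : E n → E n := fun z => z - y - t z • e
  have ht : Continuous t := by fun_prop
  have hw : Continuous w := by fun_prop
  let K : Set (E n) := {z | 0 ≤ t z ∧ t z ≤ 2 ∧ ‖w z‖ ≤ 1}
  let Ω : Set (E n) := {z | 0 < t z ∧ t z < 2 ∧ ‖w z‖ < 1}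
  have hK : IsCompact K := by
    refine Metric.isCompact_of_isClosed_isBounded
      ((isClosed_le continuous_const ht).inter ((isClosed_le ht continuous_const).inter
        (isClosed_le hw.norm continuous_const)))
      ((isBounded_closedBall (x := y) (r := 2 * ‖e‖ + 1)).subset fun z hz => ?_)
    obtain ⟨h0, h1, h2⟩ := hz
    rw [mem_closedBall, dist_eq_norm]
    have : z - y = t z • e + w z := by simp only [w]; abel
    rw [this]
    refine (norm_add_le _ _).trans (add_le_add ?_ h2)
    rw [norm_smul, Real.norm_eq_abs, abs_of_nonneg h0]
    gcongr
  have hΩ : IsOpen Ω := (isOpen_lt continuous_const ht).inter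
    ((isOpen_lt ht continuous_const).inter (isOpen_lt hw.norm continuous_const))
  have hte : t (y + e) = 1 := by
    simp only [t, add_sub_cancel_left, he2]
    field_simp
  have hwe : w (y + e) = 0 := by simp [w, hte]
  have hyeK : y + e ∈ K := ⟨by rw [hte]; norm_num, by rw [hte]; norm_num, by rw [hwe]; simp⟩
  obtain ⟨B, hB⟩ : ∃ B, ∀ z ∈ K, |N z| ≤ B := by
    obtain ⟨B, hB⟩ := hK.exists_bound_of_continuousOn hN.continuousOn
    exact ⟨B, hB⟩
  have hty : t y = 0 := by simp [t]
  have hwy : w y = 0 := by simp [w, hty]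
  have hyK : y ∈ K := ⟨hty.ge, by rw [hty]; norm_num, by rw [hwy]; simp⟩
  have hB0 : 0 ≤ B := (abs_nonneg _).trans (hB y hyK)
  obtain ⟨δ, hδ, hδ1, hδN⟩ : ∃ δ > 0, δ ≤ 1 ∧ ∀ z, ‖z - y‖ < δ → N z ≤ N y + θ := by
    obtain ⟨δ, hδ, hd⟩ := Metric.mem_nhds_iff.1
      (hN.continuousAt.eventually (Iio_mem_nhds (lt_add_of_pos_right (N y) hθ)))
    refine ⟨min δ 1, by positivity, min_le_right _ _, fun z hz => ?_⟩
    exact (hd (show z ∈ ball y δ by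
      rw [mem_ball, dist_eq_norm]; exact hz.trans_le (min_le_left _ _))).le
  obtain ⟨m, hm⟩ := pow_unbounded_of_one_lt ((2 * B + 2 * |c|) / θ) one_lt_two
  rw [div_lt_iff₀ hθ] at hm
  set A := (2 * B + 2 * |c|) / δ ^ 2 with hA
  have hA1 : 2 * B + 2 * |c| ≤ A := by
    rw [hA, le_div_iff₀ (by positivity)]
    exact mul_le_of_le_one_right (by positivity) (pow_le_one₀ hδ.le hδ1)
  have hA0 : 0 ≤ A := by positivity
  -- the exponent `m` makes the test function small for `t ≤ 1` and large for `t = 2`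
  let Φ : E n → ℝ := fun z => c * t z + θ * t z ^ (m + 1) + A * ‖w z‖ ^ 2
  have htd : Differentiable ℝ t := by
    have : Differentiable ℝ fun z : E n => ⟪e, z - y⟫ :=
      (differentiable_const e).inner ℝ (differentiable_id.sub_const y)
    simpa only [t, div_eq_mul_inv] using this.mul_const (‖e‖ ^ 2)⁻¹
  have hΦd : Differentiable ℝ Φ := by
    have hwd : Differentiable ℝ w := (differentiable_id.sub_const y).sub (htd.smul_const e)
    exact ((htd.const_mul c).add ((htd.pow (m + 1)).const_mul θ)).add
      ((hwd.norm_sq ℝ).const_mul A)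
  obtain ⟨z, hz, -, hmax⟩ := exists_interior_max hK (f := fun z => N z - Φ z) (Ω := Ω)
    (c := N y + θ) (x := y + e) (hN.sub hΦd.continuous).continuousOn
    (by
      rintro z ⟨⟨h0, h2, h1⟩, hzΩ⟩
      have hNz := abs_le.1 (hB z ⟨h0, h2, h1⟩)
      have hNy := abs_le.1 (hB y hyK)
      have hct : -(2 * |c|) ≤ c * t z := by
        have h3 : |c * t z| ≤ |c| * 2 := by
          rw [abs_mul, abs_of_nonneg h0]; gcongr
        linarith [neg_abs_le (c * t z)]
      have hp : 0 ≤ θ * t z ^ (m + 1) := by positivity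
      have hq : 0 ≤ A * ‖w z‖ ^ 2 := by positivity
      simp only [Φ]
      by_cases hd : δ ≤ ‖w z‖
      · have : 2 * B + 2 * |c| ≤ A * ‖w z‖ ^ 2 := by
          calc 2 * B + 2 * |c| = A * δ ^ 2 := by rw [hA]; field_simp
            _ ≤ _ := by gcongr
        linarith
      · push Not at hd
        have hor : t z = 0 ∨ t z = 2 := by
          by_contra! h3
          exact hzΩ ⟨lt_of_le_of_ne h0 h3.1.symm, lt_of_le_of_ne h2 h3.2, hd.trans_le hδ1⟩
        rcases hor with h3 | h3
        · have h4 : z - y = w z := by simp [w, h3]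
          have := hδN z (by rw [h4]; exact hd)
          rw [h3, mul_zero]
          rw [h3] at hp
          linarith
        · have h5 : 2 * B + 2 * |c| ≤ θ * t z ^ (m + 1) := by
            have h6 : θ * t z ^ (m + 1) = 2 * (2 ^ m * θ) := by rw [h3]; ring
            have h7 : 0 ≤ 2 ^ m * θ := by positivity
            linarith
          linarith) hyeK
    (by
      simp only [Φ, hte, hwe, one_pow, norm_zero]
      linarith)
  have hs := h z _ (IsSupergradient.of_touch (hΦd z)
    (eventually_of_mem (hΩ.mem_nhds hz) fun x hx => hmax x ⟨hx.1.le, hx.2.1.le, hx.2.2.le⟩))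
  rw [InnerProductSpace.toDual_symm_apply] at hs
  have hline : HasDerivAt (fun s : ℝ => Φ (z + s • e)) (fderiv ℝ Φ z e) 0 := by
    have h1 : HasDerivAt (fun s : ℝ => z + s • e) e 0 := by
      simpa using ((hasDerivAt_id (0 : ℝ)).smul_const e).const_add z
    have h2 : HasFDerivAt Φ (fderiv ℝ Φ z) (z + (0 : ℝ) • e) := by
      simpa using (hΦd z).hasFDerivAt
    exact h2.comp_hasDerivAt 0 h1
  have hts : ∀ s : ℝ, t (z + s • e) = t z + s := fun s => by
    simp only [t]
    rw [show z + s • e - y = (z - y) + s • e by abel, inner_add_right, real_inner_smul_right, he2]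
    field_simp
  have hws : ∀ s : ℝ, w (z + s • e) = w z := fun s => by
    simp only [w]
    rw [hts]
    module
  have hline' : HasDerivAt (fun s : ℝ => Φ (z + s • e)) (c + θ * ((m + 1) * t z ^ m)) 0 := by
    have e1 : (fun s : ℝ => Φ (z + s • e))
        = fun s => c * (t z + s) + θ * (t z + s) ^ (m + 1) + A * ‖w z‖ ^ 2 := by
      funext s
      simp only [Φ, hts, hws]
    rw [e1]
    have h1 : HasDerivAt (fun s : ℝ => t z + s) 1 0 := (hasDerivAt_id (0 : ℝ)).const_add _
    refine (((h1.const_mul c).add ((h1.pow (m + 1)).const_mul θ)).add_const _).congr_deriv ?_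
    simp
  rw [hline.unique hline'] at hs
  have h1 : 0 < t z := hz.1
  have : 0 < θ * ((m + 1) * t z ^ m) := by positivity
  linarith

lemma add_eq_of_supergradient {N : E n → ℝ} (hN : Continuous N) {e : E n} (he : e ≠ 0) {c : ℝ}
    (h : ∀ y G, IsSupergradient N y G → ⟪G, e⟫ = c) (y : E n) : N (y + e) = N y + c := by
  refine le_antisymm (le_add_of_supergradient hN he (fun y G hG => (h y G hG).le) y) ?_
  have := le_add_of_supergradient hN (neg_ne_zero.2 he) (c := -c)
    (fun y G hG => by rw [inner_neg_right, h y G hG]) (y + e)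
  rw [add_neg_cancel_right] at this
  linarith

lemma exists_supergradient (hn : 0 < n) {N : E n → ℝ} (hN : Continuous N) :
    ∃ y G, IsSupergradient N y G := by
  by_contra! h
  have he : (EuclideanSpace.single (⟨0, hn⟩ : Fin n) (1 : ℝ)) ≠ 0 := by simp
  have h0 := add_eq_of_supergradient hN he (c := 0) (fun y G hG => absurd hG (h y G)) 0
  have h1 := add_eq_of_supergradient hN he (c := 1) (fun y G hG => absurd hG (h y G)) 0
  linarith

/-- A set `𝒢` has a point `G'` in its convex hull which is at a positive distance from the
boundary, relative to the affine span of `𝒢`. Finitely many points of `𝒢` suffice to express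
this. -/
lemma exists_center {𝒢 : Set (E n)} {G₀ : E n} (hG₀ : G₀ ∈ 𝒢) {U : Submodule ℝ (E n)}
    (hU : U = Submodule.span ℝ ((fun G => G - G₀) '' 𝒢)) :
    ∃ (F : Finset (E n)) (G' : E n) (c : ℝ), ↑F ⊆ 𝒢 ∧ 0 < c ∧
      ∀ x, ∃ G ∈ F, ⟪G - G', x⟫ ≤ -(c * ‖U.starProjection x‖) := by
  classical
  obtain ⟨t, ht, htU⟩ := Submodule.fg_span_iff_fg_span_finset_subset _ |>.1
    (IsNoetherian.noetherian (Submodule.span ℝ ((fun G => G - G₀) '' 𝒢)))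
  rw [← hU] at htU
  obtain ⟨C, hC, hCx⟩ : ∃ C > 0, ∀ x : E n, ∃ v ∈ insert 0 t,
      ‖U.starProjection x‖ ≤ C * |⟪v, x⟫| := by
    let f : U →ₗ[ℝ] (t → ℝ) := LinearMap.pi fun v => (innerₗ (E n) v.1).comp U.subtype
    have hf : LinearMap.ker f = ⊥ := by
      rw [LinearMap.ker_eq_bot']
      intro x hx
      have h1 : ∀ v ∈ t, ⟪v, (x : E n)⟫ = 0 := fun v hv => congrFun hx ⟨v, hv⟩
      have h2 : (x : E n) ∈ Uᗮ := by
        rw [Submodule.mem_orthogonal]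
        intro u hu
        rw [htU] at hu
        induction hu using Submodule.span_induction with
        | mem v hv => exact h1 v hv
        | zero => simp
        | add a b _ _ ha hb => rw [inner_add_left, ha, hb, add_zero]
        | smul r a _ ha => rw [real_inner_smul_left, ha, mul_zero]
      have h3 := Submodule.inner_right_of_mem_orthogonal x.2 h2
      exact Subtype.ext (inner_self_eq_zero.1 h3)
    obtain ⟨C, hC, hanti⟩ := f.exists_antilipschitzWith hf
    refine ⟨C, hC, fun x => ?_⟩
    have h1 := hanti.le_mul_norm (f.map_zero) (U.orthogonalProjectionOnto x)
    have h2 : ∀ v : t, f (U.orthogonalProjectionOnto x) v = ⟪v.1, x⟫ := fun v => by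
      have hv : v.1 ∈ U := by rw [htU]; exact Submodule.subset_span v.2
      simp only [f, LinearMap.pi_apply, LinearMap.comp_apply, innerₗ_apply_apply,
        Submodule.subtype_apply]
      rw [← Submodule.starProjection_apply, ← Submodule.inner_starProjection_left_eq_right,
        Submodule.starProjection_eq_self_iff.2 hv]
    have h3 : ‖U.starProjection x‖ = ‖U.orthogonalProjectionOnto x‖ := rfl
    rw [h3]
    rcases isEmpty_or_nonempty t with hemp | hne
    · refine ⟨0, Finset.mem_insert_self _ _, h1.trans ?_⟩
      rw [Subsingleton.elim (f (U.orthogonalProjectionOnto x)) 0]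
      simp
    · obtain ⟨v, hv⟩ := Finite.exists_max fun v : t => |⟪v.1, x⟫|
      refine ⟨v, Finset.mem_insert_of_mem v.2, h1.trans ?_⟩
      gcongr
      refine (pi_norm_le_iff_of_nonneg (abs_nonneg _)).2 fun v' => ?_
      rw [h2]
      exact hv v'
  set F₀ := insert 0 t with hF₀
  have hF₀n : (0 : ℝ) < F₀.card := by
    exact_mod_cast Finset.card_pos.2 ⟨0, Finset.mem_insert_self _ _⟩
  set M : E n := (F₀.card : ℝ)⁻¹ • ∑ v ∈ F₀, v with hM
  refine ⟨F₀.image fun v => G₀ + v, G₀ + M, (2 * C * F₀.card)⁻¹, ?_, by positivity, fun x => ?_⟩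
  · intro G hG
    rw [Finset.coe_image] at hG
    obtain ⟨v, hv, rfl⟩ := hG
    rcases Finset.mem_insert.1 hv with rfl | hv
    · simpa using hG₀
    · obtain ⟨G, hG, rfl⟩ := ht hv
      simpa using hG
  -- if all values were large, then, as their sum vanishes, all of them would be small
  by_contra! hcon
  set μ := (2 * C * F₀.card)⁻¹ * ‖U.starProjection x‖ with hμ
  have h1 : ∀ v ∈ F₀, -μ < ⟪v - M, x⟫ := fun v hv => by
    simpa using hcon (G₀ + v) (Finset.mem_image_of_mem _ hv)
  have hsum : ∑ v ∈ F₀, ⟪v - M, x⟫ = 0 := by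
    rw [← sum_inner, Finset.sum_sub_distrib, Finset.sum_const, hM, ← Nat.cast_smul_eq_nsmul ℝ,
      smul_smul, mul_inv_cancel₀ hF₀n.ne', one_smul, sub_self, inner_zero_left]
  have hμ0 : 0 ≤ μ := by positivity
  have h2 : ∀ v ∈ F₀, ⟪v - M, x⟫ ≤ (F₀.card - 1) * μ := fun v hv => by
    rw [← Finset.add_sum_erase _ _ hv] at hsum
    have h3 : ∑ u ∈ F₀.erase v, (-μ) ≤ ∑ u ∈ F₀.erase v, ⟪u - M, x⟫ :=
      Finset.sum_le_sum fun u hu => (h1 u (Finset.mem_of_mem_erase hu)).le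
    rw [Finset.sum_const, nsmul_eq_mul, Finset.card_erase_of_mem hv,
      Nat.cast_pred (Finset.card_pos.2 ⟨v, hv⟩)] at h3
    linarith
  obtain ⟨v, hv, hvC⟩ := hCx x
  have h0 : (0 : E n) ∈ F₀ := Finset.mem_insert_self _ _
  have h3 : |⟪v, x⟫| < F₀.card * μ + μ := by
    have e1 : ⟪v, x⟫ = ⟪v - M, x⟫ - ⟪0 - M, x⟫ := by rw [← inner_sub_left]; congr 1; abel
    have a1 := h1 v hv
    have a2 := h1 0 h0
    have a3 := h2 v hv
    have a4 := h2 0 h0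
    rw [e1, abs_lt]
    constructor <;> nlinarith
  have h4 : ‖U.starProjection x‖ < C * (F₀.card * μ + μ) :=
    hvC.trans_lt (by gcongr)
  have h5 : ‖U.starProjection x‖ = 2 * C * F₀.card * μ := by
    have h6 : 2 * C * (F₀.card : ℝ) ≠ 0 := by positivity
    rw [hμ, mul_inv_cancel_left₀ h6]
  have h6 : (1 : ℝ) ≤ F₀.card := by
    exact_mod_cast Finset.card_pos.2 ⟨0, h0⟩
  rw [h5] at h4
  have : C * μ ≤ C * μ * F₀.card := le_mul_of_one_le_right (mul_nonneg hC.le hμ0) h6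
  linarith

/-! ### The behaviour of the inverted function at the origin -/

lemma exists_upperJet_quadratic {X : E n → ℝ} (hX : IsQuad X) (c : ℝ) (a x : E n) :
    ∃ p, UpperJet (fun z => c + ⟪a, z⟫ + X z / 2) x p X := by
  obtain ⟨T, hT⟩ := hX
  refine ⟨a + (1 / 2 : ℝ) • (T x + ContinuousLinearMap.adjoint T x), ?_⟩
  refine .of_eq ⟨T, hT⟩ fun h => ?_
  simp only [hT, map_add, inner_add_left, inner_add_right, real_inner_smul_left,
    ContinuousLinearMap.adjoint_inner_left]
  rw [real_inner_comm x (T h)]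
  ring

/-- The equation for a supersolution which is touched from above by a multiple of `P`. -/
lemma SuperOn.inClosedCone_of_touch (hΓ : IsAdmissibleCone Γ) {V : Set (E n)} {q P : E n → ℝ}
    (hq : SuperOn Γ V q) {x p : E n} {X : E n → ℝ} (hx : x ∈ V) (hP : UpperJet P x p X) {M : ℝ}
    (hM : 0 < M) (he : q x = M * P x) (hle : ∀ᶠ z in 𝓝 x, q z ≤ M * P z) :
    InClosedCone Γ fun h => P x * X h := by
  refine (hq x hx _ _ ((hP.const_mul hM).of_le he hle)).of_mul hΓ (t := (M ^ 2)⁻¹)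
    (by positivity) fun h => ?_
  rw [inv_mul_le_iff₀ (by positivity), he]
  have : 0 ≤ ‖M • p‖ ^ 2 / 2 * ‖h‖ ^ 2 := by positivity
  linarith

/-- Comparison on a punctured ball with a function which can not touch from above. -/
lemma le_of_no_touch {Q P : E n → ℝ} {r : ℝ} (hQ : ContinuousOn Q {0}ᶜ)
    (hQpos : ∀ x ≠ 0, 0 < Q x) (hP : ContinuousOn P (closedBall 0 r \ {0}))
    (hPpos : ∀ x ∈ closedBall 0 r \ {0}, 0 < P x) (hsphere : ∀ x ∈ sphere 0 r, Q x ≤ P x)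
    (hzero : ∀ ε > 0, ∀ᶠ x in 𝓝[≠] 0, Q x ≤ (1 + ε) * P x)
    (htouch : ∀ z ∈ ball 0 r \ {0}, ∀ M > 0, Q z = M * P z → ¬ ∀ᶠ w in 𝓝 z, Q w ≤ M * P w)
    {x : E n} (hx : x ∈ closedBall 0 r \ {0}) : Q x ≤ P x := by
  by_contra! hlt
  have hx0 : x ≠ 0 := hx.2
  have hxr : ‖x‖ ≤ r := by simpa using hx.1
  have hr : 0 < r := (norm_pos_iff.2 hx0).trans_le hxr
  have hPx := hPpos x hx
  obtain ⟨ε, hε, hεx⟩ : ∃ ε > 0, 1 + ε < Q x / P x := by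
    have : 1 < Q x / P x := (one_lt_div hPx).2 hlt
    exact ⟨(Q x / P x - 1) / 2, by linarith, by linarith⟩
  obtain ⟨σ, hσ, hσQ⟩ := Metric.mem_nhdsWithin_iff.1 (hzero ε hε)
  have hσx : σ ≤ ‖x‖ := by
    by_contra! h
    have h1 : Q x ≤ (1 + ε) * P x := hσQ ⟨by simpa using h, hx0⟩
    rw [lt_div_iff₀ hPx] at hεx
    linarith
  obtain ⟨hcomp, hopen⟩ := annulus_facts (0 : E n) ((σ / 2) ^ 2) (r ^ 2)
  have hsub : {z : E n | (σ / 2) ^ 2 ≤ ‖z - 0‖ ^ 2 ∧ ‖z - 0‖ ^ 2 ≤ r ^ 2}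
      ⊆ closedBall 0 r \ {0} := by
    rintro z ⟨h1, h2⟩
    rw [sub_zero] at h1 h2
    constructor
    · rw [mem_closedBall_zero_iff]
      exact (sq_le_sq₀ (norm_nonneg _) hr.le).1 h2
    · rintro rfl
      rw [norm_zero] at h1
      nlinarith
  obtain ⟨z, hz, hcz, hmax⟩ := exists_interior_max hcomp (f := fun z => Q z / P z)
    (Ω := {z : E n | (σ / 2) ^ 2 < ‖z - 0‖ ^ 2 ∧ ‖z - 0‖ ^ 2 < r ^ 2}) (c := 1 + ε) (x := x)
    ((hQ.mono fun z hz => (hsub hz).2).div (hP.mono hsub) fun z hz => (hPpos z (hsub hz)).ne')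
    (by
      rintro z ⟨hzK, hzΩ⟩
      have hPz := hPpos z (hsub hzK)
      have hor : ‖z - 0‖ ^ 2 = (σ / 2) ^ 2 ∨ ‖z - 0‖ ^ 2 = r ^ 2 := by
        by_contra! h
        exact hzΩ ⟨lt_of_le_of_ne hzK.1 h.1.symm, lt_of_le_of_ne hzK.2 h.2⟩
      rw [sub_zero] at hor
      rw [div_le_iff₀ hPz]
      rcases hor with h | h
      · have : ‖z‖ = σ / 2 := (sq_eq_sq₀ (norm_nonneg _) (by positivity)).1 h
        refine hσQ ⟨?_, (hsub hzK).2⟩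
        rw [mem_ball_zero_iff, this]
        linarith
      · have : ‖z‖ = r := (sq_eq_sq₀ (norm_nonneg _) hr.le).1 h
        have := hsphere z (by simpa using this)
        nlinarith)
    ⟨by rw [sub_zero]; gcongr; linarith, by rw [sub_zero]; gcongr⟩ hεx
  have hzK := hsub ⟨hz.1.le, hz.2.le⟩
  have hPz := hPpos z hzK
  refine htouch z ⟨?_, hzK.2⟩ (Q z / P z) (div_pos (hQpos z hzK.2) hPz) ?_ ?_
  · rw [mem_ball_zero_iff]
    have := hz.2
    rw [sub_zero] at this
    exact (sq_lt_sq₀ (norm_nonneg _) hr.le).1 this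
  · rw [div_mul_cancel₀ _ hPz.ne']
  · filter_upwards [hopen.mem_nhds hz] with w hw
    have hPw := hPpos w (hsub ⟨hw.1.le, hw.2.le⟩)
    exact (div_le_iff₀ hPw).1 (hmax w ⟨hw.1.le, hw.2.le⟩)

section Projection

variable (U : Submodule ℝ (E n))

lemma norm_sq_eq_projections (h : E n) :
    ‖h‖ ^ 2 = ‖U.starProjection h‖ ^ 2 + ‖h - U.starProjection h‖ ^ 2 := by
  have := Submodule.norm_sq_eq_add_norm_sq_starProjection h U
  rwa [Submodule.starProjection_orthogonal_val] at this

lemma isQuad_projection : IsQuad fun h => ‖U.starProjection h‖ ^ 2 :=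
  isQuad_normSq.comp U.starProjection

lemma isQuad_sub_projection : IsQuad fun h => ‖h - U.starProjection h‖ ^ 2 :=
  isQuad_normSq.comp (ContinuousLinearMap.id ℝ (E n) - U.starProjection)

end Projection

/-- A function with a concave kink along `U` lies below one with a kink in all directions, unless
the form which is slightly positive on `Uᗮ` and negative on `U` belongs to the cone. The reason is
that quadratic polynomials with Hessian of that type are then barriers. -/
lemma exists_kink (hΓ : IsAdmissibleCone Γ) {Q : E n → ℝ} (hQ : ContinuousOn Q {0}ᶜ)
    (hQpos : ∀ x ≠ 0, 0 < Q x) (hsup : SuperOn Γ {0}ᶜ Q) {U : Submodule ℝ (E n)} {G : E n} {c : ℝ}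
    (hc : 0 < c) (hB : ∀ κ > 0, ∀ᶠ x in 𝓝[≠] (0 : E n),
      Q x ≤ 1 + ⟪G, x⟫ - c * ‖U.starProjection x‖ + κ * ‖x‖) {b : ℝ} (hb : 0 < b)
    (hcone : ¬ InCone Γ fun h => b * ‖h - U.starProjection h‖ ^ 2 - ‖U.starProjection h‖ ^ 2) :
    ∃ η > 0, ∃ r > 0, ∀ x ≠ 0, ‖x‖ ≤ r → Q x ≤ 1 + ⟪G, x⟫ - η * ‖x‖ := by
  -- with `κ ρ = c / 3`, the polynomial `1 + ⟨G, x⟩ + Y x / 2` exceeds the bound `hB` on the sphere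
  -- of radius `ρ` by a multiple of `c₁ ρ`, which leaves room for tilting it by `e`
  set c₁ := min (c / 2) (c * b / 12) with hc₁
  have hc₁0 : 0 < c₁ := by positivity
  have hPn : ∀ h, ‖U.starProjection h‖ ≤ ‖h‖ := U.norm_starProjection_apply_le
  obtain ⟨ρ₀, hρ₀, hρB⟩ := Metric.mem_nhdsWithin_iff.1 (hB (c₁ / 4) (by positivity))
  set W := ‖G‖ + c₁ + c * (b + 6) with hW
  have hW0 : 0 < W := by positivity
  set ρ := min (ρ₀ / 2) (1 / (2 * W)) with hρ
  have hρ0 : 0 < ρ := by positivity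
  have hρρ₀ : ρ < ρ₀ := (min_le_left _ _).trans_lt (by linarith)
  have hρW : W * ρ ≤ 1 / 2 := by
    calc W * ρ ≤ W * (1 / (2 * W)) := by gcongr; exact min_le_right _ _
      _ = 1 / 2 := by field_simp
  set κ := c / 3 / ρ with hκ
  have hκ0 : 0 < κ := by positivity
  have hκρ : κ * ρ = c / 3 := by rw [hκ]; field_simp
  let Y : E n → ℝ := fun h => κ * (b / 2 * ‖h - U.starProjection h‖ ^ 2
    + -(3 * ‖U.starProjection h‖ ^ 2))
  have hYq : IsQuad Y := (((isQuad_sub_projection U).const_mul (b / 2)).add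
    ((isQuad_projection U).const_mul 3).neg).const_mul κ
  have hYle : ∀ x, Y x ≤ κ * (b / 2 * ‖x‖ ^ 2) := fun x => by
    refine mul_le_mul_of_nonneg_left ?_ hκ0.le
    nlinarith [norm_sq_eq_projections U x, sq_nonneg ‖U.starProjection x‖]
  have hYabs : ∀ x, |Y x| ≤ κ * ((b / 2 + 3) * ‖x‖ ^ 2) := fun x => by
    have h1 := norm_sq_eq_projections U x
    have h2 := sq_nonneg ‖U.starProjection x‖
    have h3 := sq_nonneg ‖x - U.starProjection x‖
    rw [abs_mul, abs_of_pos hκ0]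
    refine mul_le_mul_of_nonneg_left (abs_le.2 ⟨?_, ?_⟩) hκ0.le <;> nlinarith
  have hYc : Continuous Y := by
    obtain ⟨T, hT⟩ := hYq
    rw [show Y = fun h => ⟪T h, h⟫ from funext hT]
    fun_prop
  have key : ∀ e : E n, ‖e‖ ≤ c₁ / 4 → ∀ x ∈ closedBall (0 : E n) ρ \ {0},
      Q x ≤ 1 + ⟪G + e, x⟫ + Y x / 2 := by
    intro e he x hx
    have hrange : ∀ z, ‖z‖ ≤ ρ → |1 + ⟪G + e, z⟫ + Y z / 2 - 1| ≤ 1 / 2 := by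
      intro z hz
      have h1 : |⟪G + e, z⟫| ≤ (‖G‖ + c₁) * ρ := by
        refine (abs_real_inner_le_norm _ _).trans ?_
        gcongr
        exact (norm_add_le _ _).trans (by linarith)
      have h2 : |Y z| ≤ c * (b + 6) * ρ := by
        refine (hYabs z).trans ?_
        calc κ * ((b / 2 + 3) * ‖z‖ ^ 2) ≤ κ * ((b / 2 + 3) * ρ ^ 2) := by gcongr
          _ = κ * ρ * ((b + 6) / 2 * ρ) := by ring
          _ = c * (b + 6) * ρ * (1 / 6) := by rw [hκρ]; ring
          _ ≤ c * (b + 6) * ρ := by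
            have : 0 ≤ c * (b + 6) * ρ := by positivity
            linarith
      have h3 := abs_le.1 h1
      have h4 := abs_le.1 h2
      have h5 : 0 ≤ c * (b + 6) * ρ := by positivity
      have h6 : W * ρ = (‖G‖ + c₁) * ρ + c * (b + 6) * ρ := by rw [hW]; ring
      rw [abs_le]
      constructor <;> linarith
    refine le_of_no_touch (P := fun z => 1 + ⟪G + e, z⟫ + Y z / 2) hQ hQpos (by fun_prop) ?_ ?_ ?_
      ?_ hx
    · intro z hz
      have := (abs_le.1 (hrange z (by simpa using hz.1))).1
      linarith
    · intro z hz
      have hzρ : ‖z‖ = ρ := by simpa using hz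
      have hz0 : z ≠ 0 := by
        rw [← norm_pos_iff, hzρ]
        exact hρ0
      have h1 : Q z ≤ 1 + ⟪G, z⟫ - c * ‖U.starProjection z‖ + c₁ / 4 * ‖z‖ :=
        hρB ⟨by rw [mem_ball_zero_iff, hzρ]; exact hρρ₀, hz0⟩
      have h2 : -(c₁ / 4 * ρ) ≤ ⟪e, z⟫ := by
        have h3 : |⟪e, z⟫| ≤ c₁ / 4 * ρ := by
          refine (abs_real_inner_le_norm _ _).trans ?_
          rw [hzρ]
          gcongr
        exact (abs_le.1 h3).1
      have h4 := norm_sq_eq_projections U z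
      have h5 := hPn z
      simp only [Y]
      rw [inner_add_left]
      rw [hzρ] at h1 h4 h5
      set s := ‖U.starProjection z‖
      set s' := ‖z - U.starProjection z‖
      have hs : 0 ≤ s := norm_nonneg _
      have h6 : (c₁ / 2 * ρ - c * s) * ρ ≤ c / 6 * (b / 2 * s' ^ 2 - 3 * s ^ 2) := by
        have e1 : c₁ * s ^ 2 ≤ c / 2 * s ^ 2 := by gcongr; exact min_le_left _ _
        have e2 : c₁ * s' ^ 2 ≤ c * b / 12 * s' ^ 2 := by gcongr; exact min_le_right _ _
        have e3 : c * (s * s) ≤ c * (s * ρ) := by gcongr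
        have e4 : 0 ≤ c₁ * ρ ^ 2 := by positivity
        have e5 : c₁ * ρ ^ 2 = c₁ * s ^ 2 + c₁ * s' ^ 2 := by rw [h4]; ring
        nlinarith
      have h7 : c₁ / 2 * ρ - c * s ≤ κ * (b / 2 * s' ^ 2 + -(3 * s ^ 2)) / 2 := by
        rw [hκ, ← mul_le_mul_iff_of_pos_right hρ0]
        refine h6.trans (le_of_eq ?_)
        field_simp
        ring
      linarith
    · intro ε hε
      have h1 : ∀ᶠ x in 𝓝[≠] (0 : E n), Q x ≤ 1 + ⟪G, x⟫ + 1 * ‖x‖ := by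
        filter_upwards [hB 1 one_pos] with x hx
        have : 0 ≤ c * ‖U.starProjection x‖ := by positivity
        linarith
      have h2 : ∀ᶠ x in 𝓝 (0 : E n), 1 + ⟪G, x⟫ + 1 * ‖x‖
          < (1 + ε) * (1 + ⟪G + e, x⟫ + Y x / 2) := by
        have hY0 : Y 0 = 0 := by simp [Y]
        have c1 : Continuous fun x : E n => 1 + ⟪G, x⟫ + 1 * ‖x‖ := by fun_prop
        have c2 : Continuous fun x : E n => (1 + ε) * (1 + ⟪G + e, x⟫ + Y x / 2) := by fun_prop
        exact (c1.tendsto 0).eventually_lt (c2.tendsto 0) (by simp [hY0, hε])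
      filter_upwards [h1, eventually_nhdsWithin_of_eventually_nhds h2] with x h3 h4
      exact h3.trans h4.le
    · intro z hz M hM he' hle
      obtain ⟨p, hp⟩ := exists_upperJet_quadratic hYq 1 (G + e) z
      have h1 := hsup.inClosedCone_of_touch hΓ hz.2 hp hM he' hle
      have h2 := abs_le.1 (hrange z (by
        have : ‖z‖ < ρ := by simpa using hz.1
        exact this.le))
      set Pz := 1 + ⟪G + e, z⟫ + Y z / 2
      refine hcone ((h1 (κ * min (b / 4) (1 / 2)) (by positivity)).of_mul hΓ
        (t := κ⁻¹) (by positivity) fun h => ?_)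
      rw [inv_mul_le_iff₀ hκ0]
      have e0 : Pz * Y h + κ * min (b / 4) (1 / 2) * ‖h‖ ^ 2
          = κ * (Pz * (b / 2 * ‖h - U.starProjection h‖ ^ 2
            + -(3 * ‖U.starProjection h‖ ^ 2)) + min (b / 4) (1 / 2) * ‖h‖ ^ 2) := by
        simp only [Y]; ring
      rw [e0]
      refine mul_le_mul_of_nonneg_left ?_ hκ0.le
      rw [norm_sq_eq_projections U h, mul_add (min (b / 4) (1 / 2))]
      have e1 : min (b / 4) (1 / 2) * ‖U.starProjection h‖ ^ 2
          ≤ 1 / 2 * ‖U.starProjection h‖ ^ 2 := by gcongr; exact min_le_right _ _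
      have e2 : min (b / 4) (1 / 2) * ‖h - U.starProjection h‖ ^ 2
          ≤ b / 4 * ‖h - U.starProjection h‖ ^ 2 := by gcongr; exact min_le_left _ _
      have e3 : Pz * (b / 2 * ‖h - U.starProjection h‖ ^ 2)
          ≤ 3 / 2 * (b / 2 * ‖h - U.starProjection h‖ ^ 2) := by gcongr; linarith
      have e4 : 1 / 2 * (3 * ‖U.starProjection h‖ ^ 2)
          ≤ Pz * (3 * ‖U.starProjection h‖ ^ 2) := by gcongr; linarith
      linarith
  refine ⟨c₁ / 8, by positivity, min ρ (c₁ / (2 * κ * b)), by positivity, fun x hx0 hx => ?_⟩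
  have hN : 0 < ‖x‖ := norm_pos_iff.2 hx0
  have h1 := key (-((c₁ / 4 / ‖x‖) • x)) (by
    rw [norm_neg, norm_smul, Real.norm_eq_abs, abs_of_pos (by positivity), div_mul_cancel₀ _ hN.ne'])
    x ⟨by simpa using hx.trans (min_le_left _ _), hx0⟩
  have h2 : ⟪-((c₁ / 4 / ‖x‖) • x), x⟫ = -(c₁ / 4 * ‖x‖) := by
    rw [inner_neg_left, real_inner_smul_left, real_inner_self_eq_norm_sq]
    field_simp
  rw [inner_add_left, h2] at h1
  have h3 : Y x / 2 ≤ c₁ / 8 * ‖x‖ := by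
    have h4 : ‖x‖ * (2 * κ * b) ≤ c₁ := by
      have := hx.trans (min_le_right _ _)
      rwa [le_div_iff₀ (by positivity)] at this
    have h5 := hYle x
    nlinarith
  linarith

/-- A kink in all directions is incompatible with the value `1` as the upper limit at the origin
if `λ* ∉ closure Γ`: the barriers `1 - η r + ⟨G, x⟩ - ε log (|x|² / r²)`, whose Hessian is a
positive multiple of `λ*`, show that the upper limit is at most `1 - η r`. -/
lemma not_kink (hΓ : IsAdmissibleCone Γ) (hn : 0 < n) (hl : lambdaStar n ∉ closure Γ)
    {Q : E n → ℝ} (hQ : ContinuousOn Q {0}ᶜ) (hQpos : ∀ x ≠ 0, 0 < Q x)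
    (hsup : SuperOn Γ {0}ᶜ Q) (hfreq : ∀ b < 1, ∃ᶠ x in 𝓝[≠] (0 : E n), b < Q x) {G : E n}
    {η r : ℝ} (hη : 0 < η) (hr : 0 < r)
    (h : ∀ x ≠ 0, ‖x‖ ≤ r → Q x ≤ 1 + ⟪G, x⟫ - η * ‖x‖) : False := by
  obtain ⟨r, hr, h, hrs⟩ : ∃ r > 0, (∀ x ≠ 0, ‖x‖ ≤ r → Q x ≤ 1 + ⟪G, x⟫ - η * ‖x‖) ∧
      (η + ‖G‖) * r < 1 := by
    refine ⟨min r (1 / (2 * (η + ‖G‖))), by positivity,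
      fun x hx hxr => h x hx (hxr.trans (min_le_left _ _)), ?_⟩
    calc (η + ‖G‖) * min r (1 / (2 * (η + ‖G‖))) ≤ (η + ‖G‖) * (1 / (2 * (η + ‖G‖))) := by
          gcongr; exact min_le_right _ _
      _ = 1 / 2 := by field_simp
      _ < 1 := by norm_num
  have hlow : ∀ x, ‖x‖ ≤ r → 0 < 1 - η * r + ⟪G, x⟫ := fun x hx => by
    have h1 : |⟪G, x⟫| ≤ ‖G‖ * r := (abs_real_inner_le_norm _ _).trans (by gcongr)
    linarith [(abs_le.1 h1).1]
  have key : ∀ ε > 0, ∀ x ∈ closedBall (0 : E n) r \ {0},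
      Q x ≤ (1 - η * r + ⟪G, x⟫) + -(ε * (Real.log (‖x - 0‖ ^ 2) - Real.log (r ^ 2))) := by
    intro ε hε x hx
    have hpos : ∀ z : E n, z ≠ 0 → 0 < ‖z - 0‖ ^ 2 := fun z hz => by
      rw [sub_zero]
      exact pow_pos (norm_pos_iff.2 hz) 2
    have hlog : ∀ z ∈ closedBall (0 : E n) r \ {0},
        0 ≤ -(ε * (Real.log (‖z - 0‖ ^ 2) - Real.log (r ^ 2))) := fun z hz => by
      have h1 : Real.log (‖z - 0‖ ^ 2) ≤ Real.log (r ^ 2) := by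
        refine Real.log_le_log (hpos z hz.2) ?_
        have : ‖z‖ ≤ r := by simpa using hz.1
        rw [sub_zero]
        gcongr
      nlinarith
    refine le_of_no_touch (P := fun z => (1 - η * r + ⟪G, z⟫)
      + -(ε * (Real.log (‖z - 0‖ ^ 2) - Real.log (r ^ 2)))) hQ hQpos ?_ ?_ ?_ ?_ ?_ hx
    · have h1 : ContinuousOn (fun z : E n => ‖z - 0‖ ^ 2) (closedBall 0 r \ {0}) := by fun_prop
      have h2 := h1.log fun z hz => (hpos z hz.2).ne'
      have h3 : ContinuousOn (fun z : E n => 1 - η * r + ⟪G, z⟫) (closedBall 0 r \ {0}) := by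
        fun_prop
      exact h3.add (continuousOn_const.mul (h2.sub continuousOn_const)).neg
    · intro z hz
      have := hlow z (by simpa using hz.1)
      have := hlog z hz
      positivity
    · intro z hz
      have hzr : ‖z‖ = r := by simpa using hz
      have := h z (by rw [← norm_pos_iff, hzr]; exact hr) hzr.le
      rw [sub_zero, hzr, sub_self]
      rw [hzr] at this
      linarith
    · intro ε' hε'
      have ht : Tendsto (fun z : E n => -(ε * (Real.log (‖z - 0‖ ^ 2) - Real.log (r ^ 2))))
          (𝓝[≠] 0) atTop := by
        have h1 : Tendsto (fun z : E n => ‖z - 0‖ ^ 2) (𝓝[≠] 0) (𝓝[>] 0) := by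
          refine tendsto_nhdsWithin_iff.2 ⟨?_, eventually_nhdsWithin_of_forall fun z hz => hpos z hz⟩
          have : Continuous fun z : E n => ‖z - 0‖ ^ 2 := by fun_prop
          simpa using (this.tendsto 0).mono_left (nhdsWithin_le_nhds (s := {0}ᶜ))
        have h2 := (Real.tendsto_log_nhdsGT_zero.comp h1)
        have h3 := (tendsto_atBot_add_const_right _ (-Real.log (r ^ 2)) h2).const_mul_atBot hε
        exact (tendsto_neg_atBot_atTop.comp h3).congr fun z => by
          simp only [Function.comp_apply, sub_eq_add_neg]
      filter_upwards [ht.eventually_ge_atTop (η * r), self_mem_nhdsWithin,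
        eventually_nhdsWithin_of_eventually_nhds (closedBall_mem_nhds (0 : E n) hr)] with z h1 h2 h3
      have h4 : ‖z‖ ≤ r := by simpa using h3
      have h5 := h z h2 h4
      have h6 := hlow z h4
      have h7 : 0 ≤ η * ‖z‖ := by positivity
      have h8 : 0 ≤ η * r := by positivity
      nlinarith
    · intro z hz M hM he hle
      have hs := hpos z hz.2
      set s := ‖z - 0‖ ^ 2 with hsdef
      have hj1 : UpperJet (fun z => 1 - η * r + ⟪G, z⟫) z G fun _ => 0 := upperJet_inner z G _
      have hd1 : ∀ t ≠ 0, HasDerivAt (fun t => -(ε * (Real.log t - Real.log (r ^ 2))))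
          (-(ε * t⁻¹)) t := fun t ht =>
        (((Real.hasDerivAt_log ht).sub_const _).const_mul ε).neg
      have hd2 : HasDerivAt (fun t : ℝ => -(ε * t⁻¹)) (ε / s ^ 2) s :=
        ((hasDerivAt_inv hs.ne').const_mul ε).neg.congr_deriv (by field_simp)
      have hj2 := upperJet_radial (x := z) (y := 0)
        (eventually_of_mem (isOpen_ne.mem_nhds hs.ne') hd1) hd2
      have h1 := hsup.inClosedCone_of_touch hΓ hz.2 (hj1.add hj2) hM he hle
      have hP : 0 < (1 - η * r + ⟪G, z⟫) + -(ε * (Real.log s - Real.log (r ^ 2))) := by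
        have hz' : z ∈ closedBall (0 : E n) r \ {0} := ⟨ball_subset_closedBall hz.1, hz.2⟩
        have := hlow z (by simpa using hz'.1)
        have := hlog z hz'
        positivity
      set Pz := (1 - η * r + ⟪G, z⟫) + -(ε * (Real.log s - Real.log (r ^ 2)))
      have h2 : InClosedCone Γ (fun h => (-1) * ‖h‖ ^ 2 + (2 / s) * ⟪z - 0, h⟫ ^ 2) := by
        refine h1.of_mul hΓ (t := (Pz * (2 * ε / s))⁻¹) (by positivity) fun h => le_of_eq ?_
        rw [inv_mul_eq_iff_eq_mul₀ (by positivity), ← hsdef]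
        field_simp
        ring
      rw [inClosedCone_rankOne_iff hΓ hn (sub_ne_zero.2 hz.2), ← hsdef,
        div_mul_cancel₀ _ hs.ne'] at h2
      refine hl ?_
      convert h2 using 1
      funext i
      simp only [lambdaStar]
      norm_num
  -- the logarithm is removed by `ε → 0`
  have key' : ∀ x ≠ 0, ‖x‖ ≤ r → Q x ≤ 1 - η * r + ⟪G, x⟫ := by
    intro x hx hxr
    refine le_of_forall_pos_le_add fun δ hδ => ?_
    set A := -(Real.log (‖x - 0‖ ^ 2) - Real.log (r ^ 2)) with hA
    refine (key (δ / (|A| + 1)) (by positivity) x ⟨by simpa using hxr, hx⟩).trans ?_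
    have h1 : δ / (|A| + 1) * A ≤ δ := by
      rw [div_mul_eq_mul_div, div_le_iff₀ (by positivity)]
      nlinarith [le_abs_self A]
    have h2 : -(δ / (|A| + 1) * (Real.log (‖x - 0‖ ^ 2) - Real.log (r ^ 2)))
        = δ / (|A| + 1) * A := by rw [hA]; ring
    rw [h2]
    linarith
  have hηr : 0 < η * r := by positivity
  refine hfreq (1 - η * r / 2) (by linarith) ?_
  have hc : Continuous fun x : E n => 1 - η * r + ⟪G, x⟫ := by fun_prop
  filter_upwards [self_mem_nhdsWithin,
    eventually_nhdsWithin_of_eventually_nhds (closedBall_mem_nhds (0 : E n) hr),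
    eventually_nhdsWithin_of_eventually_nhds ((hc.tendsto 0).eventually
      (Iio_mem_nhds (show 1 - η * r + ⟪G, (0 : E n)⟫ < 1 - η * r / 2 by simp; linarith)))]
    with x h1 h2 h3
  exact not_lt.2 ((key' x h1 (by simpa using h2)).trans (le_of_lt h3))

/-! ### Quadratic growth -/

lemma norm_inversion {z : E n} (hz : z ≠ 0) : ‖(1 / ‖z‖ ^ 2) • z‖ = ‖z‖⁻¹ := by
  have : 0 < ‖z‖ := norm_pos_iff.2 hz
  rw [norm_smul, Real.norm_eq_abs, abs_of_nonneg (by positivity)]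
  field_simp

lemma tendsto_inversion_zero :
    Tendsto (fun z : E n => (1 / ‖z‖ ^ 2) • z) (𝓝[≠] 0) (Bornology.cobounded (E n)) := by
  rw [← tendsto_norm_atTop_iff_cobounded]
  have h1 : Tendsto (fun z : E n => ‖z‖⁻¹) (𝓝[≠] 0) atTop :=
    tendsto_inv_nhdsGT_zero.comp tendsto_norm_nhdsNE_zero
  exact h1.congr' (eventually_nhdsWithin_of_forall fun z hz => (norm_inversion hz).symm)

lemma tendsto_inversion_cobounded :
    Tendsto (fun z : E n => (1 / ‖z‖ ^ 2) • z) (Bornology.cobounded (E n)) (𝓝[≠] 0) := by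
  have hne : ∀ᶠ z in Bornology.cobounded (E n), z ≠ 0 :=
    (tendsto_norm_cobounded_atTop.eventually_gt_atTop 0).mono fun z hz => norm_pos_iff.1 hz
  refine tendsto_nhdsWithin_iff.2 ⟨?_, ?_⟩
  · rw [tendsto_zero_iff_norm_tendsto_zero]
    exact (tendsto_inv_atTop_zero.comp tendsto_norm_cobounded_atTop).congr'
      (hne.mono fun z hz => (norm_inversion hz).symm)
  · filter_upwards [hne] with z hz
    have : 0 < ‖z‖ := norm_pos_iff.2 hz
    exact smul_ne_zero (by positivity) hz

/-- The moving spheres bound every `q` of growth `|z|²` at infinity by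
`|w|² + ⟨G, w⟩ + o(|w|)`, for every supergradient `G` of `q - |·|²`. -/
lemma eventually_le_of_supergradient (hΓ : IsAdmissibleCone Γ) {q : E n → ℝ} (hc : Continuous q)
    (hpos : ∀ x, 0 < q x) (hsup : SuperOn Γ univ q) (hsub : SubOn Γ univ q)
    (hβ : ∀ ε > 0, ∀ᶠ z in Bornology.cobounded (E n), q z ≤ (1 + ε) * ‖z‖ ^ 2) {y G : E n}
    (hG : IsSupergradient (fun z => q z - ‖z‖ ^ 2) y G) {κ : ℝ} (hκ : 0 < κ) :
    ∀ᶠ w in Bornology.cobounded (E n), q w ≤ ‖w‖ ^ 2 + ⟪G, w⟫ + κ * ‖w‖ := by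
  set a := q y with ha
  have ha0 : 0 < a := hpos y
  have hζ : Tendsto (fun w : E n => w - y) (Bornology.cobounded (E n))
      (Bornology.cobounded (E n)) := by
    rw [← tendsto_norm_atTop_iff_cobounded]
    refine tendsto_atTop_mono (fun w => norm_sub_norm_le w y) ?_
    exact tendsto_atTop_add_const_right _ (-‖y‖) tendsto_norm_cobounded_atTop
  -- the point which is symmetric to `w`
  let x : E n → E n := fun w => y + a • ((1 / ‖w - y‖ ^ 2) • (w - y))
  have hx : Tendsto x (Bornology.cobounded (E n)) (𝓝 y) := by
    have h1 := ((tendsto_nhds_of_tendsto_nhdsWithin tendsto_inversion_cobounded).comp hζ).const_smul a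
    have h2 := h1.const_add y
    rw [smul_zero, add_zero] at h2
    exact h2
  have hnear : ∀ᶠ z in 𝓝 y, κ / 4 * ‖z - y‖ + ‖z - y‖ ^ 2 ≤ κ / 2 * ‖z - y‖ := by
    filter_upwards [ball_mem_nhds y (show 0 < κ / 4 by positivity)] with z hz
    rw [mem_ball, dist_eq_norm] at hz
    nlinarith [norm_nonneg (z - y)]
  have hsmall : ∀ᶠ w in Bornology.cobounded (E n),
      ‖y‖ ^ 2 + |⟪G + (2 : ℝ) • y, y⟫| + κ / 2 * ‖y‖ ≤ κ / 2 * ‖w‖ :=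
    (tendsto_norm_cobounded_atTop.const_mul_atTop (show 0 < κ / 2 by positivity)).eventually_ge_atTop
      _
  have hlarge : ∀ᶠ w in Bornology.cobounded (E n), √a < ‖w - y‖ :=
    (tendsto_norm_cobounded_atTop.comp hζ).eventually_gt_atTop _
  filter_upwards [hx.eventually (hG (κ / 4) (by positivity)), hx.eventually hnear, hsmall, hlarge]
    with w h1 h2 h3 h4
  have hN : 0 < ‖w - y‖ := (Real.sqrt_nonneg a).trans_lt h4
  have hN2 : a < ‖w - y‖ ^ 2 := (Real.sqrt_lt' hN).1 h4
  set s := ‖w - y‖ ^ 2 with hs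
  have hs0 : 0 < s := by positivity
  have hxw : x w = y + (a / s) • (w - y) := by
    simp only [x]
    rw [smul_smul, mul_one_div]
  have hv : x w - y = (a / s) • (w - y) := by rw [hxw, add_sub_cancel_left]
  have hvn2 : ‖x w - y‖ ^ 2 = a ^ 2 / s := by
    rw [hv, norm_smul, mul_pow, Real.norm_eq_abs, sq_abs, ← hs]
    field_simp
  have hvn : ‖x w - y‖ = a / s * ‖w - y‖ := by
    rw [hv, norm_smul, Real.norm_eq_abs, abs_of_pos (by positivity)]
  have hwy : w - y ≠ 0 := norm_pos_iff.1 hN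
  have h5 : q w = s / a * kelvin y a q (x w) := by
    have := kelvin_eq (y := y) ha0 hwy q
    rwa [add_sub_cancel, ← hs, ← hxw] at this
  have h6 : kelvin y a q (x w) ≤ q (x w) := by
    refine kelvin_le hΓ hc hpos hsup hsub zero_le_one hβ ha0 (by rw [one_mul]) ?_ ?_
    · rw [← sub_ne_zero, hv]
      exact smul_ne_zero (by positivity) hwy
    · rw [hvn2, div_le_iff₀ hs0]
      nlinarith
  have h7 : ‖x w‖ ^ 2 = ‖y‖ ^ 2 + 2 * ⟪y, x w - y⟫ + ‖x w - y‖ ^ 2 := by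
    rw [← norm_add_sq_real, add_sub_cancel]
  have h8 : q (x w) ≤ a + ⟪G + (2 : ℝ) • y, x w - y⟫ + κ / 2 * ‖x w - y‖ := by
    rw [inner_add_left, real_inner_smul_left]
    linarith
  have h9 : q w ≤ s + ⟪G + (2 : ℝ) • y, w - y⟫ + κ / 2 * ‖w - y‖ := by
    rw [h5]
    refine (mul_le_mul_of_nonneg_left (h6.trans h8) (by positivity)).trans (le_of_eq ?_)
    rw [hvn, hv, real_inner_smul_right]
    field_simp
  have h10 : s = ‖w‖ ^ 2 - 2 * ⟪y, w⟫ + ‖y‖ ^ 2 := by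
    rw [hs, norm_sub_sq_real, real_inner_comm]
  have h11 : ⟪G + (2 : ℝ) • y, w - y⟫ = ⟪G, w⟫ + 2 * ⟪y, w⟫ - ⟪G + (2 : ℝ) • y, y⟫ := by
    rw [inner_sub_right, inner_add_left, real_inner_smul_left]
  have h12 : κ / 2 * ‖w - y‖ ≤ κ / 2 * (‖w‖ + ‖y‖) := by gcongr; exact norm_sub_le _ _
  have h13 := neg_abs_le ⟪G + (2 : ℝ) • y, y⟫
  rw [h10, h11] at h9
  linarith

/-- If `q - |·|²` is affine in the directions orthogonal to `U`, then `q` can be touched from below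
by functions whose Hessian is positive on `Uᗮ`. -/
lemma not_subOn_of_affine (hΓ : IsAdmissibleCone Γ) {q : E n → ℝ} (hc : Continuous q)
    (hpos : ∀ x, 0 < q x) (hsub : SubOn Γ univ q) {U : Submodule ℝ (E n)} {G : E n}
    (hN : ∀ y, ∀ e ∈ Uᗮ, q (y + e) - ‖y + e‖ ^ 2 = q y - ‖y‖ ^ 2 + ⟪G, e⟫)
    (hcone : ∀ b > 0, InCone Γ fun h =>
      b * ‖h - U.starProjection h‖ ^ 2 - ‖U.starProjection h‖ ^ 2) : False := by
  let P : E n →L[ℝ] E n := U.starProjection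
  have hPP : ∀ x, P (P x) = P x := fun x =>
    Submodule.starProjection_eq_self_iff.2 (U.starProjection_apply_mem x)
  have hperp : ∀ x, x - P x ∈ Uᗮ := fun x => U.sub_starProjection_mem_orthogonal x
  have hzero : ∀ e ∈ Uᗮ, P e = 0 := fun e he => (U.starProjection_apply_eq_zero_iff).2 he
  have hin : ∀ x, ∀ e ∈ Uᗮ, ⟪P x, e⟫ = 0 := fun x e he =>
    Submodule.inner_right_of_mem_orthogonal (U.starProjection_apply_mem x) he
  have hPn : ∀ h, ‖P h‖ ≤ ‖h‖ := U.norm_starProjection_apply_le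
  set γ := G - P G with hγ
  have hγU : γ ∈ Uᗮ := hperp G
  have hGe : ∀ e ∈ Uᗮ, ⟪G, e⟫ = ⟪γ, e⟫ := fun e he => by
    rw [hγ, inner_sub_left, hin G e he, sub_zero]
  -- `q` in terms of its restriction to an affine subspace parallel to `U`
  have hq : ∀ y, q y = q (P y - (1 / 2 : ℝ) • γ) + ‖y - P y + (1 / 2 : ℝ) • γ‖ ^ 2 := by
    intro y
    have hmem : y - P y + (1 / 2 : ℝ) • γ ∈ Uᗮ :=
      Submodule.add_mem _ (hperp y) (Submodule.smul_mem _ _ hγU)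
    have h1 := hN (P y - (1 / 2 : ℝ) • γ) _ hmem
    have e1 : P y - (1 / 2 : ℝ) • γ + (y - P y + (1 / 2 : ℝ) • γ) = y := by abel
    rw [e1, hGe _ hmem] at h1
    have h2 : ‖y‖ ^ 2 = ‖P y - (1 / 2 : ℝ) • γ‖ ^ 2
        + 2 * ⟪P y - (1 / 2 : ℝ) • γ, y - P y + (1 / 2 : ℝ) • γ⟫
        + ‖y - P y + (1 / 2 : ℝ) • γ‖ ^ 2 := by
      rw [← norm_add_sq_real, e1]
    rw [inner_sub_left, hin y _ hmem, real_inner_smul_left] at h2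
    linarith
  let qP : E n → ℝ := fun y => q (P y - (1 / 2 : ℝ) • γ)
  have hqPc : Continuous qP := by fun_prop
  -- `q` is touched from below by `t (A - |P y|²)² + |y - P y + γ / 2|²` with the largest possible
  -- `t`; the choice of `A` makes the slope of this function small compared to its value
  set A := 8 * qP 0 with hA
  have hA0 : 0 < A := by have := hpos (P 0 - (1 / 2 : ℝ) • γ); positivity
  obtain ⟨z, hz, hmax⟩ := (isCompact_closedBall (0 : E n) (√A)).exists_isMaxOn ⟨0, by simp⟩
    (f := fun y => (A - ‖P y‖ ^ 2) ^ 2 / qP y)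
    (Continuous.continuousOn (Continuous.div (by fun_prop) hqPc fun y => (hpos _).ne'))
  have hball : ∀ y, y ∈ closedBall (0 : E n) (√A) ↔ ‖y‖ ^ 2 ≤ A := fun y => by
    rw [mem_closedBall_zero_iff, Real.le_sqrt (norm_nonneg _) hA0.le]
  set M := (A - ‖P z‖ ^ 2) ^ 2 / qP z with hM
  have hM0 : A ^ 2 / qP 0 ≤ M := by
    have := hmax (show (0 : E n) ∈ closedBall (0 : E n) (√A) by simp)
    simpa using this
  have hqz : 0 < qP z := hpos _
  have hq0 : 0 < qP 0 := hpos _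
  have hMpos : 0 < M := (by positivity : 0 < A ^ 2 / qP 0).trans_le hM0
  have hPz : ‖P z‖ ^ 2 ≤ A := by
    refine le_trans ?_ ((hball z).1 hz)
    have := hPn z
    gcongr
  set w := A - ‖P z‖ ^ 2 with hw
  have hw0 : 0 < w := by
    rcases eq_or_lt_of_le hPz with h | h
    · rw [hM, hw, h] at hMpos
      simp at hMpos
    · rw [hw]; linarith
  set t := M⁻¹ with ht
  have ht0 : 0 < t := by positivity
  have htA : 8 * t * A ≤ 1 := by
    have h1 : t ≤ qP 0 / A ^ 2 := by
      rw [ht, ← inv_div]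
      exact inv_anti₀ (by positivity) hM0
    calc 8 * t * A ≤ 8 * (qP 0 / A ^ 2) * A := by gcongr
      _ = 8 * qP 0 / A := by field_simp
      _ = 1 := by rw [← hA]; exact div_self hA0.ne'
  set x₀ := P z - (1 / 2 : ℝ) • γ with hx₀
  have hPx₀ : P x₀ = P z := by
    rw [hx₀, map_sub, map_smul, hzero γ hγU, hPP, smul_zero, sub_zero]
  have hqx₀ : q x₀ = t * w ^ 2 := by
    have : q x₀ = qP z := rfl
    rw [this, ht, hM, inv_div]
    field_simp
  have hlow : ∀ y, ‖P y‖ ^ 2 ≤ A →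
      t * (A - ‖P y‖ ^ 2) ^ 2 + ‖y - P y + (1 / 2 : ℝ) • γ‖ ^ 2 ≤ q y := by
    intro y hy
    rw [hq y]
    gcongr
    have h1 : (A - ‖P (P y)‖ ^ 2) ^ 2 / qP (P y) ≤ M := hmax ((hball (P y)).2 hy)
    rw [hPP] at h1
    have h2 : 0 < qP (P y) := hpos _
    have h3 : qP (P y) = q (P y - (1 / 2 : ℝ) • γ) := by simp only [qP, hPP]
    rw [div_le_iff₀ h2] at h1
    rw [← h3, ht, inv_mul_le_iff₀ hMpos]
    exact h1
  have hjet : UpperJet (fun y => -q y) x₀ ((4 * t * w) • P z)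
      fun h => 4 * t * w * ‖P h‖ ^ 2 + -(2 * ‖h - P h‖ ^ 2) := by
    refine ⟨((isQuad_projection U).const_mul _).add ((isQuad_sub_projection U).const_mul 2).neg,
      fun κ hκ => ?_⟩
    have hcont : Continuous fun h : E n => ‖P (x₀ + h)‖ ^ 2 := by fun_prop
    have hev : ∀ᶠ h in 𝓝 (0 : E n), ‖P (x₀ + h)‖ ^ 2 < A :=
      (hcont.tendsto 0).eventually (Iio_mem_nhds (by
        rw [add_zero, hPx₀]
        rw [hw] at hw0
        linarith))
    filter_upwards [hev] with h hh
    have h1 := hlow _ hh.le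
    have e1 : ‖P (x₀ + h)‖ ^ 2 = ‖P z‖ ^ 2 + 2 * ⟪P z, h⟫ + ‖P h‖ ^ 2 := by
      rw [map_add, hPx₀, norm_add_sq_real]
      have : ⟪P z, h⟫ = ⟪P z, P h⟫ := by
        have := hin z _ (hperp h)
        rw [inner_sub_right] at this
        linarith
      rw [this]
    have e2 : x₀ + h - P (x₀ + h) + (1 / 2 : ℝ) • γ = h - P h := by
      rw [map_add, hPx₀, hx₀]; abel
    rw [e1, e2] at h1
    have e3 : t * (A - (‖P z‖ ^ 2 + 2 * ⟪P z, h⟫ + ‖P h‖ ^ 2)) ^ 2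
        = t * w ^ 2 - 2 * t * w * (2 * ⟪P z, h⟫ + ‖P h‖ ^ 2)
          + t * (2 * ⟪P z, h⟫ + ‖P h‖ ^ 2) ^ 2 := by rw [hw]; ring
    have h2 : 0 ≤ t * (2 * ⟪P z, h⟫ + ‖P h‖ ^ 2) ^ 2 := by positivity
    have h3 : 0 ≤ κ * ‖h‖ ^ 2 := by positivity
    rw [hqx₀, real_inner_smul_left]
    linarith
  refine hsub x₀ (mem_univ _) _ _ hjet ?_
  set K := 4 * t ^ 2 * w ^ 3 + 8 * t ^ 2 * w ^ 2 * A with hK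
  have hK0 : 0 < K := by positivity
  refine (hcone (t * w ^ 2 / K) (by positivity)).of_mul hΓ hK0 fun h => ?_
  rw [hqx₀, norm_smul, mul_pow, Real.norm_eq_abs, sq_abs, norm_sq_eq_projections U h]
  have e1 : K * (t * w ^ 2 / K * ‖h - U.starProjection h‖ ^ 2 - ‖U.starProjection h‖ ^ 2)
      = t * w ^ 2 * ‖h - U.starProjection h‖ ^ 2 - K * ‖U.starProjection h‖ ^ 2 := by
    field_simp
  rw [e1]
  change t * w ^ 2 * ‖h - P h‖ ^ 2 - K * ‖P h‖ ^ 2 ≤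
    -(t * w ^ 2) * (4 * t * w * ‖P h‖ ^ 2 + -(2 * ‖h - P h‖ ^ 2))
      - (4 * t * w) ^ 2 * ‖P z‖ ^ 2 / 2 * (‖P h‖ ^ 2 + ‖h - P h‖ ^ 2)
  have h1 : 8 * t * ‖P z‖ ^ 2 ≤ 1 := le_trans (by gcongr) htA
  have h2 : t * w ^ 2 * (8 * t * ‖P z‖ ^ 2) * ‖h - P h‖ ^ 2 ≤ t * w ^ 2 * 1 * ‖h - P h‖ ^ 2 := by
    gcongr
  have h3 : 8 * t ^ 2 * w ^ 2 * ‖P z‖ ^ 2 * ‖P h‖ ^ 2 ≤ 8 * t ^ 2 * w ^ 2 * A * ‖P h‖ ^ 2 := by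
    gcongr
  rw [hK]
  nlinarith

/-- If `λ* ∉ closure Γ`, solutions do not grow quadratically. Let `U` be spanned by the differences
of supergradients of `q - |·|²`. The inverted function has a concave kink along `U`, so that forms
which are slightly positive on `Uᗮ` and negative on `U` belong to the cone; on the other hand
`q - |·|²` is affine along `Uᗮ`, so that `q` can be touched from below by functions with Hessians of
this type. -/
theorem not_quadratic_growth (hΓ : IsAdmissibleCone Γ) (hn : 0 < n) (hl : lambdaStar n ∉ closure Γ)
    {q : E n → ℝ} (hc : Continuous q) (hpos : ∀ x, 0 < q x) (hsup : SuperOn Γ univ q)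
    (hsub : SubOn Γ univ q)
    (hβ : ∀ ε > 0, ∀ᶠ z in Bornology.cobounded (E n), q z ≤ (1 + ε) * ‖z‖ ^ 2)
    (hβ' : ∀ b < 1, ∃ᶠ z in Bornology.cobounded (E n), b * ‖z‖ ^ 2 < q z) : False := by
  have hNc : Continuous fun z => q z - ‖z‖ ^ 2 := by fun_prop
  let 𝒢 : Set (E n) := {G | ∃ y, IsSupergradient (fun z => q z - ‖z‖ ^ 2) y G}
  obtain ⟨G₀, hG₀⟩ : 𝒢.Nonempty := by
    obtain ⟨y, G, h⟩ := exists_supergradient hn hNc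
    exact ⟨G, y, h⟩
  set U := Submodule.span ℝ ((fun G => G - G₀) '' 𝒢) with hU
  obtain ⟨F, G, c, hF, hc0, hFx⟩ := exists_center hG₀ hU
  set Q := kelvin 0 1 q with hQ
  have hQx : ∀ x, Q x = ‖x‖ ^ 2 * q ((1 / ‖x‖ ^ 2) • x) := fun x => by simp [hQ, kelvin]
  have hfreq : ∀ b < 1, ∃ᶠ x in 𝓝[≠] (0 : E n), b < Q x := by
    intro b hb
    have hne : ∀ᶠ z in Bornology.cobounded (E n), z ≠ 0 :=
      (tendsto_norm_cobounded_atTop.eventually_gt_atTop 0).mono fun z hz => norm_pos_iff.1 hz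
    refine tendsto_inversion_cobounded.frequently (((hβ' b hb).and_eventually hne).mono ?_)
    rintro z ⟨h1, h2⟩
    have : 0 < ‖z‖ := norm_pos_iff.2 h2
    rw [eq_kelvin_zero q h2, mul_comm] at h1
    exact lt_of_mul_lt_mul_left h1 (by positivity)
  have hB : ∀ κ > 0, ∀ᶠ x in 𝓝[≠] (0 : E n),
      Q x ≤ 1 + ⟪G, x⟫ - c * ‖U.starProjection x‖ + κ * ‖x‖ := by
    intro κ hκ
    have h1 : ∀ᶠ w in Bornology.cobounded (E n), ∀ G' ∈ F,
        q w ≤ ‖w‖ ^ 2 + ⟪G', w⟫ + κ * ‖w‖ := by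
      rw [Finset.eventually_all]
      intro G' hG'
      obtain ⟨y, hy⟩ := hF hG'
      exact eventually_le_of_supergradient hΓ hc hpos hsup hsub hβ hy hκ
    filter_upwards [tendsto_inversion_zero.eventually h1, self_mem_nhdsWithin] with x hx hx0
    have hN : 0 < ‖x‖ := norm_pos_iff.2 hx0
    obtain ⟨G', hG', hle⟩ := hFx x
    have h2 := mul_le_mul_of_nonneg_left (hx G' hG') (sq_nonneg ‖x‖)
    rw [norm_inversion hx0, real_inner_smul_right] at h2
    rw [hQx]
    refine h2.trans ?_
    rw [inner_sub_left] at hle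
    have e : ‖x‖ ^ 2 * (‖x‖⁻¹ ^ 2 + 1 / ‖x‖ ^ 2 * ⟪G', x⟫ + κ * ‖x‖⁻¹)
        = 1 + ⟪G', x⟫ + κ * ‖x‖ := by field_simp
    rw [e]
    linarith
  have hQc := continuousOn_kelvin hc 0 1
  have hQpos : ∀ x ≠ 0, 0 < Q x := fun x hx => kelvin_pos hpos one_pos hx
  have hQsup := hsup.kelvin (y := 0) one_pos
  refine not_subOn_of_affine hΓ hc hpos hsub (U := U) (G := G₀) (fun y e he => ?_) fun b hb => ?_
  · rcases eq_or_ne e 0 with rfl | he0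
    · simp
    refine add_eq_of_supergradient hNc he0 (fun y G hG => ?_) y
    have h1 : G - G₀ ∈ U := Submodule.subset_span ⟨G, ⟨y, hG⟩, rfl⟩
    have h2 := Submodule.inner_right_of_mem_orthogonal h1 he
    rw [inner_sub_left] at h2
    linarith
  · by_contra hcone
    obtain ⟨η, hη, r, hr, hk⟩ := exists_kink hΓ hQc hQpos hQsup hc0 hB hb hcone
    exact not_kink hΓ hn hl hQc hQpos hQsup hfreq hη hr hk

lemma SuperOn.const_mul (hΓ : IsAdmissibleCone Γ) {V : Set (E n)} {q : E n → ℝ}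
    (hq : SuperOn Γ V q) {c : ℝ} (hc : 0 < c) : SuperOn Γ V fun x => c * q x := by
  intro x hx p X hj
  have h1 := hj.const_mul (inv_pos.2 hc)
  simp only [inv_mul_cancel_left₀ hc.ne'] at h1
  refine (hq x hx _ _ h1).of_mul hΓ (t := c ^ 2) (by positivity) fun h => le_of_eq ?_
  rw [norm_smul, mul_pow, Real.norm_eq_abs, sq_abs]
  field_simp

lemma SubOn.const_mul (hΓ : IsAdmissibleCone Γ) {V : Set (E n)} {q : E n → ℝ}
    (hq : SubOn Γ V q) {c : ℝ} (hc : 0 < c) : SubOn Γ V fun x => c * q x := by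
  intro x hx p X hj hcone
  have h1 := hj.const_mul (inv_pos.2 hc)
  simp only [mul_neg, inv_mul_cancel_left₀ hc.ne'] at h1
  refine hq x hx _ _ h1 (hcone.of_mul hΓ (t := (c ^ 2)⁻¹) (by positivity) fun h => le_of_eq ?_)
  rw [norm_smul, mul_pow, Real.norm_eq_abs, sq_abs]
  field_simp

/-- If `λ* ∉ closure Γ`, positive solutions on `ℝⁿ` are constant. -/
theorem eq_of_lambdaStar_notMem (hΓ : IsAdmissibleCone Γ) (hn : 0 < n)
    (hl : lambdaStar n ∉ closure Γ) {q : E n → ℝ} (hc : Continuous q) (hpos : ∀ x, 0 < q x)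
    (hsup : SuperOn Γ univ q) (hsub : SubOn Γ univ q) (x y : E n) : q y ≤ q x := by
  obtain ⟨β, hβ0, hβ, hβ'⟩ := exists_growth hΓ hn hl hc hpos hsup
  rcases eq_or_lt_of_le hβ0 with rfl | hβp
  · exact eq_of_growth_zero hΓ hc hpos hsup hsub hβ x y
  · exfalso
    have hi : 0 < β⁻¹ := inv_pos.2 hβp
    refine not_quadratic_growth hΓ hn hl (q := fun z => β⁻¹ * q z) (by fun_prop)
      (fun z => mul_pos hi (hpos z)) (hsup.const_mul hΓ hi) (hsub.const_mul hΓ hi)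
      (fun ε hε => ?_) fun b hb => ?_
    · filter_upwards [hβ (β * ε) (by positivity)] with z hz
      rw [inv_mul_le_iff₀ hβp]
      linarith
    · refine (hβ' (β * b) (by nlinarith)).mono fun z hz => ?_
      rw [lt_inv_mul_iff₀ hβp]
      linarith

/-- Entire continuous viscosity solutions are constant if `λ* ∉ ∂Γ`. -/
theorem IsViscositySolution.isConstant (hΓ : IsAdmissibleCone Γ) (hn : 0 < n)
    (hl : lambdaStar n ∉ frontier Γ) {v : E n → ℝ} (hc : Continuous v)
    (hv : IsViscositySolution Γ v) : IsConstant v := by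
  have hqc : Continuous fun x => Real.exp (-v x) := by fun_prop
  have hqpos : ∀ x, 0 < Real.exp (-v x) := fun x => Real.exp_pos _
  have hsup := hv.1.superOn hΓ
  have hsub := hv.2.subOn hΓ
  have hle : ∀ x y, Real.exp (-v y) ≤ Real.exp (-v x) := by
    by_cases h : lambdaStar n ∈ Γ
    · exact hsub.eq_of_lambdaStar_mem hΓ hn h hqc hqpos
    · refine eq_of_lambdaStar_notMem hΓ hn (fun h' => hl ?_) hqc hqpos hsup hsub
      rw [hΓ.isOpen.frontier_eq]
      exact ⟨h', h⟩
  refine ⟨v 0, fun x => ?_⟩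
  have := Real.exp_injective (le_antisymm (hle 0 x) (hle x 0))
  linarith

/-! ### The dual cone -/

/-- The cone `-(ℝⁿ \ closure Γ)`, for which the equation `λ(A[v]) ∈ ∂Γ'` is `λ(-A[v]) ∈ ∂Γ`. -/
def dualCone (Γ : Set (Fin n → ℝ)) : Set (Fin n → ℝ) := {l | -l ∉ closure Γ}

lemma mem_dualCone {l : Fin n → ℝ} : l ∈ dualCone Γ ↔ -l ∉ closure Γ := Iff.rfl

lemma IsAdmissibleCone.dualCone (hΓ : IsAdmissibleCone Γ) : IsAdmissibleCone (dualCone Γ) where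
  nonempty := ⟨fun _ => 1, fun h => hΓ.zero_notMem (by
    have := hΓ.mem_closure_iff.1 h 1 one_pos
    convert this using 1
    funext i
    simp)⟩
  ne_univ := fun h => by
    obtain ⟨l, hl⟩ := hΓ.nonempty
    have h1 : -l ∈ MobiusLiouville.dualCone Γ := by rw [h]; trivial
    rw [mem_dualCone, neg_neg] at h1
    exact h1 (subset_closure hl)
  isOpen := isClosed_closure.isOpen_compl.preimage continuous_neg
  symmetric := fun σ l hl h => hl (hΓ.mem_closure_iff.2 fun ε hε => by
    have := hΓ.symmetric σ⁻¹ _ (hΓ.mem_closure_iff.1 h ε hε)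
    convert this using 1
    funext i
    simp)
  cone := fun t ht l hl h => hl (hΓ.mem_closure_iff.2 fun ε hε => by
    have := hΓ.cone t⁻¹ (inv_pos.2 ht) _ (hΓ.mem_closure_iff.1 h (t * ε) (by positivity))
    convert this using 1
    funext i
    simp only [Pi.neg_apply, Pi.smul_apply, smul_eq_mul]
    field_simp)
  add_posCone := by
    rintro _ ⟨l, hl, m, hm, rfl⟩ h
    refine hl (hΓ.mem_closure_iff.2 fun ε hε => hΓ.mono (hΓ.mem_closure_iff.1 h ε hε) fun i => ?_)
    have : 0 < m i := hm i
    simp only [Pi.neg_apply, Pi.add_apply]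
    linarith

lemma IsAdmissibleCone.mem_closure_dualCone (hΓ : IsAdmissibleCone Γ) {l : Fin n → ℝ} :
    l ∈ closure (MobiusLiouville.dualCone Γ) ↔ -l ∉ Γ := by
  rw [hΓ.dualCone.mem_closure_iff]
  refine ⟨fun h hl => ?_, fun h ε hε hcl => h ?_⟩
  · obtain ⟨ε, hε, h1⟩ := hΓ.exists_sub_mem hl
    refine h ε hε (subset_closure ?_)
    convert h1 using 1
    funext i
    simp only [Pi.neg_apply]
    ring
  · have := hΓ.mem_closure_iff.1 hcl ε hε
    convert this using 1
    funext i
    simp only [Pi.neg_apply]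
    ring

lemma IsAdmissibleCone.mem_frontier_dualCone (hΓ : IsAdmissibleCone Γ) {l : Fin n → ℝ} :
    l ∈ frontier (MobiusLiouville.dualCone Γ) ↔ -l ∈ frontier Γ := by
  rw [hΓ.isOpen.frontier_eq, hΓ.dualCone.isOpen.frontier_eq, Set.mem_sdiff, Set.mem_sdiff,
    hΓ.mem_closure_dualCone, mem_dualCone, not_not, and_comm]

lemma matrixForm_neg_eq {M : Matrix (Fin n) (Fin n) ℝ} (hM : M.IsHermitian) :
    matrixForm (-M) = fun h => ∑ i, (-hM.eigenvalues) i * ⟪hM.eigenvectorBasis i, h⟫ ^ 2 := by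
  funext h
  have h1 : matrixForm (-M) h = -matrixForm M h := by
    simp [matrixForm]
  rw [h1, matrixForm_eq_sum_eigenvalues hM, ← Finset.sum_neg_distrib]
  simp

lemma eigNegA_mem_iff (hΓ : IsAdmissibleCone Γ) {v : E n → ℝ} {x : E n}
    (hv : ContDiffAt ℝ 2 v x) : eigNegA hv ∈ Γ ↔ -eigA hv ∈ Γ := by
  rw [eigNegA, eigenvalues_mem_iff hΓ, matrixForm_neg_eq (mobiusHessian_isHermitian hv),
    inCone_diagonal_iff hΓ, eigA]

lemma eigNegA_mem_closure_iff (hΓ : IsAdmissibleCone Γ) {v : E n → ℝ} {x : E n}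
    (hv : ContDiffAt ℝ 2 v x) : eigNegA hv ∈ closure Γ ↔ -eigA hv ∈ closure Γ := by
  rw [eigNegA, eigenvalues_mem_closure_iff hΓ, matrixForm_neg_eq (mobiusHessian_isHermitian hv),
    inClosedCone_diagonal_iff hΓ, eigA]

lemma isViscositySolutionNeg_iff (hΓ : IsAdmissibleCone Γ) {v : E n → ℝ} :
    IsViscositySolutionNeg Γ v ↔ IsViscositySolution (dualCone Γ) v := by
  rw [IsViscositySolutionNeg, IsViscositySolution, IsViscositySupersolution,
    IsViscositySubsolution, and_comm]
  refine and_congr (and_congr Iff.rfl ?_) (and_congr Iff.rfl ?_)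
  · refine forall₂_congr fun x φ => forall₂_congr fun hφ _ => ?_
    rw [mem_compl_iff, eigNegA_mem_iff hΓ, hΓ.mem_closure_dualCone]
  · refine forall₂_congr fun x φ => forall₂_congr fun hφ _ => ?_
    rw [eigNegA_mem_closure_iff hΓ, mem_compl_iff, mem_dualCone, not_not]

/-! ### Linear solutions -/

/-- First and second order conditions for a function touching a linear function, from below if
`0 < s` and from above if `s < 0`. -/
lemma touch_linear {φ : E n → ℝ} {x : E n} (hφ : ContDiffAt ℝ 2 φ x) (L : E n →L[ℝ] ℝ) {s : ℝ}
    (hs : s ≠ 0) (hx : φ x = L x) (h : ∀ᶠ z in 𝓝 x, s * (φ z - L z) ≤ 0) :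
    fderiv ℝ φ x = L ∧ ∀ e, s * fderiv ℝ (fderiv ℝ φ) x e e ≤ 0 := by
  have hd : DifferentiableAt ℝ φ x := hφ.differentiableAt (by norm_num)
  have h1 : fderiv ℝ φ x = L := by
    have hmax : IsLocalMax (fun z => s * (φ z - L z)) x := by
      filter_upwards [h] with z hz
      rw [hx, sub_self, mul_zero]
      exact hz
    have hd' : HasFDerivAt (fun z => s * (φ z - L z)) (s • (fderiv ℝ φ x - L)) x :=
      (hd.hasFDerivAt.sub L.hasFDerivAt).const_mul s
    have := hmax.hasFDerivAt_eq_zero hd'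
    exact sub_eq_zero.1 ((smul_eq_zero.1 this).resolve_left hs)
  refine ⟨h1, fun e => ?_⟩
  have hline : Continuous fun t : ℝ => x + t • e := by fun_prop
  have hline0 : Tendsto (fun t : ℝ => x + t • e) (𝓝 0) (𝓝 x) := by
    simpa using hline.tendsto 0
  have hlined : ∀ t : ℝ, HasDerivAt (fun t : ℝ => x + t • e) e t := fun t => by
    simpa using ((hasDerivAt_id t).smul_const e).const_add x
  have hdd : ∀ᶠ z in 𝓝 x, DifferentiableAt ℝ φ z := by
    filter_upwards [hφ.eventually (by norm_num)] with z hz using hz.differentiableAt (by norm_num)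
  have hF : ∀ᶠ t in 𝓝 (0 : ℝ), HasDerivAt (fun t : ℝ => s * (φ (x + t • e) - L (x + t • e)))
      (s * (fderiv ℝ φ (x + t • e) e - L e)) t := by
    filter_upwards [hline0.eventually hdd] with t ht
    exact ((ht.hasFDerivAt.comp_hasDerivAt t (hlined t)).sub
      (L.hasFDerivAt.comp_hasDerivAt t (hlined t))).const_mul s
  have hF' : HasDerivAt (fun t : ℝ => s * (fderiv ℝ φ (x + t • e) e - L e))
      (s * fderiv ℝ (fderiv ℝ φ) x e e) 0 := by
    have h2 : HasFDerivAt (fderiv ℝ φ) (fderiv ℝ (fderiv ℝ φ) x) x :=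
      ((hφ.fderiv_right (m := 1) (by norm_num)).differentiableAt (by norm_num)).hasFDerivAt
    have h3 : HasDerivAt (fun t : ℝ => fderiv ℝ φ (x + t • e)) (fderiv ℝ (fderiv ℝ φ) x e) 0 :=
      h2.comp_hasDerivAt_of_eq 0 (hlined 0) (by simp)
    have h4 : HasDerivAt (fun t : ℝ => fderiv ℝ φ (x + t • e) e)
        (fderiv ℝ (fderiv ℝ φ) x e e) 0 :=
      (ContinuousLinearMap.apply ℝ ℝ e).hasFDerivAt.comp_hasDerivAt 0 h3
    exact (h4.sub_const (L e)).const_mul s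
  refine le_of_forall_pos_le_add fun κ hκ => ?_
  have h4 := taylor_two hF hF' (half_pos hκ)
  obtain ⟨t, ⟨h5, h6⟩, h7⟩ := ((eventually_nhdsWithin_of_eventually_nhds
    (h4.and (hline0.eventually h))).and (self_mem_nhdsWithin (s := Ioi (0 : ℝ)))).exists
  have ht : 0 < t := h7
  have h8 := (abs_le.1 h5).1
  simp only [zero_add, zero_smul, add_zero, hx, h1, sub_self, mul_zero, zero_mul, sub_zero] at h8
  have h9 : (s * fderiv ℝ (fderiv ℝ φ) x e e) / 2 * t ^ 2 ≤ κ / 2 * t ^ 2 := by linarith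
  have h10 := le_of_mul_le_mul_right h9 (by positivity)
  linarith

lemma inClosedCone_linear (hΓ : IsAdmissibleCone Γ) (hn : 0 < n) (hl : lambdaStar n ∈ closure Γ)
    (p : E n) : InClosedCone Γ fun h => ⟪p, h⟫ ^ 2 - ‖p‖ ^ 2 / 2 * ‖h‖ ^ 2 := by
  rcases eq_or_ne p 0 with rfl | hp
  · refine fun ε hε => ⟨EuclideanSpace.basisFun (Fin n) ℝ, fun _ => ε,
      hΓ.mem_of_pos fun _ => hε, fun h => ?_⟩
    rw [← Finset.mul_sum, sum_sq_inner]
    simp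
  · have hN : 0 < ‖p‖ := norm_pos_iff.2 hp
    have h1 : InClosedCone Γ (fun h => (-1) * ‖h‖ ^ 2 + (2 / ‖p‖ ^ 2) * ⟪p, h⟫ ^ 2) := by
      rw [inClosedCone_rankOne_iff hΓ hn hp, div_mul_cancel₀ _ (by positivity)]
      convert hl using 1
      funext i
      simp only [lambdaStar]
      norm_num
    refine h1.of_mul hΓ (t := ‖p‖ ^ 2 / 2) (by positivity) fun h => le_of_eq ?_
    field_simp
    ring

lemma not_inCone_linear (hΓ : IsAdmissibleCone Γ) (hn : 0 < n) (hl : lambdaStar n ∉ Γ)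
    (p : E n) : ¬ InCone Γ fun h => ⟪p, h⟫ ^ 2 - ‖p‖ ^ 2 / 2 * ‖h‖ ^ 2 := by
  intro hc
  rcases eq_or_ne p 0 with rfl | hp
  · refine hΓ.zero_notMem ((inCone_diagonal_iff hΓ (EuclideanSpace.basisFun (Fin n) ℝ) 0).1 ?_)
    exact hc.mono fun h => by simp
  · have hN : 0 < ‖p‖ := norm_pos_iff.2 hp
    have h1 : InCone Γ (fun h => (-1) * ‖h‖ ^ 2 + (2 / ‖p‖ ^ 2) * ⟪p, h⟫ ^ 2) := by
      refine hc.of_mul hΓ (t := 2 / ‖p‖ ^ 2) (by positivity) fun h => le_of_eq ?_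
      field_simp
      ring
    rw [inCone_rankOne_iff hΓ hn hp, div_mul_cancel₀ _ (by positivity)] at h1
    refine hl ?_
    convert h1 using 1
    funext i
    simp only [lambdaStar]
    norm_num

/-- Linear functions are solutions if `λ* ∈ ∂Γ`, since `A[v]` has then the eigenvalues `c λ*`
with `c ≥ 0`. -/
theorem isViscositySolution_linear (hΓ : IsAdmissibleCone Γ) (hn : 0 < n)
    (hl : lambdaStar n ∈ frontier Γ) (L : E n →ₗ[ℝ] ℝ) : IsViscositySolution Γ L := by
  rw [hΓ.isOpen.frontier_eq] at hl
  set L' : E n →L[ℝ] ℝ := LinearMap.toContinuousLinearMap L with hL'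
  have hLc : Continuous L := L'.continuous
  refine ⟨⟨hLc.lowerSemicontinuous, fun x φ hφ ht => ?_⟩,
    ⟨hLc.upperSemicontinuous, fun x φ hφ ht hmem => ?_⟩⟩
  · obtain ⟨h1, h2⟩ := touch_linear hφ L' one_ne_zero ht.1
      (by filter_upwards [ht.2] with z hz; rw [one_mul]; exact sub_nonpos.2 hz)
    rw [eigA, eigenvalues_mem_closure_iff hΓ]
    refine (inClosedCone_linear hΓ hn hl.1 (gradient φ x)).of_mul hΓ
      (Real.exp_pos (-2 * φ x)) fun h => ?_
    rw [matrixForm_mobiusHessian]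
    refine mul_le_mul_of_nonneg_left ?_ (Real.exp_pos _).le
    linarith [h2 h]
  · obtain ⟨h1, h2⟩ := touch_linear hφ L' (neg_ne_zero.2 one_ne_zero) ht.1
      (by
        filter_upwards [ht.2] with z hz
        have : L' z ≤ φ z := hz
        linarith)
    rw [eigA, eigenvalues_mem_iff hΓ] at hmem
    refine not_inCone_linear hΓ hn hl.2 (gradient φ x) (hmem.of_mul hΓ
      (Real.exp_pos (2 * φ x)) fun h => ?_)
    rw [matrixForm_mobiusHessian, ← mul_assoc, ← Real.exp_add,
      show 2 * φ x + -2 * φ x = 0 by ring, Real.exp_zero]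
    linarith [h2 h]

lemma exists_linear_not_isConstant (hn : 0 < n) :
    ∃ L : E n →ₗ[ℝ] ℝ, Continuous L ∧ ¬ IsConstant L := by
  let i : Fin n := ⟨0, hn⟩
  refine ⟨(EuclideanSpace.proj i : E n →L[ℝ] ℝ).toLinearMap,
    (EuclideanSpace.proj i : E n →L[ℝ] ℝ).continuous, ?_⟩
  rintro ⟨c, hc⟩
  have h0 := hc 0
  have h1 := hc (EuclideanSpace.single i 1)
  simp at h0 h1
  linarith

end MobiusLiouville

theorem theorem1p2 (n : ℕ) (hn : 2 ≤ n) (Γ : Set (Fin n → ℝ))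
    (hΓ : MobiusLiouville.IsAdmissibleCone Γ) :
    -- if `λ* ∉ ∂Γ`, entire continuous viscosity solutions of `λ(A[v]) ∈ ∂Γ` are constant
    (MobiusLiouville.lambdaStar n ∉ frontier Γ →
      ∀ v : MobiusLiouville.E n → ℝ, Continuous v →
        MobiusLiouville.IsViscositySolution Γ v → MobiusLiouville.IsConstant v) ∧
    -- if `-λ* ∉ ∂Γ`, entire continuous viscosity solutions of `λ(-A[v]) ∈ ∂Γ` are constant
    (-MobiusLiouville.lambdaStar n ∉ frontier Γ →
      ∀ v : MobiusLiouville.E n → ℝ, Continuous v →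
        MobiusLiouville.IsViscositySolutionNeg Γ v → MobiusLiouville.IsConstant v) ∧
    -- optimality: if `λ* ∈ ∂Γ`, linear functions are solutions and non-constant solutions exist
    (MobiusLiouville.lambdaStar n ∈ frontier Γ →
      (∀ L : MobiusLiouville.E n →ₗ[ℝ] ℝ, MobiusLiouville.IsViscositySolution Γ L) ∧
      ∃ v : MobiusLiouville.E n → ℝ, Continuous v ∧
        MobiusLiouville.IsViscositySolution Γ v ∧ ¬ MobiusLiouville.IsConstant v) ∧
    -- optimality: the same for `λ(-A[v]) ∈ ∂Γ` if `-λ* ∈ ∂Γ`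
    (-MobiusLiouville.lambdaStar n ∈ frontier Γ →
      (∀ L : MobiusLiouville.E n →ₗ[ℝ] ℝ, MobiusLiouville.IsViscositySolutionNeg Γ L) ∧
      ∃ v : MobiusLiouville.E n → ℝ, Continuous v ∧
        MobiusLiouville.IsViscositySolutionNeg Γ v ∧ ¬ MobiusLiouville.IsConstant v) := by
  have h0 : 0 < n := by omega
  refine ⟨fun hl v hc hv => hv.isConstant hΓ h0 hl hc, fun hl v hc hv => ?_, fun hl => ?_,
    fun hl => ?_⟩
  · refine MobiusLiouville.IsViscositySolution.isConstant hΓ.dualCone h0 ?_ hc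
      ((MobiusLiouville.isViscositySolutionNeg_iff hΓ).1 hv)
    rwa [hΓ.mem_frontier_dualCone]
  · have h := MobiusLiouville.isViscositySolution_linear hΓ h0 hl
    obtain ⟨L, hLc, hL⟩ := MobiusLiouville.exists_linear_not_isConstant h0
    exact ⟨h, L, hLc, h L, hL⟩
  · rw [← hΓ.mem_frontier_dualCone] at hl
    have h : ∀ L : MobiusLiouville.E n →ₗ[ℝ] ℝ, MobiusLiouville.IsViscositySolutionNeg Γ L :=
      fun L => (MobiusLiouville.isViscositySolutionNeg_iff hΓ).2
        (MobiusLiouville.isViscositySolution_linear hΓ.dualCone h0 hl L)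
    obtain ⟨L, hLc, hL⟩ := MobiusLiouville.exists_linear_not_isConstant h0
    exact ⟨h, L, hLc, h L, hL⟩
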